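/- Conventions. An $\omega$-category is a strict globular $\omega$-category in one-sorted form, all of whose cells have finite dimension; $s_n,t_n$ are the $n$-source and $n$-target and $*_n$ is the composition of $x,y$ with $t_nx=s_ny$. $\omega Cat$ is the category of $\omega$-categories and $\omega$-functors. It is non-contracting if $s_1x$ and $t_1x$ have dimension $1$ whenever $\dim x\ge 1$. For $n\ge 0$ let $I^n$ be the $\omega$-category of the $n$-cube and $\Delta^n$ that of the $n$-simplex (the $n$-th oriental). The faces of the $n$-cube are the words of length $n$ in $\{-,0,+\}$ (the dimension is the number of zeros); the source (target) of a face consists of the words in which its $k$-th zero is replaced by $(-)^k$ (by $(-)^{k+1}$). The faces of the $n$-simplex are the nonempty subsets of $\{0,\dots,n\}$; the source (target) of a face is obtained by removing a vertex in odd (even) position. The cells are closed sets of faces, generated by the sets $R(x)$ of subfaces of a face $x$, composition is union, and the $n$-dimensional faces of the $n$-source (target) of $R(x)$ are those $n$-dimensional $a\in R(x)$ such that, for every $(n+1)$-dimensional $b\in R(x)$ with $a\in R(b)$, $a$ is in the source (target) of $b$. For a non-contracting $\mathcal C$, the path $\omega$-category $\mathbb P\mathcal C$ consists of the cells of dimension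 $\ge 1$, with all degrees shifted down by one. Let $\mathcal R^-$ be the equivalence relation on $\mathbb P\mathcal C$ generated by $x\sim x*_0y$ ($x$, $y$, $x*_0y\in\mathbb P\mathcal C$), let $\mathbb U$ be the forgetful functor to globular sets, $\mathbb F$ its left adjoint, $\phi:\mathbb U\mathbb P\mathcal C\to\mathbb U\mathbb P\mathcal C/\mathcal R^-$ the projection and $\eta:\mathbb F\mathbb U\mathbb P\mathcal C\to\mathbb P\mathcal C$ the counit. The negative semi-path $\omega$-category $\mathbb P^-\mathcal C$ is the pushout of $\mathbb F(\phi)$ and $\eta$ in $\omega Cat$, with canonical $\omega$-functor $h^-:\mathbb P\mathcal C\to\mathbb P^-\mathcal C$. The $0$-source of $\mathcal C$ induces a grading of $\mathbb P^-\mathcal C$ by the $0$-cells of $\mathcal C$, and $\mathbb P^-_\alpha\mathcal C$ denotes the fiber over $\alpha$. Write $-_n$ for the word $-\cdots-$ of length $n$. Let $\delta^-_{i+1}:I^n\to I^{n+1}$ ($0\le i\le n$) and $\gamma^-_{i+1}:I^{n+2}\to I^{n+1}$ ($0\le i\le n$) be the $\omega$-functors given on faces by $$\delta^-_{i+1}(k_1\cdots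 k_n)=k_1\cdots k_i\,{-}\,k_{i+1}\cdots k_n,\qquad \gamma^-_{i+1}(k_1\cdots k_{n+2})=k_1\cdots k_i\max(k_{i+1},k_{i+2})k_{i+3}\cdots k_{n+2},$$ where $-<0<+$. An $\omega$-functor $g$ between fibers $\mathbb P^-_{R(-_m)}(I^m)\to\mathbb P^-_{R(-_l)}(I^l)$ is said to be induced by an $\omega$-functor $f:I^m\to I^l$ if, for every cell $x$ of $I^m$ with $\dim x\ge1$ and $s_0x=R(-_m)$, the cell $f(x)$ satisfies $\dim f(x)\ge1$, $s_0f(x)=R(-_l)$, and $g(h^-(x))=h^-(f(x))$. Statement. (1) For all $n\ge0$ and $0\le i\le n$, there is exactly one $\omega$-functor $\mathbb P^-_{R(-_n)}(I^n)\to\mathbb P^-_{R(-_{n+1})}(I^{n+1})$ that is induced by $\delta^-_{i+1}$. (2) For all $n\ge0$ and $0\le i\le n$, there is exactly one $\omega$-functor $\mathbb P^-_{R(-_{n+2})}(I^{n+2})\to\mathbb P^-_{R(-_{n+1})}(I^{n+1})$ that is induced by $\gamma^-_{i+1}$. (3) There is a functor $Q$ from the simplex category $\underline\Delta$ to $\omega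 Cat$ with $Q([n])=\mathbb P^-_{R(-_{n+1})}(I^{n+1})$ that sends the coface $\epsilon_i:[n]\to[n+1]$ ($0\le i\le n+1$) to an $\omega$-functor induced by $\delta^-_{i+1}$ and the codegeneracy $\eta_i:[n+1]\to[n]$ ($0\le i\le n$) to one induced by $\gamma^-_{i+1}$. Moreover there is an isomorphism of functors $\Delta^*\cong Q$, where $\Delta^*:\underline\Delta\to\omega Cat$ is the functor $[n]\mapsto\Delta^n$ for which a monotone map $f$ acts by $R(\sigma)\mapsto R(f(\sigma))$, and its component at $[n]$ sends $R(\sigma)$, for every face $\sigma$ of $\Delta^n$, to $h^-(R(\phi^-_n(\sigma)))$, where $\phi^-_n(\sigma)=k_1\cdots k_{n+1}$ with $k_{j+1}=0$ if $j\in\sigma$ and $k_{j+1}=-$ if $j\notin\sigma$. -/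

import Mathlib

open CategoryTheory

universe u

/-! ### Strict globular omega-categories (one-sorted) -/

/-- A strict globular `ω`-category in one-sorted form.  `d false n` is the `n`-source `sₙ`, `d true n`
is the `n`-target `tₙ`, and `comp n x y h` is `x *ₙ y`, defined when `tₙ x = sₙ y`. -/
structure OmegaCat where
  carrier : Type u
  d : Bool → ℕ → carrier → carrier
  comp : (n : ℕ) → (x y : carrier) → d true n x = d false n y → carrier
  d_d_lt : ∀ (α β : Bool) (m n : ℕ) (x : carrier), m < n → d β m (d α n x) = d β m x
  d_d_ge : ∀ (α β : Bool) (m n : ℕ) (x : carrier), n ≤ m → d β m (d α n x) = d α n x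
  source_comp : ∀ (n : ℕ) (x : carrier) (h : d true n (d false n x) = d false n x),
    comp n (d false n x) x h = x
  comp_target : ∀ (n : ℕ) (x : carrier) (h : d true n x = d false n (d true n x)),
    comp n x (d true n x) h = x
  d_source : ∀ (n : ℕ) (x y : carrier) (h : d true n x = d false n y),
    d false n (comp n x y h) = d false n x
  d_target : ∀ (n : ℕ) (x y : carrier) (h : d true n x = d false n y),
    d true n (comp n x y h) = d true n y
  d_comp : ∀ (α : Bool) (m n : ℕ) (x y : carrier) (h : d true n x = d false n y), m ≠ n →
    ∃ h' : d true n (d α m x) = d false n (d α m y),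
      d α m (comp n x y h) = comp n (d α m x) (d α m y) h'
  assoc : ∀ (n : ℕ) (x y z : carrier) (h₁ : d true n x = d false n y)
    (h₂ : d true n (comp n x y h₁) = d false n z) (h₃ : d true n y = d false n z)
    (h₄ : d true n x = d false n (comp n y z h₃)),
    comp n (comp n x y h₁) z h₂ = comp n x (comp n y z h₃) h₄
  interchange : ∀ (m n : ℕ) (x y z w : carrier), m ≠ n →
    ∀ (h₁ : d true n x = d false n y) (h₂ : d true n z = d false n w)
    (h₃ : d true m (comp n x y h₁) = d false m (comp n z w h₂))
    (h₄ : d true m x = d false m z) (h₅ : d true m y = d false m w)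
    (h₆ : d true n (comp m x z h₄) = d false n (comp m y w h₅)),
    comp m (comp n x y h₁) (comp n z w h₂) h₃ = comp n (comp m x z h₄) (comp m y w h₅) h₆
  finite_dim : ∀ x : carrier, ∃ n : ℕ, d false n x = x ∧ d true n x = x

namespace OmegaCat

/-- An `ω`-functor. -/
@[ext]
structure Hom (C D : OmegaCat.{u}) where
  toFun : C.carrier → D.carrier
  map_d : ∀ (α : Bool) (n : ℕ) (x : C.carrier), toFun (C.d α n x) = D.d α n (toFun x)
  map_comp : ∀ (n : ℕ) (x y : C.carrier) (h : C.d true n x = C.d false n y),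
    ∃ h' : D.d true n (toFun x) = D.d false n (toFun y),
      toFun (C.comp n x y h) = D.comp n (toFun x) (toFun y) h'

/-- The category `ωCat`. -/
instance : LargeCategory OmegaCat.{u} where
  Hom := Hom
  id C := ⟨fun x => x, fun _ _ _ => rfl, fun _ _ _ h => ⟨h, rfl⟩⟩
  comp f g := ⟨fun x => g.toFun (f.toFun x),
    fun α n x => by rw [f.map_d, g.map_d],
    fun n x y h => by
      obtain ⟨h₁, e₁⟩ := f.map_comp n x y h
      obtain ⟨h₂, e₂⟩ := g.map_comp n _ _ h₁
      exact ⟨h₂, by rw [e₁, e₂]⟩⟩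

@[ext]
theorem hom_ext {C D : OmegaCat.{u}} {f g : C ⟶ D} (h : ∀ x, Hom.toFun f x = Hom.toFun g x) :
    f = g :=
  Hom.ext (funext h)

@[simp]
theorem id_apply (C : OmegaCat.{u}) (x : C.carrier) : Hom.toFun (𝟙 C) x = x := rfl

@[simp]
theorem comp_apply {C D E : OmegaCat.{u}} (f : C ⟶ D) (g : D ⟶ E) (x : C.carrier) :
    Hom.toFun (f ≫ g) x = Hom.toFun g (Hom.toFun f x) := rfl

theorem comp_congr (C : OmegaCat.{u}) {n : ℕ} {x x' y y' : C.carrier} (hx : x = x') (hy : y = y')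
    (h : C.d true n x = C.d false n y) (h' : C.d true n x' = C.d false n y') :
    C.comp n x y h = C.comp n x' y' h' := by
  subst hx; subst hy; rfl

/-- The dimension of a cell: the smallest `n` with `sₙ x = tₙ x = x`. -/
noncomputable def dim (C : OmegaCat.{u}) (x : C.carrier) : ℕ :=
  sInf {n | C.d false n x = x ∧ C.d true n x = x}

theorem d_eq_self_of_dim_le (C : OmegaCat.{u}) {x : C.carrier} {n : ℕ} (h : C.dim x ≤ n)
    (α : Bool) : C.d α n x = x := by
  have hk : C.dim x ∈ {n | C.d false n x = x ∧ C.d true n x = x} := Nat.sInf_mem (C.finite_dim x)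
  conv_lhs => rw [← hk.1]
  rw [C.d_d_ge _ _ _ _ _ h, hk.1]

theorem dim_le_of_d_eq_self (C : OmegaCat.{u}) {x : C.carrier} {n : ℕ} {α : Bool}
    (h : C.d α n x = x) : C.dim x ≤ n := by
  refine Nat.sInf_le ⟨?_, ?_⟩
  · rw [← h, C.d_d_ge _ _ _ _ _ le_rfl]
  · rw [← h, C.d_d_ge _ _ _ _ _ le_rfl]

theorem dim_le_iff (C : OmegaCat.{u}) {x : C.carrier} {n : ℕ} (α : Bool) :
    C.dim x ≤ n ↔ C.d α n x = x :=
  ⟨fun h => C.d_eq_self_of_dim_le h α, C.dim_le_of_d_eq_self⟩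

/-- The sub-`ω`-category on a set of cells that is closed under sources, targets and composition. -/
def sub (C : OmegaCat.{u}) (S : C.carrier → Prop) (hd : ∀ α n x, S x → S (C.d α n x))
    (hc : ∀ n x y h, S x → S y → S (C.comp n x y h)) : OmegaCat.{u} where
  carrier := {x : C.carrier // S x}
  d α n x := ⟨C.d α n x.1, hd α n x.1 x.2⟩
  comp n x y h := ⟨C.comp n x.1 y.1 (congrArg Subtype.val h), hc n x.1 y.1 _ x.2 y.2⟩
  d_d_lt α β m n x h := Subtype.ext (C.d_d_lt α β m n x.1 h)
  d_d_ge α β m n x h := Subtype.ext (C.d_d_ge α β m n x.1 h)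
  source_comp n x h := Subtype.ext (C.source_comp n x.1 _)
  comp_target n x h := Subtype.ext (C.comp_target n x.1 _)
  d_source n x y h := Subtype.ext (C.d_source n x.1 y.1 _)
  d_target n x y h := Subtype.ext (C.d_target n x.1 y.1 _)
  d_comp α m n x y h hmn := by
    obtain ⟨h', e⟩ := C.d_comp α m n x.1 y.1 (congrArg Subtype.val h) hmn
    exact ⟨Subtype.ext h', Subtype.ext e⟩
  assoc n x y z _ _ _ _ := Subtype.ext (C.assoc n x.1 y.1 z.1 _ _ _ _)
  interchange m n x y z w hmn _ _ _ _ _ _ :=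
    Subtype.ext (C.interchange m n x.1 y.1 z.1 w.1 hmn _ _ _ _ _ _)
  finite_dim x := by
    obtain ⟨n, h₁, h₂⟩ := C.finite_dim x.1
    exact ⟨n, Subtype.ext h₁, Subtype.ext h₂⟩

/-- The smallest set of cells that contains `S` and is closed under sources, targets and
composition. -/
inductive Generated (C : OmegaCat.{u}) (S : C.carrier → Prop) : C.carrier → Prop
  | of (x : C.carrier) : S x → Generated C S x
  | d (α : Bool) (n : ℕ) (x : C.carrier) : Generated C S x → Generated C S (C.d α n x)
  | comp (n : ℕ) (x y : C.carrier) (h : C.d true n x = C.d false n y) :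
      Generated C S x → Generated C S y → Generated C S (C.comp n x y h)

/-- The sub-`ω`-category generated by a set of cells. -/
def generate (C : OmegaCat.{u}) (S : C.carrier → Prop) : OmegaCat.{u} :=
  C.sub (Generated C S) (fun α n x h => Generated.d α n x h)
    (fun n x y h hx hy => Generated.comp n x y h hx hy)

/-- The `ω`-category with set of cells `A`, all of dimension `0`. -/
def discrete (A : Type u) : OmegaCat.{u} where
  carrier := A
  d _ _ x := x
  comp _ x _ _ := x
  d_d_lt _ _ _ _ _ _ := rfl
  d_d_ge _ _ _ _ _ _ := rfl
  source_comp _ _ _ := rfl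
  comp_target _ _ _ := rfl
  d_source _ _ _ _ := rfl
  d_target _ _ _ h := h
  d_comp _ _ _ _ _ h _ := ⟨h, rfl⟩
  assoc _ _ _ _ _ _ _ _ := rfl
  interchange _ _ _ _ _ _ _ _ _ _ _ _ _ := rfl
  finite_dim _ := ⟨0, rfl, rfl⟩

/-! ### Presented omega-categories -/

/-- Formal expressions in a set `X` of generators. -/
inductive Term (X : Type u) : Type u
  | gen : X → Term X
  | bd : Bool → ℕ → Term X → Term X
  | comp : ℕ → Term X → Term X → Term X

/-- `TermEq r s t`: the expressions `s` and `t` are both meaningful, and they are equal, as a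
consequence of the relations `r` and of the axioms of `ω`-categories. -/
inductive TermEq {X : Type u} (r : Term X → Term X → Prop) : Term X → Term X → Prop
  | gen (x : X) : TermEq r (.gen x) (.gen x)
  | rel (s t : Term X) : r s t → TermEq r s t
  | symm (s t : Term X) : TermEq r s t → TermEq r t s
  | trans (s t v : Term X) : TermEq r s t → TermEq r t v → TermEq r s v
  | bd (α : Bool) (n : ℕ) (s t : Term X) : TermEq r s t → TermEq r (.bd α n s) (.bd α n t)
  | comp (n : ℕ) (s s' t t' : Term X) : TermEq r s s' → TermEq r t t' →
      TermEq r (.bd true n s) (.bd false n t) → TermEq r (.comp n s t) (.comp n s' t')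
  | bd_bd_lt (α β : Bool) (m n : ℕ) (s : Term X) : m < n → TermEq r s s →
      TermEq r (.bd β m (.bd α n s)) (.bd β m s)
  | bd_bd_ge (α β : Bool) (m n : ℕ) (s : Term X) : n ≤ m → TermEq r s s →
      TermEq r (.bd β m (.bd α n s)) (.bd α n s)
  | source_comp (n : ℕ) (s : Term X) : TermEq r s s →
      TermEq r (.comp n (.bd false n s) s) s
  | comp_target (n : ℕ) (s : Term X) : TermEq r s s →
      TermEq r (.comp n s (.bd true n s)) s
  | bd_source (n : ℕ) (s t : Term X) : TermEq r s s → TermEq r t t →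
      TermEq r (.bd true n s) (.bd false n t) →
      TermEq r (.bd false n (.comp n s t)) (.bd false n s)
  | bd_target (n : ℕ) (s t : Term X) : TermEq r s s → TermEq r t t →
      TermEq r (.bd true n s) (.bd false n t) →
      TermEq r (.bd true n (.comp n s t)) (.bd true n t)
  | bd_comp (α : Bool) (m n : ℕ) (s t : Term X) : m ≠ n → TermEq r s s → TermEq r t t →
      TermEq r (.bd true n s) (.bd false n t) →
      TermEq r (.bd α m (.comp n s t)) (.comp n (.bd α m s) (.bd α m t))
  | assoc (n : ℕ) (s t v : Term X) : TermEq r s s → TermEq r t t → TermEq r v v →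
      TermEq r (.bd true n s) (.bd false n t) → TermEq r (.bd true n t) (.bd false n v) →
      TermEq r (.comp n (.comp n s t) v) (.comp n s (.comp n t v))
  | interchange (m n : ℕ) (x y z w : Term X) : m ≠ n →
      TermEq r x x → TermEq r y y → TermEq r z z → TermEq r w w →
      TermEq r (.bd true n x) (.bd false n y) → TermEq r (.bd true n z) (.bd false n w) →
      TermEq r (.bd true m (.comp n x y)) (.bd false m (.comp n z w)) →
      TermEq r (.bd true m x) (.bd false m z) → TermEq r (.bd true m y) (.bd false m w) →
      TermEq r (.bd true n (.comp m x z)) (.bd false n (.comp m y w)) →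
      TermEq r (.comp m (.comp n x y) (.comp n z w)) (.comp n (.comp m x z) (.comp m y w))

/-- The meaningful expressions, with their equality. -/
def termSetoid {X : Type u} (r : Term X → Term X → Prop) : Setoid {t : Term X // TermEq r t t} where
  r s t := TermEq r s.1 t.1
  iseqv := ⟨fun s => s.2, fun h => .symm _ _ h, fun h k => .trans _ _ _ h k⟩

theorem TermEq.left {X : Type u} {r : Term X → Term X → Prop} {s t : Term X} (h : TermEq r s t) :
    TermEq r s s := .trans _ _ _ h (.symm _ _ h)

theorem TermEq.right {X : Type u} {r : Term X → Term X → Prop} {s t : Term X} (h : TermEq r s t) :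
    TermEq r t t := .trans _ _ _ (.symm _ _ h) h

section Presented

variable {X : Type u} (r : Term X → Term X → Prop)

/-- Cells of the presented `ω`-category. -/
abbrev PCell := Quotient (termSetoid r)

def PCell.mk (t : Term X) (h : TermEq r t t) : PCell r := Quotient.mk (termSetoid r) ⟨t, h⟩

theorem PCell.ind {p : PCell r → Prop} (h : ∀ t ht, p (PCell.mk r t ht)) (x : PCell r) : p x :=
  Quotient.ind (fun ⟨t, ht⟩ => h t ht) x

theorem PCell.mk_eq {s t : Term X} {hs : TermEq r s s} {ht : TermEq r t t} :
    PCell.mk r s hs = PCell.mk r t ht ↔ TermEq r s t :=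
  ⟨fun h => Quotient.exact h, fun h => Quotient.sound h⟩

def PCell.d (α : Bool) (n : ℕ) : PCell r → PCell r :=
  Quotient.map (fun t => ⟨.bd α n t.1, .bd α n _ _ t.2⟩) (fun _ _ h => .bd α n _ _ h)

theorem PCell.d_mk (α : Bool) (n : ℕ) (t : Term X) (h : TermEq r t t) :
    PCell.d r α n (PCell.mk r t h) = PCell.mk r (.bd α n t) (.bd α n _ _ h) := rfl

theorem PCell.out_comp (n : ℕ) (x y : PCell r) (h : PCell.d r true n x = PCell.d r false n y) :
    TermEq r (.bd true n x.out.1) (.bd false n y.out.1) := by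
  rw [← Quotient.out_eq x, ← Quotient.out_eq y] at h
  exact Quotient.exact h

noncomputable def PCell.comp (n : ℕ) (x y : PCell r)
    (h : PCell.d r true n x = PCell.d r false n y) : PCell r :=
  PCell.mk r (.comp n x.out.1 y.out.1)
    (.comp n _ _ _ _ x.out.2 y.out.2 (PCell.out_comp r n x y h))

theorem PCell.comp_mk (n : ℕ) (s t : Term X) (hs : TermEq r s s) (ht : TermEq r t t)
    (h : PCell.d r true n (PCell.mk r s hs) = PCell.d r false n (PCell.mk r t ht)) :
    PCell.comp r n (PCell.mk r s hs) (PCell.mk r t ht) h =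
      PCell.mk r (.comp n s t) (.comp n _ _ _ _ hs ht (Quotient.exact h)) := by
  refine (PCell.mk_eq r).2 (.comp n _ _ _ _ ?_ ?_ (PCell.out_comp r n _ _ h))
  · exact Quotient.exact (Quotient.out_eq (PCell.mk r s hs))
  · exact Quotient.exact (Quotient.out_eq (PCell.mk r t ht))

/-- Expressions of finite dimension. -/
def FinTerm (t : Term X) : Prop := ∃ n, ∀ α, TermEq r (.bd α n t) t

variable {r}

theorem FinTerm.congr {s t : Term X} (h : TermEq r s t) (hs : FinTerm r s) : FinTerm r t := by
  obtain ⟨n, hn⟩ := hs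
  exact ⟨n, fun α => .trans _ _ _ (.bd α n _ _ (.symm _ _ h)) (.trans _ _ _ (hn α) h)⟩

theorem FinTerm.up {t : Term X} {n k : ℕ} (hnk : n ≤ k) (h : ∀ α, TermEq r (.bd α n t) t)
    (α : Bool) : TermEq r (.bd α k t) t :=
  .trans _ _ _ (.bd α k _ _ (.symm _ _ (h false)))
    (.trans _ _ _ (.bd_bd_ge _ _ _ _ _ hnk (h false).right) (h false))

theorem FinTerm.bd {t : Term X} (h : TermEq r t t) (α : Bool) (n : ℕ) : FinTerm r (.bd α n t) :=
  ⟨n, fun _ => .bd_bd_ge _ _ _ _ _ le_rfl h⟩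

theorem FinTerm.comp {s t : Term X} {n : ℕ} (hs : TermEq r s s) (ht : TermEq r t t)
    (h : TermEq r (.bd true n s) (.bd false n t)) (fs : FinTerm r s) (ft : FinTerm r t) :
    FinTerm r (.comp n s t) := by
  obtain ⟨a, ha⟩ := fs
  obtain ⟨b, hb⟩ := ft
  refine ⟨a + b + n + 1, fun α => ?_⟩
  have h1 : TermEq r (.bd α (a + b + n + 1) s) s := FinTerm.up (by omega) ha α
  have h2 : TermEq r (.bd α (a + b + n + 1) t) t := FinTerm.up (by omega) hb α
  refine .trans _ _ _ (.bd_comp α _ n s t (by omega) hs ht h) (.comp n _ _ _ _ h1 h2 ?_)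
  exact .trans _ _ _ (.bd true n _ _ h1) (.trans _ _ _ h (.symm _ _ (.bd false n _ _ h2)))

theorem FinTerm.of_termEq (hgen : ∀ x, FinTerm r (.gen x))
    (hrel : ∀ s t, r s t → ∃ x, t = .gen x) {s t : Term X} (h : TermEq r s t) : FinTerm r s := by
  induction h with
  | gen x => exact hgen x
  | rel s t h =>
    obtain ⟨x, rfl⟩ := hrel s t h
    exact (hgen x).congr (.symm _ _ (.rel _ _ h))
  | symm s t h ih => exact ih.congr h
  | trans s t v _ _ ih _ => exact ih
  | bd α n s t h _ => exact .bd h.left α n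
  | comp n s s' t t' hs ht h ihs iht _ => exact .comp hs.left ht.left h ihs iht
  | bd_bd_lt α β m n s h hs ih => exact .bd (.bd _ _ _ _ hs) _ _
  | bd_bd_ge α β m n s h hs ih => exact .bd (.bd _ _ _ _ hs) _ _
  | source_comp n s hs ih => exact ih.congr (.symm _ _ (.source_comp _ _ hs))
  | comp_target n s hs ih => exact ih.congr (.symm _ _ (.comp_target _ _ hs))
  | bd_source n s t hs ht h _ _ _ => exact .bd (.comp n _ _ _ _ hs ht h) _ _
  | bd_target n s t hs ht h _ _ _ => exact .bd (.comp n _ _ _ _ hs ht h) _ _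
  | bd_comp α m n s t _ hs ht h _ _ _ => exact .bd (.comp n _ _ _ _ hs ht h) _ _
  | assoc n s t v hs ht hv h h' is it iv _ _ =>
    refine .comp (.comp n _ _ _ _ hs ht h) hv ?_ (.comp hs ht h is it) iv
    exact .trans _ _ _ (.bd_target n s t hs ht h) h'
  | interchange m n x y z w _ hx hy hz hw h₁ h₂ h₃ _ _ _ ix iy iz iw _ _ _ _ _ _ =>
    exact .comp (.comp n _ _ _ _ hx hy h₁) (.comp n _ _ _ _ hz hw h₂) h₃
      (.comp hx hy h₁ ix iy) (.comp hz hw h₂ iz iw)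

variable (r)

/-- The `ω`-category presented by generators and relations.  The relations have to bound the
dimension of every generator. -/
noncomputable def presented (hgen : ∀ x, FinTerm r (.gen x))
    (hrel : ∀ s t, r s t → ∃ x, t = .gen x) : OmegaCat.{u} where
  carrier := PCell r
  d := PCell.d r
  comp := PCell.comp r
  d_d_lt α β m n x h := by
    induction x using PCell.ind with | _ t ht =>
    exact (PCell.mk_eq r).2 (.bd_bd_lt _ _ _ _ _ h ht)
  d_d_ge α β m n x h := by
    induction x using PCell.ind with | _ t ht =>
    exact (PCell.mk_eq r).2 (.bd_bd_ge _ _ _ _ _ h ht)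
  source_comp n x h := by
    induction x using PCell.ind with | _ t ht =>
    simp only [PCell.d_mk] at h ⊢
    rw [PCell.comp_mk]
    exact (PCell.mk_eq r).2 (.source_comp _ _ ht)
  comp_target n x h := by
    induction x using PCell.ind with | _ t ht =>
    simp only [PCell.d_mk] at h ⊢
    rw [PCell.comp_mk]
    exact (PCell.mk_eq r).2 (.comp_target _ _ ht)
  d_source n x y h := by
    induction x using PCell.ind with | _ s hs =>
    induction y using PCell.ind with | _ t ht =>
    rw [PCell.comp_mk]
    exact (PCell.mk_eq r).2 (.bd_source _ _ _ hs ht (Quotient.exact h))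
  d_target n x y h := by
    induction x using PCell.ind with | _ s hs =>
    induction y using PCell.ind with | _ t ht =>
    rw [PCell.comp_mk]
    exact (PCell.mk_eq r).2 (.bd_target _ _ _ hs ht (Quotient.exact h))
  d_comp α m n x y h hmn := by
    induction x using PCell.ind with | _ s hs =>
    induction y using PCell.ind with | _ t ht =>
    have h0 : TermEq r (.bd true n s) (.bd false n t) := Quotient.exact h
    have key := TermEq.bd_comp (r := r) α m n s t hmn hs ht h0
    have h1 : TermEq r (.bd true n (.bd α m s)) (.bd false n (.bd α m t)) := by
      rcases lt_or_gt_of_ne hmn with hlt | hlt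
      · have e1 : TermEq r (.bd α m s) (.bd α m t) :=
          .trans _ _ _ (.symm _ _ (.bd_bd_lt true α m n s hlt hs))
            (.trans _ _ _ (.bd α m _ _ h0) (.bd_bd_lt false α m n t hlt ht))
        exact .trans _ _ _ (.bd_bd_ge _ _ _ _ _ hlt.le hs)
          (.trans _ _ _ e1 (.symm _ _ (.bd_bd_ge _ _ _ _ _ hlt.le ht)))
      · exact .trans _ _ _ (.bd_bd_lt _ _ _ _ _ hlt hs)
          (.trans _ _ _ h0 (.symm _ _ (.bd_bd_lt _ _ _ _ _ hlt ht)))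
    refine ⟨(PCell.mk_eq r).2 h1, ?_⟩
    simp only [PCell.comp_mk, PCell.d_mk]
    exact (PCell.mk_eq r).2 key
  assoc n x y z h₁ h₂ h₃ h₄ := by
    induction x using PCell.ind with | _ s hs =>
    induction y using PCell.ind with | _ t ht =>
    induction z using PCell.ind with | _ v hv =>
    simp only [PCell.comp_mk]
    exact (PCell.mk_eq r).2 (.assoc n s t v hs ht hv (Quotient.exact h₁) (Quotient.exact h₃))
  interchange m n x y z w hmn h₁ h₂ h₃ h₄ h₅ h₆ := by
    induction x using PCell.ind with | _ x hx =>
    induction y using PCell.ind with | _ y hy =>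
    induction z using PCell.ind with | _ z hz =>
    induction w using PCell.ind with | _ w hw =>
    simp only [PCell.comp_mk] at h₃ h₆ ⊢
    exact (PCell.mk_eq r).2 (.interchange m n x y z w hmn hx hy hz hw (Quotient.exact h₁)
      (Quotient.exact h₂) (Quotient.exact h₃) (Quotient.exact h₄) (Quotient.exact h₅)
      (Quotient.exact h₆))
  finite_dim x := by
    induction x using PCell.ind with | _ t ht =>
    obtain ⟨n, hn⟩ := FinTerm.of_termEq hgen hrel ht
    exact ⟨n, (PCell.mk_eq r).2 (hn false), (PCell.mk_eq r).2 (hn true)⟩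

end Presented

/-! The universal property of a presented `ω`-category. -/

open Classical in
/-- The value of an expression in an `ω`-category, if it has one. -/
noncomputable def Term.eval {X : Type u} {D : OmegaCat.{u}} (v : X → D.carrier) :
    Term X → Option D.carrier
  | .gen x => some (v x)
  | .bd α n t => (Term.eval v t).map (D.d α n)
  | .comp n s t => (Term.eval v s).bind fun a => (Term.eval v t).bind fun b =>
      if h : D.d true n a = D.d false n b then some (D.comp n a b h) else none

section Lift

variable {X : Type u} {r : Term X → Term X → Prop} {D : OmegaCat.{u}} (v : X → D.carrier)

theorem Term.eval_bd {t : Term X} {a : D.carrier} (h : t.eval v = some a) (α : Bool) (n : ℕ) :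
    (Term.bd α n t).eval v = some (D.d α n a) := by
  simp [Term.eval, h]

theorem Term.eval_comp {s t : Term X} {a b : D.carrier} (hs : s.eval v = some a)
    (ht : t.eval v = some b) {n : ℕ} (h : D.d true n a = D.d false n b) :
    (Term.comp n s t).eval v = some (D.comp n a b h) := by
  simp [Term.eval, hs, ht, h]

theorem TermEq.sound (hv : ∀ s t, r s t → ∃ a, s.eval v = some a ∧ t.eval v = some a)
    {s t : Term X} (h : TermEq r s t) : ∃ a, s.eval v = some a ∧ t.eval v = some a := by
  have cmp : ∀ {n : ℕ} {s t : Term X} {a b : D.carrier}, s.eval v = some a → t.eval v = some b →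
      (∃ c, (Term.bd true n s).eval v = some c ∧ (Term.bd false n t).eval v = some c) →
      D.d true n a = D.d false n b := by
    rintro n s t a b ha hb ⟨c, h₁, h₂⟩
    rw [Term.eval_bd v ha] at h₁
    rw [Term.eval_bd v hb] at h₂
    exact Option.some.inj (h₁.trans h₂.symm)
  induction h with
  | gen x => exact ⟨v x, rfl, rfl⟩
  | rel s t h => exact hv s t h
  | symm s t _ ih =>
    obtain ⟨a, h₁, h₂⟩ := ih
    exact ⟨a, h₂, h₁⟩
  | trans s t w _ _ ih ih' =>
    obtain ⟨a, h₁, h₂⟩ := ih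
    obtain ⟨b, h₃, h₄⟩ := ih'
    exact ⟨a, h₁, by rw [h₄, ← h₃, h₂]⟩
  | bd α n s t _ ih =>
    obtain ⟨a, h₁, h₂⟩ := ih
    exact ⟨_, Term.eval_bd v h₁ α n, Term.eval_bd v h₂ α n⟩
  | comp n s s' t t' _ _ _ ihs iht ih =>
    obtain ⟨a, h₁, h₂⟩ := ihs
    obtain ⟨b, h₃, h₄⟩ := iht
    have h := cmp h₁ h₃ ih
    exact ⟨_, Term.eval_comp v h₁ h₃ h, Term.eval_comp v h₂ h₄ h⟩
  | bd_bd_lt α β m n s h _ ih =>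
    obtain ⟨a, h₁, _⟩ := ih
    refine ⟨_, Term.eval_bd v (Term.eval_bd v h₁ α n) β m, ?_⟩
    rw [D.d_d_lt _ _ _ _ _ h]
    exact Term.eval_bd v h₁ β m
  | bd_bd_ge α β m n s h _ ih =>
    obtain ⟨a, h₁, _⟩ := ih
    refine ⟨_, Term.eval_bd v (Term.eval_bd v h₁ α n) β m, ?_⟩
    rw [D.d_d_ge _ _ _ _ _ h]
    exact Term.eval_bd v h₁ α n
  | source_comp n s _ ih =>
    obtain ⟨a, h₁, _⟩ := ih
    have h : D.d true n (D.d false n a) = D.d false n a := D.d_d_ge _ _ _ _ _ le_rfl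
    refine ⟨_, Term.eval_comp v (Term.eval_bd v h₁ false n) h₁ h, ?_⟩
    rw [D.source_comp, h₁]
  | comp_target n s _ ih =>
    obtain ⟨a, h₁, _⟩ := ih
    have h : D.d true n a = D.d false n (D.d true n a) := (D.d_d_ge _ _ _ _ _ le_rfl).symm
    refine ⟨_, Term.eval_comp v h₁ (Term.eval_bd v h₁ true n) h, ?_⟩
    rw [D.comp_target, h₁]
  | bd_source n s t _ _ _ ihs iht ih =>
    obtain ⟨a, h₁, _⟩ := ihs
    obtain ⟨b, h₃, _⟩ := iht
    have h := cmp h₁ h₃ ih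
    refine ⟨_, Term.eval_bd v (Term.eval_comp v h₁ h₃ h) _ _, ?_⟩
    rw [D.d_source, Term.eval_bd v h₁]
  | bd_target n s t _ _ _ ihs iht ih =>
    obtain ⟨a, h₁, _⟩ := ihs
    obtain ⟨b, h₃, _⟩ := iht
    have h := cmp h₁ h₃ ih
    refine ⟨_, Term.eval_bd v (Term.eval_comp v h₁ h₃ h) _ _, ?_⟩
    rw [D.d_target, Term.eval_bd v h₃]
  | bd_comp α m n s t hmn _ _ _ ihs iht ih =>
    obtain ⟨a, h₁, _⟩ := ihs
    obtain ⟨b, h₃, _⟩ := iht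
    have h := cmp h₁ h₃ ih
    obtain ⟨h', e⟩ := D.d_comp α m n a b h hmn
    refine ⟨_, Term.eval_bd v (Term.eval_comp v h₁ h₃ h) _ _, ?_⟩
    rw [e]
    exact Term.eval_comp v (Term.eval_bd v h₁ α m) (Term.eval_bd v h₃ α m) h'
  | assoc n s t w _ _ _ _ _ ihs iht ihw ih ih' =>
    obtain ⟨a, h₁, _⟩ := ihs
    obtain ⟨b, h₃, _⟩ := iht
    obtain ⟨c, h₅, _⟩ := ihw
    have h := cmp h₁ h₃ ih
    have h' := cmp h₃ h₅ ih'
    have k : D.d true n (D.comp n a b h) = D.d false n c := by rw [D.d_target, h']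
    have k' : D.d true n a = D.d false n (D.comp n b c h') := by rw [D.d_source, h]
    refine ⟨_, Term.eval_comp v (Term.eval_comp v h₁ h₃ h) h₅ k, ?_⟩
    rw [D.assoc n a b c h k h' k']
    exact Term.eval_comp v h₁ (Term.eval_comp v h₃ h₅ h') k'
  | interchange m n x y z w hmn _ _ _ _ _ _ _ _ _ _ ix iy iz iw i₁ i₂ i₃ i₄ i₅ i₆ =>
    obtain ⟨a, hx, _⟩ := ix
    obtain ⟨b, hy, _⟩ := iy
    obtain ⟨c, hz, _⟩ := iz
    obtain ⟨e, hw, _⟩ := iw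
    have h₁ := cmp hx hy i₁
    have h₂ := cmp hz hw i₂
    have h₄ := cmp hx hz i₄
    have h₅ := cmp hy hw i₅
    have h₃ := cmp (Term.eval_comp v hx hy h₁) (Term.eval_comp v hz hw h₂) i₃
    have h₆ := cmp (Term.eval_comp v hx hz h₄) (Term.eval_comp v hy hw h₅) i₆
    refine ⟨_, Term.eval_comp v (Term.eval_comp v hx hy h₁) (Term.eval_comp v hz hw h₂) h₃, ?_⟩
    rw [D.interchange m n a b c e hmn h₁ h₂ h₃ h₄ h₅ h₆]
    exact Term.eval_comp v (Term.eval_comp v hx hz h₄) (Term.eval_comp v hy hw h₅) h₆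

variable {v} in
theorem TermEq.exists_val (hv : ∀ s t, r s t → ∃ a, s.eval v = some a ∧ t.eval v = some a)
    (x : PCell r) : ∃ a, ∀ t ht, x = PCell.mk r t ht → t.eval v = some a := by
  induction x using PCell.ind with | _ s hs =>
  obtain ⟨a, ha, _⟩ := hs.sound v hv
  refine ⟨a, fun t ht h => ?_⟩
  obtain ⟨b, hb, hb'⟩ := TermEq.sound v hv ((PCell.mk_eq r).1 h)
  rw [hb', ← hb, ha]

/-- The `ω`-functor out of a presented `ω`-category that is given by the images of the
generators. -/
noncomputable def presentedLift (hgen : ∀ x, FinTerm r (.gen x))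
    (hrel : ∀ s t, r s t → ∃ x, t = .gen x)
    (hv : ∀ s t, r s t → ∃ a, s.eval v = some a ∧ t.eval v = some a) :
    presented r hgen hrel ⟶ D where
  toFun x := (TermEq.exists_val hv x).choose
  map_d α n x := by
    have key := (TermEq.exists_val hv x).choose_spec
    have key' := (TermEq.exists_val hv (PCell.d r α n x)).choose_spec
    induction x using PCell.ind with | _ t ht =>
    have h₁ := key t ht rfl
    have h₂ := key' (.bd α n t) (.bd α n _ _ ht) rfl
    rw [Term.eval_bd v h₁] at h₂
    exact (Option.some.inj h₂).symm
  map_comp n x y h := by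
    have key := (TermEq.exists_val hv x).choose_spec
    have key₂ := (TermEq.exists_val hv y).choose_spec
    have key₃ := (TermEq.exists_val hv (PCell.comp r n x y h)).choose_spec
    induction x using PCell.ind with | _ s hs =>
    induction y using PCell.ind with | _ t ht =>
    have h₁ := key s hs rfl
    have h₂ := key₂ t ht rfl
    have h0 : TermEq r (.bd true n s) (.bd false n t) := Quotient.exact h
    have h₃ := key₃ (.comp n s t) (.comp n _ _ _ _ hs ht h0) (PCell.comp_mk r n s t hs ht h)
    obtain ⟨a, e₁, e₂⟩ := TermEq.sound v hv h0
    rw [Term.eval_bd v h₁] at e₁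
    rw [Term.eval_bd v h₂] at e₂
    have h' := Option.some.inj (e₁.trans e₂.symm)
    rw [Term.eval_comp v h₁ h₂ h'] at h₃
    exact ⟨h', (Option.some.inj h₃).symm⟩

theorem presentedLift_gen (hgen : ∀ x, FinTerm r (.gen x))
    (hrel : ∀ s t, r s t → ∃ x, t = .gen x)
    (hv : ∀ s t, r s t → ∃ a, s.eval v = some a ∧ t.eval v = some a) (x : X) :
    Hom.toFun (presentedLift v hgen hrel hv) (PCell.mk r (.gen x) (.gen x)) = v x :=
  (Option.some.inj
    ((TermEq.exists_val hv (PCell.mk r (.gen x) (.gen x))).choose_spec (.gen x) (.gen x) rfl)).symm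

/-- A property of cells that holds for the generators and is stable under sources, targets and
composition holds for every cell of a presented `ω`-category. -/
theorem presented_induction {hgen : ∀ x, FinTerm r (.gen x)}
    {hrel : ∀ s t, r s t → ∃ x, t = .gen x} {p : (presented r hgen hrel).carrier → Prop}
    (gen : ∀ x, p (PCell.mk r (.gen x) (.gen x)))
    (bd : ∀ α n x, p x → p ((presented r hgen hrel).d α n x))
    (comp : ∀ n x y h, p x → p y → p ((presented r hgen hrel).comp n x y h)) (x) : p x := by
  let q : Term X → Prop := fun t => ∀ ht, p (PCell.mk r t ht)
  have cg : ∀ {s t : Term X}, TermEq r s t → q s → q t := fun {s t} h hs ht => by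
    have e : PCell.mk r s h.left = PCell.mk r t ht := (PCell.mk_eq r).2 h
    exact e ▸ hs h.left
  have qb : ∀ {t : Term X} (α n), TermEq r t t → q t → q (.bd α n t) := fun α n ht hq _ =>
    bd α n _ (hq ht)
  have qc : ∀ {s t : Term X} {n}, TermEq r s s → TermEq r t t →
      TermEq r (.bd true n s) (.bd false n t) → q s → q t → q (.comp n s t) :=
    fun {s t n} hs ht h qs qt _ => by
      have h' : PCell.d r true n (PCell.mk r s hs) = PCell.d r false n (PCell.mk r t ht) :=
        (PCell.mk_eq r).2 h
      have e := PCell.comp_mk r n s t hs ht h'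
      exact e ▸ comp n (PCell.mk r s hs) (PCell.mk r t ht) h' (qs hs) (qt ht)
  have main : ∀ {s t : Term X}, TermEq r s t → q s := by
    intro s t h
    induction h with
    | gen x => exact fun _ => gen x
    | rel s t h =>
      obtain ⟨x, rfl⟩ := hrel s t h
      exact cg (.symm _ _ (.rel _ _ h)) (fun _ => gen x)
    | symm s t h ih => exact cg h ih
    | trans s t v _ _ ih _ => exact ih
    | bd α n s t h ih => exact qb α n h.left ih
    | comp n s s' t t' hs ht h ihs iht _ => exact qc hs.left ht.left h ihs iht
    | bd_bd_lt α β m n s h hs ih => exact qb _ _ (.bd _ _ _ _ hs) (qb _ _ hs ih)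
    | bd_bd_ge α β m n s h hs ih => exact qb _ _ (.bd _ _ _ _ hs) (qb _ _ hs ih)
    | source_comp n s hs ih => exact cg (.symm _ _ (.source_comp _ _ hs)) ih
    | comp_target n s hs ih => exact cg (.symm _ _ (.comp_target _ _ hs)) ih
    | bd_source n s t hs ht h is it _ =>
      exact qb _ _ (.comp n _ _ _ _ hs ht h) (qc hs ht h is it)
    | bd_target n s t hs ht h is it _ =>
      exact qb _ _ (.comp n _ _ _ _ hs ht h) (qc hs ht h is it)
    | bd_comp α m n s t _ hs ht h is it _ =>
      exact qb _ _ (.comp n _ _ _ _ hs ht h) (qc hs ht h is it)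
    | assoc n s t v hs ht hv h h' is it iv _ _ =>
      refine qc (.comp n _ _ _ _ hs ht h) hv ?_ (qc hs ht h is it) iv
      exact .trans _ _ _ (.bd_target n s t hs ht h) h'
    | interchange m n x y z w _ hx hy hz hw h₁ h₂ h₃ _ _ _ ix iy iz iw _ _ _ _ _ _ =>
      exact qc (.comp n _ _ _ _ hx hy h₁) (.comp n _ _ _ _ hz hw h₂) h₃
        (qc hx hy h₁ ix iy) (qc hz hw h₂ iz iw)
  induction x using PCell.ind with | _ t ht =>
  exact main ht ht

theorem presented_hom_ext {hgen : ∀ x, FinTerm r (.gen x)}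
    {hrel : ∀ s t, r s t → ∃ x, t = .gen x} {f g : presented r hgen hrel ⟶ D}
    (h : ∀ x, Hom.toFun f (PCell.mk r (.gen x) (.gen x)) =
      Hom.toFun g (PCell.mk r (.gen x) (.gen x))) : f = g := by
  refine hom_ext (presented_induction h (fun α n x hx => ?_) (fun n x y hxy hx hy => ?_))
  · rw [f.map_d, g.map_d, hx]
  · obtain ⟨h₁, e₁⟩ := f.map_comp n x y hxy
    obtain ⟨h₂, e₂⟩ := g.map_comp n x y hxy
    rw [e₁, e₂]
    exact D.comp_congr hx hy _ _

end Lift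

end OmegaCat

/-! ### Globular sets and the free omega-category on a globular set -/

/-- A globular set. -/
structure GlobularSet where
  cells : ℕ → Type u
  bd : Bool → (n : ℕ) → cells (n + 1) → cells n
  bd_bd : ∀ (α β : Bool) (n : ℕ) (x : cells (n + 2)),
    bd α n (bd β (n + 1) x) = bd α n (bd α (n + 1) x)

namespace GlobularSet

/-- A morphism of globular sets. -/
@[ext]
structure Hom (G H : GlobularSet.{u}) where
  app : (n : ℕ) → G.cells n → H.cells n
  app_bd : ∀ (α : Bool) (n : ℕ) (x : G.cells (n + 1)),
    app n (G.bd α n x) = H.bd α n (app (n + 1) x)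

instance : LargeCategory GlobularSet.{u} where
  Hom := Hom
  id G := ⟨fun _ x => x, fun _ _ _ => rfl⟩
  comp f g := ⟨fun n x => g.app n (f.app n x), fun α n x => by rw [f.app_bd, g.app_bd]⟩

@[ext]
theorem hom_ext {G H : GlobularSet.{u}} {f g : G ⟶ H}
    (h : ∀ n x, Hom.app f n x = Hom.app g n x) : f = g :=
  Hom.ext (funext fun n => funext (h n))

end GlobularSet

namespace OmegaCat

/-- The underlying globular set of an `ω`-category: its `n`-cells are the cells of dimension at
most `n`. -/
def underlying : OmegaCat.{u} ⥤ GlobularSet.{u} where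
  obj C :=
    { cells := fun n => {x : C.carrier // C.dim x ≤ n}
      bd := fun α n x =>
        ⟨C.d α n x.1, C.dim_le_of_d_eq_self (α := α) (C.d_d_ge _ _ _ _ _ le_rfl)⟩
      bd_bd := fun α β n x => Subtype.ext (by
        simp only [C.d_d_lt _ _ _ _ _ (Nat.lt_succ_self n)]) }
  map f :=
    { app := fun n x => ⟨Hom.toFun f x.1, (dim_le_iff _ true).2 (by
        rw [← Hom.map_d, (dim_le_iff _ true).1 x.2])⟩
      app_bd := fun α n x => Subtype.ext (Hom.map_d f α n x.1) }

/-- The relations between the cells of a globular set in the free `ω`-category. -/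
inductive FreeRel (G : GlobularSet.{u}) :
    Term (Σ n, G.cells n) → Term (Σ n, G.cells n) → Prop
  | dim (α : Bool) (n : ℕ) (x : G.cells n) : FreeRel G (.bd α n (.gen ⟨n, x⟩)) (.gen ⟨n, x⟩)
  | bd (α : Bool) (n : ℕ) (x : G.cells (n + 1)) :
      FreeRel G (.bd α n (.gen ⟨n + 1, x⟩)) (.gen ⟨n, G.bd α n x⟩)

/-- The free `ω`-category generated by a globular set. -/
noncomputable def freeObj (G : GlobularSet.{u}) : OmegaCat.{u} :=
  presented (FreeRel G) (fun x => ⟨x.1, fun α => .rel _ _ (.dim α x.1 x.2)⟩)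
    (fun _ _ h => by cases h <;> exact ⟨_, rfl⟩)

/-- A generating cell of the free `ω`-category. -/
def freeCell (G : GlobularSet.{u}) (n : ℕ) (x : G.cells n) : (freeObj G).carrier :=
  PCell.mk (FreeRel G) (.gen ⟨n, x⟩) (.gen _)

theorem freeCell_dim (G : GlobularSet.{u}) (n : ℕ) (x : G.cells n) :
    (freeObj G).dim (freeCell G n x) ≤ n :=
  dim_le_of_d_eq_self (α := true) _ ((PCell.mk_eq _).2 (.rel _ _ (.dim true n x)))

theorem freeCell_bd (G : GlobularSet.{u}) (α : Bool) (n : ℕ) (x : G.cells (n + 1)) :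
    freeCell G n (G.bd α n x) = (freeObj G).d α n (freeCell G (n + 1) x) :=
  (PCell.mk_eq _).2 (.symm _ _ (.rel _ _ (.bd α n x)))

/-- The `ω`-functor out of the free `ω`-category that extends a morphism of globular sets. -/
noncomputable def freeLift {G : GlobularSet.{u}} {C : OmegaCat.{u}} (g : G ⟶ underlying.obj C) :
    freeObj G ⟶ C :=
  presentedLift (fun x => (GlobularSet.Hom.app g x.1 x.2).1) _ _ (by
    intro s t h
    cases h with
    | dim α n x =>
      refine ⟨_, Term.eval_bd _ rfl α n, ?_⟩
      exact congrArg some ((dim_le_iff _ α).1 (GlobularSet.Hom.app g n x).2).symm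
    | bd α n x =>
      refine ⟨_, Term.eval_bd _ rfl α n, ?_⟩
      exact congrArg some (congrArg Subtype.val (GlobularSet.Hom.app_bd g α n x)))

theorem freeLift_freeCell {G : GlobularSet.{u}} {C : OmegaCat.{u}} (g : G ⟶ underlying.obj C)
    (n : ℕ) (x : G.cells n) :
    Hom.toFun (freeLift g) (freeCell G n x) = (GlobularSet.Hom.app g n x).1 :=
  presentedLift_gen (fun x : (Σ n, G.cells n) => (GlobularSet.Hom.app g x.1 x.2).1) _ _ _ ⟨n, x⟩

/-- `ω`-functors out of the free `ω`-category on `G` are the same as morphisms of globular sets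
out of `G`. -/
noncomputable def freeEquiv (G : GlobularSet.{u}) (C : OmegaCat.{u}) :
    (freeObj G ⟶ C) ≃ (G ⟶ underlying.obj C) where
  toFun f :=
    { app := fun n x => ⟨Hom.toFun f (freeCell G n x), (dim_le_iff _ true).2 (by
        rw [← Hom.map_d, (dim_le_iff _ true).1 (freeCell_dim G n x)])⟩
      app_bd := fun α n x => Subtype.ext (by
        simp only [freeCell_bd, Hom.map_d]; rfl) }
  invFun g := freeLift g
  left_inv f := presented_hom_ext fun x => freeLift_freeCell _ x.1 x.2
  right_inv g := GlobularSet.hom_ext fun n x => Subtype.ext (freeLift_freeCell g n x)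

theorem freeEquiv_comp (G : GlobularSet.{u}) (C D : OmegaCat.{u}) (g : C ⟶ D)
    (f : freeObj G ⟶ C) : freeEquiv G D (f ≫ g) = freeEquiv G C f ≫ underlying.map g := rfl

/-- The free `ω`-category functor. -/
noncomputable def free : GlobularSet.{u} ⥤ OmegaCat.{u} :=
  Adjunction.leftAdjointOfEquiv (G := underlying) (F_obj := freeObj) freeEquiv freeEquiv_comp

/-- The free `ω`-category functor is left adjoint to the forgetful functor. -/
noncomputable def freeAdjunction : free.{u} ⊣ underlying.{u} :=
  Adjunction.adjunctionOfEquivLeft freeEquiv freeEquiv_comp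

/-! ### Pushouts of omega-categories -/

section Pushout

variable {A B C : OmegaCat.{u}} (f : A ⟶ B) (g : A ⟶ C)

/-- The relations of the pushout of `f` and `g`. -/
inductive PushoutRel : Term (B.carrier ⊕ C.carrier) → Term (B.carrier ⊕ C.carrier) → Prop
  | bd_inl (α : Bool) (n : ℕ) (x : B.carrier) :
      PushoutRel (.bd α n (.gen (.inl x))) (.gen (.inl (B.d α n x)))
  | bd_inr (α : Bool) (n : ℕ) (x : C.carrier) :
      PushoutRel (.bd α n (.gen (.inr x))) (.gen (.inr (C.d α n x)))
  | comp_inl (n : ℕ) (x y : B.carrier) (h : B.d true n x = B.d false n y) :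
      PushoutRel (.comp n (.gen (.inl x)) (.gen (.inl y))) (.gen (.inl (B.comp n x y h)))
  | comp_inr (n : ℕ) (x y : C.carrier) (h : C.d true n x = C.d false n y) :
      PushoutRel (.comp n (.gen (.inr x)) (.gen (.inr y))) (.gen (.inr (C.comp n x y h)))
  | glue (a : A.carrier) : PushoutRel (.gen (.inl (Hom.toFun f a))) (.gen (.inr (Hom.toFun g a)))

/-- An explicit pushout of `f` and `g`. -/
noncomputable def pushoutObj : OmegaCat.{u} :=
  presented (PushoutRel f g)
    (by
      rintro (x | x)
      · obtain ⟨n, h₁, h₂⟩ := B.finite_dim x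
        refine ⟨n, fun α => ?_⟩
        have h := TermEq.rel _ _ (PushoutRel.bd_inl (f := f) (g := g) α n x)
        rwa [show B.d α n x = x by cases α <;> assumption] at h
      · obtain ⟨n, h₁, h₂⟩ := C.finite_dim x
        refine ⟨n, fun α => ?_⟩
        have h := TermEq.rel _ _ (PushoutRel.bd_inr (f := f) (g := g) α n x)
        rwa [show C.d α n x = x by cases α <;> assumption] at h)
    (fun _ _ h => by cases h <;> exact ⟨_, rfl⟩)

noncomputable def pushoutInl : B ⟶ pushoutObj f g where
  toFun x := PCell.mk (PushoutRel f g) (.gen (.inl x)) (.gen _)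
  map_d α n x := (PCell.mk_eq _).2 (.symm _ _ (.rel _ _ (.bd_inl α n x)))
  map_comp n x y h := by
    have h' : PCell.d (PushoutRel f g) true n (PCell.mk _ (.gen (.inl x)) (.gen _)) =
        PCell.d (PushoutRel f g) false n (PCell.mk _ (.gen (.inl y)) (.gen _)) :=
      (PCell.mk_eq _).2 (.trans _ _ _ (.rel _ _ (.bd_inl true n x))
        (by rw [h]; exact .symm _ _ (.rel _ _ (.bd_inl false n y))))
    refine ⟨h', Eq.trans ?_ (PCell.comp_mk _ n _ _ _ _ h').symm⟩
    exact (PCell.mk_eq _).2 (.symm _ _ (.rel _ _ (.comp_inl n x y h)))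

noncomputable def pushoutInr : C ⟶ pushoutObj f g where
  toFun x := PCell.mk (PushoutRel f g) (.gen (.inr x)) (.gen _)
  map_d α n x := (PCell.mk_eq _).2 (.symm _ _ (.rel _ _ (.bd_inr α n x)))
  map_comp n x y h := by
    have h' : PCell.d (PushoutRel f g) true n (PCell.mk _ (.gen (.inr x)) (.gen _)) =
        PCell.d (PushoutRel f g) false n (PCell.mk _ (.gen (.inr y)) (.gen _)) :=
      (PCell.mk_eq _).2 (.trans _ _ _ (.rel _ _ (.bd_inr true n x))
        (by rw [h]; exact .symm _ _ (.rel _ _ (.bd_inr false n y))))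
    refine ⟨h', Eq.trans ?_ (PCell.comp_mk _ n _ _ _ _ h').symm⟩
    exact (PCell.mk_eq _).2 (.symm _ _ (.rel _ _ (.comp_inr n x y h)))

variable {f g} in
/-- The `ω`-functor out of the explicit pushout that is given by a commutative square. -/
noncomputable def pushoutDesc {D : OmegaCat.{u}} (p : B ⟶ D) (q : C ⟶ D) (w : f ≫ p = g ≫ q) :
    pushoutObj f g ⟶ D :=
  presentedLift (Sum.elim (Hom.toFun p) (Hom.toFun q)) _ _ (by
    intro t t' h
    cases h with
    | bd_inl α n x => exact ⟨_, Term.eval_bd _ rfl α n, congrArg some (Hom.map_d p α n x)⟩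
    | bd_inr α n x => exact ⟨_, Term.eval_bd _ rfl α n, congrArg some (Hom.map_d q α n x)⟩
    | comp_inl n x y h =>
      obtain ⟨h', e⟩ := Hom.map_comp p n x y h
      exact ⟨_, Term.eval_comp _ rfl rfl h', congrArg some e⟩
    | comp_inr n x y h =>
      obtain ⟨h', e⟩ := Hom.map_comp q n x y h
      exact ⟨_, Term.eval_comp _ rfl rfl h', congrArg some e⟩
    | glue a => exact ⟨_, rfl, congrArg some (congrArg (fun k => Hom.toFun k a) w).symm⟩)

theorem pushoutObj_isPushout : IsPushout f g (pushoutInl f g) (pushoutInr f g) := by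
  have gen : ∀ (s : Limits.PushoutCocone f g) (x : B.carrier ⊕ C.carrier),
      Hom.toFun (pushoutDesc s.inl s.inr s.condition) (PCell.mk (PushoutRel f g) (.gen x) (.gen x))
        = Sum.elim (Hom.toFun s.inl) (Hom.toFun s.inr) x :=
    fun s x => presentedLift_gen (Sum.elim (Hom.toFun s.inl) (Hom.toFun s.inr)) _ _ _ x
  refine IsPushout.of_isColimit' ⟨?_⟩ (Limits.PushoutCocone.IsColimit.mk _
    (fun s => pushoutDesc s.inl s.inr s.condition) ?_ ?_ ?_)
  · exact hom_ext fun a => (PCell.mk_eq _).2 (.rel _ _ (.glue a))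
  · exact fun s => hom_ext fun x => gen s (.inl x)
  · exact fun s => hom_ext fun x => gen s (.inr x)
  · intro s m h₁ h₂
    refine presented_hom_ext ?_
    rintro (x | x)
    · exact (congrArg (fun k => Hom.toFun k x) h₁).trans (gen s (.inl x)).symm
    · exact (congrArg (fun k => Hom.toFun k x) h₂).trans (gen s (.inr x)).symm

instance : Limits.HasPushout f g := (pushoutObj_isPushout f g).hasPushout

end Pushout

/-! ### The negative semi-path omega-category -/

/-- A non-contracting `ω`-category. -/
def NonContracting (C : OmegaCat.{u}) : Prop :=
  ∀ x : C.carrier, 1 ≤ C.dim x → ∀ α : Bool, C.dim (C.d α 1 x) = 1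

theorem NonContracting.dim_d {C : OmegaCat.{u}} (hC : C.NonContracting) {x : C.carrier}
    (hx : 1 ≤ C.dim x) (α : Bool) (n : ℕ) : 1 ≤ C.dim (C.d α (n + 1) x) := by
  by_contra h
  have h0 : C.dim (C.d α (n + 1) x) ≤ 0 := by omega
  have h1 := C.d_eq_self_of_dim_le (h0.trans (Nat.zero_le 1)) α
  have h2 : C.d α 1 (C.d α (n + 1) x) = C.d α 1 x := by
    rcases n with _ | n
    · exact C.d_d_ge _ _ _ _ _ le_rfl
    · exact C.d_d_lt _ _ _ _ _ (by omega)
  have := hC x hx α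
  rw [← h2, h1] at this
  omega

theorem NonContracting.dim_comp {C : OmegaCat.{u}} (hC : C.NonContracting) {x y : C.carrier}
    (hx : 1 ≤ C.dim x) (n : ℕ) (h : C.d true (n + 1) x = C.d false (n + 1) y) :
    1 ≤ C.dim (C.comp (n + 1) x y h) := by
  by_contra h'
  have h0 : C.dim (C.comp (n + 1) x y h) ≤ n + 1 := by omega
  have h1 := C.d_eq_self_of_dim_le h0 false
  rw [C.d_source] at h1
  have := hC.dim_d hx false n
  rw [h1] at this
  exact h' this

/-- The path `ω`-category `ℙC`: its cells are the cells of `C` of dimension at least `1`, and its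
`n`-source, `n`-target and `n`-composition are those of `C` in degree `n + 1`. -/
def path (C : OmegaCat.{u}) (hC : C.NonContracting) : OmegaCat.{u} where
  carrier := {x : C.carrier // 1 ≤ C.dim x}
  d α n x := ⟨C.d α (n + 1) x.1, hC.dim_d x.2 α n⟩
  comp n x y h := ⟨C.comp (n + 1) x.1 y.1 (congrArg Subtype.val h), hC.dim_comp x.2 n _⟩
  d_d_lt α β m n x h := Subtype.ext (C.d_d_lt α β _ _ x.1 (Nat.succ_lt_succ h))
  d_d_ge α β m n x h := Subtype.ext (C.d_d_ge α β _ _ x.1 (Nat.succ_le_succ h))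
  source_comp n x h := Subtype.ext (C.source_comp _ x.1 _)
  comp_target n x h := Subtype.ext (C.comp_target _ x.1 _)
  d_source n x y h := Subtype.ext (C.d_source _ x.1 y.1 _)
  d_target n x y h := Subtype.ext (C.d_target _ x.1 y.1 _)
  d_comp α m n x y h hmn := by
    obtain ⟨h', e⟩ := C.d_comp α (m + 1) (n + 1) x.1 y.1 (congrArg Subtype.val h) (by omega)
    exact ⟨Subtype.ext h', Subtype.ext e⟩
  assoc n x y z _ _ _ _ := Subtype.ext (C.assoc _ x.1 y.1 z.1 _ _ _ _)
  interchange m n x y z w hmn _ _ _ _ _ _ :=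
    Subtype.ext (C.interchange _ _ x.1 y.1 z.1 w.1 (by omega) _ _ _ _ _ _)
  finite_dim x := by
    obtain ⟨n, h₁, h₂⟩ := C.finite_dim x.1
    refine ⟨n, Subtype.ext ?_, Subtype.ext ?_⟩
    · exact C.d_eq_self_of_dim_le ((C.dim_le_of_d_eq_self h₁).trans (Nat.le_succ n)) false
    · exact C.d_eq_self_of_dim_le ((C.dim_le_of_d_eq_self h₁).trans (Nat.le_succ n)) true

section SemiPath

variable (C : OmegaCat.{u}) (hC : C.NonContracting)

/-- The pairs `(x, x *₀ y)` with `x`, `y` and `x *₀ y` in `ℙC`. -/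
def GermStep (a b : (C.path hC).carrier) : Prop :=
  ∃ (y : (C.path hC).carrier) (h : C.d true 0 a.1 = C.d false 0 y.1), b.1 = C.comp 0 a.1 y.1 h

/-- The equivalence relation `R⁻` on the cells of `ℙC`. -/
def GermRel : (C.path hC).carrier → (C.path hC).carrier → Prop :=
  Relation.EqvGen (C.GermStep hC)

variable {C hC} in
theorem GermRel.d {a b : (C.path hC).carrier} (h : C.GermRel hC a b) (α : Bool) (n : ℕ) :
    C.GermRel hC ((C.path hC).d α n a) ((C.path hC).d α n b) := by
  induction h with
  | rel a b h =>
    obtain ⟨y, h, e⟩ := h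
    refine .rel _ _ ⟨(C.path hC).d α n y, ?_, ?_⟩
    · exact (C.d_comp α (n + 1) 0 a.1 y.1 h (by omega)).choose
    · change C.d α (n + 1) b.1 = _
      rw [e]
      exact (C.d_comp α (n + 1) 0 a.1 y.1 h (by omega)).choose_spec
  | refl a => exact .refl _
  | symm a b _ ih => exact .symm _ _ ih
  | trans a b c _ _ ih ih' => exact .trans _ _ _ ih ih'

/-- The relation `R⁻` on the `n`-cells of the underlying globular set of `ℙC`. -/
def germSetoid (n : ℕ) : Setoid ((underlying.obj (C.path hC)).cells n) where
  r a b := C.GermRel hC a.1 b.1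
  iseqv := ⟨fun _ => .refl _, fun h => .symm _ _ h, fun h h' => .trans _ _ _ h h'⟩

/-- The quotient of the underlying globular set of `ℙC` by `R⁻`. -/
def germGlobularSet : GlobularSet.{u} where
  cells n := Quotient (C.germSetoid hC n)
  bd α n := Quotient.map ((underlying.obj (C.path hC)).bd α n)
    (fun _ _ h => GermRel.d h α n)
  bd_bd α β n x := by
    induction x using Quotient.inductionOn with | _ x =>
    exact congrArg (Quotient.mk _) ((underlying.obj (C.path hC)).bd_bd α β n x)

/-- The canonical morphism of globular sets to the quotient by `R⁻`. -/
def germProj : underlying.obj (C.path hC) ⟶ C.germGlobularSet hC where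
  app n x := Quotient.mk (C.germSetoid hC n) x
  app_bd _ _ _ := rfl

/-- The negative semi-path `ω`-category `ℙ⁻C`: the pushout of the morphism that the projection
induces on free `ω`-categories, and the counit of the free-forgetful adjunction at `ℙC`. -/
noncomputable def semiPath : OmegaCat.{u} :=
  Limits.pushout (free.map (C.germProj hC)) (freeAdjunction.counit.app (C.path hC))

/-- The canonical `ω`-functor `h⁻ : ℙC ⟶ ℙ⁻C`. -/
noncomputable def toSemiPath : C.path hC ⟶ C.semiPath hC :=
  Limits.pushout.inr (free.map (C.germProj hC)) (freeAdjunction.counit.app (C.path hC))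

/-- The `0`-source as an `ω`-functor on `ℙC`. -/
def pathStart : C.path hC ⟶ discrete C.carrier where
  toFun x := C.d false 0 x.1
  map_d α n x := C.d_d_lt _ _ _ _ _ (Nat.succ_pos n)
  map_comp n x y h := by
    have h' : C.d false 0 x.1 = C.d false 0 y.1 := by
      have e := congrArg (C.d false 0) (congrArg Subtype.val h)
      have e₁ := C.d_d_lt true false 0 (n + 1) x.1 (Nat.succ_pos n)
      have e₂ := C.d_d_lt false false 0 (n + 1) y.1 (Nat.succ_pos n)
      exact e₁.symm.trans (e.trans e₂)
    refine ⟨h', ?_⟩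
    obtain ⟨h'', e⟩ := C.d_comp false 0 (n + 1) x.1 y.1 (congrArg Subtype.val h) (by omega)
    have e₁ := C.d_source (n + 1) x.1 y.1 (congrArg Subtype.val h)
    have e₂ := congrArg (C.d false 0) e₁
    rw [C.d_d_lt _ _ _ _ _ (Nat.succ_pos n), C.d_d_lt _ _ _ _ _ (Nat.succ_pos n)] at e₂
    exact e₂

theorem pathStart_germRel {a b : (C.path hC).carrier} (h : C.GermRel hC a b) :
    Hom.toFun (C.pathStart hC) a = Hom.toFun (C.pathStart hC) b := by
  induction h with
  | rel a b h =>
    obtain ⟨y, h, e⟩ := h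
    change C.d false 0 a.1 = C.d false 0 b.1
    rw [e, C.d_source]
  | refl a => rfl
  | symm a b _ ih => exact ih.symm
  | trans a b c _ _ ih ih' => exact ih.trans ih'

/-- The `0`-source on the quotient globular set. -/
noncomputable def germStart : C.germGlobularSet hC ⟶ underlying.obj (discrete C.carrier) where
  app n := Quotient.lift (GlobularSet.Hom.app (underlying.map (C.pathStart hC)) n)
    (fun _ _ h => Subtype.ext (C.pathStart_germRel hC h))
  app_bd α n x := by
    induction x using Quotient.inductionOn with | _ x =>
    exact GlobularSet.Hom.app_bd (underlying.map (C.pathStart hC)) α n x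

theorem germProj_germStart :
    C.germProj hC ≫ C.germStart hC = underlying.map (C.pathStart hC) := rfl

/-- The grading of `ℙ⁻C` by the `0`-cells of `C` that is induced by the `0`-source of `C`. -/
noncomputable def semiPathStart : C.semiPath hC ⟶ discrete C.carrier :=
  Limits.pushout.desc
    (free.map (C.germStart hC) ≫ freeAdjunction.counit.app (discrete C.carrier))
    (C.pathStart hC) (by
      rw [← Category.assoc, ← free.map_comp, germProj_germStart]
      exact freeAdjunction.counit_naturality (C.pathStart hC))

theorem semiPathStart_toSemiPath (x : (C.path hC).carrier) :
    Hom.toFun (C.semiPathStart hC) (Hom.toFun (C.toSemiPath hC) x) = C.d false 0 x.1 :=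
  congrArg (fun k => Hom.toFun k x) (Limits.pushout.inr_desc
    (free.map (C.germStart hC) ≫ freeAdjunction.counit.app (discrete C.carrier))
    (C.pathStart hC) _)

/-- The fiber `ℙ⁻ₐC` of the grading of `ℙ⁻C` over `a`. -/
noncomputable def semiPathAt (a : C.carrier) : OmegaCat.{u} :=
  (C.semiPath hC).sub (fun z => Hom.toFun (C.semiPathStart hC) z = a)
    (fun α n z hz => (Hom.map_d (C.semiPathStart hC) α n z).trans hz)
    (fun n z w h hz _ => (Hom.map_comp (C.semiPathStart hC) n z w h).choose_spec.trans hz)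

/-- The class `h⁻(x)` in `ℙ⁻ₐC` of a cell `x` of `ℙC` with `s₀ x = a`. -/
noncomputable def germ {a : C.carrier} (x : C.carrier) (hx : 1 ≤ C.dim x)
    (ha : C.d false 0 x = a) : (C.semiPathAt hC a).carrier :=
  ⟨Hom.toFun (C.toSemiPath hC) ⟨x, hx⟩, (C.semiPathStart_toSemiPath hC ⟨x, hx⟩).trans ha⟩

end SemiPath

end OmegaCat

/-! ### Omega-categories of faces -/

/-- The combinatorial data of a cube or of a simplex: its faces with their dimensions, the relation
`sub a x` (`a` is a subface of `x`, that is `a ∈ R(x)`), and the sets `bd false x` and `bd true x`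
of codimension-one faces in the source and in the target of `x` (written `s_x` and `t_x`). -/
structure FaceComplex where
  Face : Type
  dim : Face → ℕ
  sub : Face → Face → Prop
  bd : Bool → Face → Set Face
  dim_le : ∀ a x, sub a x → dim a ≤ dim x

namespace FaceComplex

/-- A closed set `X` of faces together with its iterated sources and targets, recorded by the sets
`val α n` of the `n`-dimensional faces that belong to the `n`-source (`α = false`) and to the
`n`-target (`α = true`) of `X`.  The closed set is recovered as `X = R(⋃ val α n)`, and the closed
set of a composite is the union of the closed sets of its two factors. -/
@[ext]
structure Table (K : FaceComplex) where
  val : Bool → ℕ → Set K.Face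
  dim_eq : ∀ α n a, a ∈ val α n → K.dim a = n
  finite : ∃ N, ∀ α n, N ≤ n → val α n = ∅

namespace Table

variable {K : FaceComplex}

/-- The `n`-source or `n`-target: it agrees with `T` in dimensions below `n`, consists of
`T.val α n` in dimension `n`, and is empty in dimensions above `n`. -/
def d (α : Bool) (n : ℕ) (T : K.Table) : K.Table where
  val β m := if m < n then T.val β m else if m = n then T.val α n else ∅
  dim_eq := by
    intro β m a ha
    split_ifs at ha with h₁ h₂
    · exact T.dim_eq _ _ _ ha
    · exact h₂ ▸ T.dim_eq _ _ _ ha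
    · exact ha.elim
  finite := ⟨n + 1, fun β m h => by rw [if_neg (by omega), if_neg (by omega)]⟩

/-- The composite `S *ₙ T`, for `S` and `T` with `tₙ S = sₙ T`: it agrees with `S` and `T` in
dimensions below `n`, has the `n`-source of `S` and the `n`-target of `T`, and is the union of `S`
and `T` in dimensions above `n`. -/
def comp (n : ℕ) (S T : K.Table) : K.Table where
  val β m := if m < n then S.val β m else
    if m = n then (if β = true then T.val true n else S.val false n) else S.val β m ∪ T.val β m
  dim_eq := by
    intro β m a ha
    split_ifs at ha with h₁ h₂ h₃
    · exact S.dim_eq _ _ _ ha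
    · exact h₂ ▸ T.dim_eq _ _ _ ha
    · exact h₂ ▸ S.dim_eq _ _ _ ha
    · exact ha.elim (S.dim_eq _ _ _) (T.dim_eq _ _ _)
  finite := by
    obtain ⟨N, hN⟩ := S.finite
    obtain ⟨M, hM⟩ := T.finite
    refine ⟨N + M + n + 1, fun β m h => ?_⟩
    rw [if_neg (by omega), if_neg (by omega), hN β m (by omega), hM β m (by omega),
      Set.union_empty]

theorem eq_of_lt {n : ℕ} {S T : K.Table} (h : d true n S = d false n T) {m : ℕ} (hm : m < n)
    (β : Bool) : S.val β m = T.val β m := by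
  have := congrArg (fun U : K.Table => U.val β m) h
  simpa only [d, if_pos hm] using this

theorem eq_at {n : ℕ} {S T : K.Table} (h : d true n S = d false n T) :
    S.val true n = T.val false n := by
  have := congrArg (fun U : K.Table => U.val true n) h
  simpa only [d, if_neg (lt_irrefl n), if_true] using this

theorem d_eq_of {n : ℕ} {S T : K.Table} (h : ∀ m < n, ∀ β, S.val β m = T.val β m)
    (h' : S.val true n = T.val false n) : d true n S = d false n T := by
  ext β m : 3
  simp only [d]
  split_ifs with h₁
  · exact h m h₁ β
  · exact h'
  · rfl

end Table

open Table in
/-- The `ω`-category of all tables. -/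
def tables (K : FaceComplex) : OmegaCat.{0} where
  carrier := K.Table
  d := Table.d
  comp n S T _ := Table.comp n S T
  d_d_lt α β m n T h := by
    ext γ k : 3
    simp only [Table.d]
    split_ifs <;> first | rfl | omega
  d_d_ge α β m n T h := by
    ext γ k : 3
    simp only [Table.d]
    split_ifs <;> first | rfl | omega
  source_comp n T h := by
    ext γ k : 3
    simp only [Table.d, Table.comp]
    rcases lt_trichotomy k n with hk | hk | hk
    · simp [hk]
    · subst hk; cases γ <;> simp
    · simp [hk.not_gt, hk.ne']
  comp_target n T h := by
    ext γ k : 3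
    simp only [Table.d, Table.comp]
    rcases lt_trichotomy k n with hk | hk | hk
    · simp [hk]
    · subst hk; cases γ <;> simp
    · simp [hk.not_gt, hk.ne']
  d_source n S T h := by
    ext γ k : 3
    simp only [Table.d, Table.comp]
    split_ifs <;> first | rfl | omega | simp_all
  d_target n S T h := by
    ext γ k : 3
    simp only [Table.d, Table.comp]
    split_ifs with h₁ <;> first | exact eq_of_lt h h₁ γ | rfl | omega
  d_comp α m n S T h hmn := by
    refine ⟨d_eq_of (fun k hk β => ?_) ?_, ?_⟩
    · simp only [Table.d]
      split_ifs with h₁ h₂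
      · exact eq_of_lt h hk β
      · exact eq_of_lt h (h₂ ▸ hk) α
      · rfl
    · simp only [Table.d]
      split_ifs with h₁ h₂
      · exact eq_at h
      · exact absurd h₂.symm hmn
      · rfl
    · ext γ k : 3
      simp only [Table.d, Table.comp]
      have e : ∀ β, m < n → S.val β m = T.val β m := fun β h' => eq_of_lt h h' β
      split_ifs <;> first | rfl | omega | simp_all
  assoc n S T U h₁ h₂ h₃ h₄ := by
    ext γ k : 3
    simp only [Table.comp]
    rcases lt_trichotomy k n with hk | hk | hk
    · simp only [if_pos hk]
    · subst hk; cases γ <;> simp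
    · simp only [if_neg hk.not_gt, if_neg hk.ne']
      exact Set.union_assoc _ _ _
  interchange m n S T U V hmn h₁ h₂ h₃ h₄ h₅ h₆ := by
    have a₁ := fun k hk β => @eq_of_lt K n S T h₁ k hk β
    have a₂ := fun k hk β => @eq_of_lt K n U V h₂ k hk β
    have a₄ := fun k hk β => @eq_of_lt K m S U h₄ k hk β
    have a₅ := fun k hk β => @eq_of_lt K m T V h₅ k hk β
    ext γ k : 3
    simp only [Table.comp]
    split_ifs <;> first | rfl | omega | simp_all [Set.union_assoc, Set.union_left_comm]
  finite_dim T := by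
    obtain ⟨N, hN⟩ := T.finite
    refine ⟨N, ?_, ?_⟩ <;> ext γ k : 3 <;> simp only [Table.d] <;> split_ifs with h₁ h₂
    all_goals first | rfl | (rw [hN _ _ (by omega)]; try rw [hN _ _ (by omega)])

/-- The table of `R(x)`: a face `a` of dimension `n` belongs to the `n`-source (`n`-target) of
`R(x)` if and only if it is a subface of `x` and, for every `(n + 1)`-dimensional subface `b` of
`x` with `a ∈ R(b)`, it belongs to `R(s_b)` (to `R(t_b)`). -/
def atom (K : FaceComplex) (x : K.Face) : K.Table where
  val α n := {a | K.sub a x ∧ K.dim a = n ∧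
    ∀ b, K.sub b x → K.dim b = n + 1 → K.sub a b → ∃ c ∈ K.bd α b, K.sub a c}
  dim_eq _ _ _ h := h.2.1
  finite := ⟨K.dim x + 1, fun α n h => Set.eq_empty_of_forall_notMem fun a ha => by
    have := K.dim_le a x ha.1
    have := ha.2.1
    omega⟩

/-- The `ω`-category of a complex of faces: it is generated by the cells `R(x)`, for `x` a face,
under sources, targets and compositions. -/
def omega (K : FaceComplex) : OmegaCat.{0} :=
  K.tables.generate (fun T => ∃ x, T = K.atom x)

/-- The cell `R(x)`. -/
def cell (K : FaceComplex) (x : K.Face) : K.omega.carrier :=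
  ⟨K.atom x, .of _ ⟨x, rfl⟩⟩

section Map

variable {K L : FaceComplex} (f : K.Face → L.Face)

/-- The image of a table under a map of faces; faces whose dimension drops are discarded. -/
def mapTable (T : K.Table) : L.Table where
  val α n := {b | L.dim b = n ∧ ∃ a ∈ T.val α n, f a = b}
  dim_eq _ _ _ h := h.1
  finite := by
    obtain ⟨N, hN⟩ := T.finite
    refine ⟨N, fun α n h => Set.eq_empty_of_forall_notMem ?_⟩
    rintro b ⟨_, a, ha, _⟩
    rw [hN α n h] at ha
    exact ha

theorem mapTable_d (α : Bool) (n : ℕ) (T : K.Table) :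
    mapTable f (T.d α n) = (mapTable f T).d α n := by
  ext β m b
  simp only [mapTable, Table.d]
  split_ifs with h₁ h₂
  · rfl
  · subst h₂; rfl
  · simp

theorem mapTable_comp (n : ℕ) (S T : K.Table) :
    mapTable f (S.comp n T) = (mapTable f S).comp n (mapTable f T) := by
  ext β m b
  simp only [mapTable, Table.comp]
  split_ifs with h₁ h₂ h₃
  · rfl
  · subst h₂; rfl
  · subst h₂; rfl
  · simp only [Set.mem_ofPred_eq, Set.mem_union]
    constructor
    · rintro ⟨h, a, ha | ha, e⟩
      · exact .inl ⟨h, a, ha, e⟩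
      · exact .inr ⟨h, a, ha, e⟩
    · rintro (⟨h, a, ha, e⟩ | ⟨h, a, ha, e⟩)
      · exact ⟨h, a, .inl ha, e⟩
      · exact ⟨h, a, .inr ha, e⟩

/-- The `ω`-functor that a map of faces induces if it carries the cell `R(x)` to `R(f x)`. -/
def mapOmega (hf : ∀ x, mapTable f (K.atom x) = L.atom (f x)) : K.omega ⟶ L.omega where
  toFun T := ⟨mapTable f T.1, by
    obtain ⟨T, hT⟩ := T
    simp only
    induction hT with
    | of T h =>
      obtain ⟨x, rfl⟩ := h
      exact .of _ ⟨f x, hf x⟩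
    | d α n T _ ih =>
      have := OmegaCat.Generated.d (C := L.tables) α n _ ih
      exact (mapTable_d f α n T) ▸ this
    | comp n S T h _ _ ihS ihT =>
      have h' : (mapTable f S).d true n = (mapTable f T).d false n := by
        exact (mapTable_d f true n S).symm.trans
          ((congrArg (mapTable f) h).trans (mapTable_d f false n T))
      have := OmegaCat.Generated.comp (C := L.tables) n _ _ h' ihS ihT
      exact (mapTable_comp f n S T) ▸ this⟩
  map_d α n T := Subtype.ext (mapTable_d f α n T.1)
  map_comp n S T h := by
    refine ⟨Subtype.ext ?_, Subtype.ext (mapTable_comp f n S.1 T.1)⟩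
    change (mapTable f S.1).d true n = (mapTable f T.1).d false n
    exact (mapTable_d f true n S.1).symm.trans
      ((congrArg (mapTable f) (congrArg Subtype.val h)).trans (mapTable_d f false n T.1))

theorem mapOmega_cell (hf : ∀ x, mapTable f (K.atom x) = L.atom (f x)) (x : K.Face) :
    OmegaCat.Hom.toFun (mapOmega f hf) (K.cell x) = L.cell (f x) :=
  Subtype.ext (hf x)

end Map

theorem omega_dim_le_zero {K : FaceComplex} {T : K.omega.carrier}
    (h : ∀ α n, T.1.val α (n + 1) = ∅) (h' : T.1.val true 0 = T.1.val false 0) :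
    K.omega.dim T ≤ 0 := by
  refine K.omega.dim_le_of_d_eq_self (α := true) (Subtype.ext ?_)
  change T.1.d true 0 = T.1
  ext β m : 3
  simp only [Table.d]
  rcases m with _ | m
  · cases β <;> simp [h']
  · simp [h β m]

/-- If every face `x` of positive dimension has an edge in the `1`-source and in the `1`-target of
`R(x)`, then the `ω`-category of faces is non-contracting. -/
theorem omega_nonContracting (K : FaceComplex)
    (hpos : ∀ x α, 1 ≤ K.dim x → ((K.atom x).val α 1).Nonempty) : K.omega.NonContracting := by
  have main : ∀ T, K.tables.Generated (fun T => ∃ x, T = K.atom x) T →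
      ((∀ α n, T.val α (n + 1) = ∅) ∧ T.val true 0 = T.val false 0) ∨
        ∀ α, (T.val α 1).Nonempty := by
    intro T hT
    induction hT with
    | of T h =>
      obtain ⟨x, rfl⟩ := h
      rcases Nat.eq_zero_or_pos (K.dim x) with h0 | h0
      · refine .inl ⟨fun α n => Set.eq_empty_of_forall_notMem fun a ha => ?_, ?_⟩
        · have := K.dim_le a x ha.1
          have := ha.2.1
          omega
        · ext a
          refine ⟨fun ha => ⟨ha.1, ha.2.1, fun b hb hb' => ?_⟩,
            fun ha => ⟨ha.1, ha.2.1, fun b hb hb' => ?_⟩⟩ <;>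
          · have := K.dim_le b x hb
            omega
      · exact .inr fun α => hpos x α h0
    | d α n T _ ih =>
      change ((∀ β m, (T.d α n).val β (m + 1) = ∅) ∧ (T.d α n).val true 0 = (T.d α n).val false 0) ∨
        ∀ β, ((T.d α n).val β 1).Nonempty
      rcases n with _ | n
      · exact .inl ⟨fun β m => by simp [Table.d], by simp [Table.d]⟩
      · rcases ih with ⟨h₁, h₂⟩ | h
        · exact .inl ⟨fun β m => by simp [Table.d, h₁], by simp [Table.d, h₂]⟩
        · refine .inr fun β => ?_
          simp only [Table.d]
          split_ifs with h₃ h₄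
          · exact h β
          · exact h₄ ▸ h α
          · omega
    | comp n S T h _ _ ihS ihT =>
      have e₁ : ∀ {m}, m < n → ∀ β, S.val β m = T.val β m := fun hm β => Table.eq_of_lt h hm β
      have e₂ : S.val true n = T.val false n := Table.eq_at h
      change ((∀ β m, (S.comp n T).val β (m + 1) = ∅) ∧
        (S.comp n T).val true 0 = (S.comp n T).val false 0) ∨
        ∀ β, ((S.comp n T).val β 1).Nonempty
      rcases n with _ | _ | n
      · rcases ihS with ⟨h₁, h₂⟩ | h₁
        · rcases ihT with ⟨h₃, h₄⟩ | h₃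
          · refine .inl ⟨fun β m => ?_, ?_⟩
            · simp [Table.comp, h₁, h₃]
            · simp [Table.comp, ← h₂, ← h₄, e₂]
          · refine .inr fun β => (h₃ β).mono ?_
            simp [Table.comp]
        · refine .inr fun β => (h₁ β).mono ?_
          simp [Table.comp]
      · rcases ihS with ⟨h₁, h₂⟩ | h₁
        · rcases ihT with ⟨h₃, h₄⟩ | h₃
          · refine .inl ⟨fun β m => ?_, ?_⟩
            · rcases m with _ | m
              · cases β <;> simp [Table.comp, h₁, h₃]
              · simp [Table.comp, h₁, h₃]
            · simp [Table.comp, h₂]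
          · have := h₃ false
            rw [zero_add] at e₂
            rw [← e₂] at this
            rw [h₁ true 0] at this
            exact absurd this Set.not_nonempty_empty
        · rcases ihT with ⟨h₃, h₄⟩ | h₃
          · have := h₁ true
            rw [zero_add] at e₂
            rw [e₂, h₃ false 0] at this
            exact absurd this Set.not_nonempty_empty
          · refine .inr fun β => ?_
            cases β
            · simpa [Table.comp] using h₁ false
            · simpa [Table.comp] using h₃ true
      · rcases ihS with ⟨h₁, h₂⟩ | h₁
        · rcases ihT with ⟨h₃, h₄⟩ | h₃
          · refine .inl ⟨fun β m => ?_, ?_⟩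
            · simp only [Table.comp]
              split_ifs <;> simp [h₁, h₃]
            · simp [Table.comp, h₂]
          · have := h₃ false
            rw [← e₁ (by omega) false, h₁ false 0] at this
            exact absurd this Set.not_nonempty_empty
        · exact .inr fun β => by simpa [Table.comp] using h₁ β
  intro T hT α
  refine le_antisymm (K.omega.dim_le_of_d_eq_self (α := α) (K.omega.d_d_ge _ _ _ _ _ le_rfl)) ?_
  rcases main T.1 T.2 with ⟨h₁, h₂⟩ | h
  · have := omega_dim_le_zero h₁ h₂
    omega
  · by_contra hlt
    have h0 := K.omega.d_eq_self_of_dim_le (x := K.omega.d α 1 T) (n := 0) (by omega) true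
    have h1 : ((T.1.d α 1).d true 0).val α 1 = (T.1.d α 1).val α 1 :=
      congrArg (fun U : K.omega.carrier => U.1.val α 1) h0
    have h2 := h α
    simp [Table.d] at h1
    rw [← h1] at h2
    exact Set.not_nonempty_empty h2

end FaceComplex

/-! ### Simplices -/

/-- The faces of the `n`-simplex are the nonempty subsets of `{0, …, n}`.  The source (target) of a
face is obtained by removing the vertices in odd (even) position, the first vertex being in
position `1`. -/
def simplexComplex (n : ℕ) : FaceComplex where
  Face := {s : Finset (Fin (n + 1)) // s.Nonempty}
  dim x := x.1.card - 1
  sub a x := a.1 ⊆ x.1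
  bd α x := {y | ∃ v ∈ x.1, y.1 = x.1.erase v ∧
    if α = true then Even (x.1.filter (· ≤ v)).card else Odd (x.1.filter (· ≤ v)).card}
  dim_le _ _ h := Nat.sub_le_sub_right (Finset.card_le_card h) 1

/-- The `ω`-category `Δⁿ` of the `n`-simplex. -/
def oriental (n : ℕ) : OmegaCat.{0} := (simplexComplex n).omega

theorem simplex_mem_atom {n : ℕ} (x a : (simplexComplex n).Face) (α : Bool) (m : ℕ) :
    a ∈ ((simplexComplex n).atom x).val α m ↔ a.1 ⊆ x.1 ∧ a.1.card = m + 1 ∧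
      ∀ v ∈ x.1, v ∉ a.1 →
        if α = true then Odd (a.1.filter (· < v)).card else Even (a.1.filter (· < v)).card := by
  have hpos : 1 ≤ a.1.card := a.2.card_pos
  have key : ∀ v, v ∉ a.1 →
      ((insert v a.1).filter (· ≤ v)).card = (a.1.filter (· < v)).card + 1 := by
    intro v hv
    have e : (insert v a.1).filter (· ≤ v) = insert v (a.1.filter (· < v)) := by
      ext u
      simp only [Finset.mem_filter, Finset.mem_insert]
      constructor
      · rintro ⟨rfl | h, h'⟩
        · exact .inl rfl
        · exact .inr ⟨h, lt_of_le_of_ne h' (fun e => hv (e ▸ h))⟩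
      · rintro (rfl | ⟨h, h'⟩)
        · exact ⟨.inl rfl, le_rfl⟩
        · exact ⟨.inr h, h'.le⟩
    rw [e, Finset.card_insert_of_notMem (by simp)]
  change (a.1 ⊆ x.1 ∧ a.1.card - 1 = m ∧ ∀ b : (simplexComplex n).Face, b.1 ⊆ x.1 →
    b.1.card - 1 = m + 1 → a.1 ⊆ b.1 → ∃ c : (simplexComplex n).Face, (∃ v ∈ b.1,
      c.1 = b.1.erase v ∧ if α = true then Even (b.1.filter (· ≤ v)).card else
        Odd (b.1.filter (· ≤ v)).card) ∧ a.1 ⊆ c.1) ↔ _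
  refine and_congr_right fun hax => ?_
  constructor
  · rintro ⟨hm, h⟩
    refine ⟨by omega, fun v hv hva => ?_⟩
    obtain ⟨c, ⟨w, hw, hc, hp⟩, hac⟩ := h ⟨insert v a.1, Finset.insert_nonempty _ _⟩
      (Finset.insert_subset hv hax) (by
        change (insert v a.1).card - 1 = m + 1
        rw [Finset.card_insert_of_notMem hva]; omega) (Finset.subset_insert _ _)
    have hwa : w ∉ a.1 := fun hwa => by
      have := hac hwa
      rw [hc] at this
      exact Finset.notMem_erase _ _ this
    have hwv : w = v := (Finset.mem_insert.1 hw).resolve_right hwa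
    subst hwv
    change if α = true then Even ((insert w a.1).filter (· ≤ w)).card else
      Odd ((insert w a.1).filter (· ≤ w)).card at hp
    rw [key w hva] at hp
    split_ifs at hp ⊢ with hα
    · simpa [Nat.even_add_one] using hp
    · simpa [Nat.odd_add_one] using hp
  · rintro ⟨hm, h⟩
    refine ⟨by omega, fun b hbx hb hab => ?_⟩
    obtain ⟨v, hvb, hva⟩ : ∃ v ∈ b.1, v ∉ a.1 := by
      by_contra hcon
      push Not at hcon
      have := Finset.card_le_card (show b.1 ⊆ a.1 from hcon)
      omega
    have hba : b.1 = insert v a.1 := by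
      symm
      refine Finset.eq_of_subset_of_card_le (Finset.insert_subset hvb hab) ?_
      rw [Finset.card_insert_of_notMem hva]
      omega
    refine ⟨a, ⟨v, hvb, ?_, ?_⟩, Finset.Subset.refl _⟩
    · rw [hba, Finset.erase_insert hva]
    · have := h v (hbx hvb) hva
      rw [hba, key v hva]
      split_ifs at this ⊢ with hα
      · simpa [Nat.even_add_one] using this
      · simpa [Nat.odd_add_one] using this

/-- The action of a monotone map on the faces of a simplex. -/
def simplexMap {n m : ℕ} (f : Fin (n + 1) →o Fin (m + 1)) (x : (simplexComplex n).Face) :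
    (simplexComplex m).Face :=
  ⟨x.1.image f, x.2.image f⟩

theorem simplexMap_atom {n m : ℕ} (f : Fin (n + 1) →o Fin (m + 1)) (x : (simplexComplex n).Face) :
    FaceComplex.mapTable (simplexMap f) ((simplexComplex n).atom x) =
      (simplexComplex m).atom (simplexMap f x) := by
  ext α k b
  rw [simplex_mem_atom]
  change ((b.1.card - 1 = k ∧ ∃ a ∈ ((simplexComplex n).atom x).val α k, simplexMap f a = b) ↔
    b.1 ⊆ x.1.image f ∧ b.1.card = k + 1 ∧ ∀ v ∈ x.1.image f, v ∉ b.1 →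
      if α = true then Odd (b.1.filter (· < v)).card else Even (b.1.filter (· < v)).card)
  have hpos : 1 ≤ b.1.card := b.2.card_pos
  -- Counting the vertices below `f v` in the image of `a`.
  have count : ∀ a : Finset (Fin (n + 1)), Set.InjOn f a → ∀ v, f v ∉ a.image f →
      ((a.image f).filter (· < f v)).card = (a.filter (· < v)).card := by
    intro a hinj v hv
    have e : (a.image f).filter (· < f v) = (a.filter (· < v)).image f := by
      ext w
      simp only [Finset.mem_filter, Finset.mem_image]
      constructor
      · rintro ⟨⟨u, hu, rfl⟩, h⟩
        exact ⟨u, ⟨hu, lt_of_not_ge fun h' => absurd h (f.monotone h').not_gt⟩, rfl⟩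
      · rintro ⟨u, ⟨hu, h⟩, rfl⟩
        exact ⟨⟨u, hu, rfl⟩, lt_of_le_of_ne (f.monotone h.le)
          fun e => hv (Finset.mem_image.2 ⟨u, hu, e⟩)⟩
    rw [e, Finset.card_image_of_injOn (hinj.mono (Finset.coe_subset.2 (Finset.filter_subset _ _)))]
  constructor
  · rintro ⟨hb, a, ha, rfl⟩
    rw [simplex_mem_atom] at ha
    obtain ⟨h₁, h₂, h₃⟩ := ha
    change (a.1.image f).card - 1 = k at hb
    change 1 ≤ (a.1.image f).card at hpos
    have hinj : Set.InjOn f a.1 := Finset.card_image_iff.1 (by omega)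
    change a.1.image f ⊆ x.1.image f ∧ (a.1.image f).card = k + 1 ∧ ∀ v ∈ x.1.image f,
      v ∉ a.1.image f → if α = true then Odd ((a.1.image f).filter (· < v)).card else
        Even ((a.1.image f).filter (· < v)).card
    refine ⟨Finset.image_subset_image h₁, by omega, fun v hv hv' => ?_⟩
    obtain ⟨u, hu, rfl⟩ := Finset.mem_image.1 hv
    rw [count a.1 hinj u hv']
    exact h₃ u hu (fun h => hv' (Finset.mem_image_of_mem f h))
  · rintro ⟨h₁, h₂, h₃⟩
    refine ⟨by omega, ?_⟩
    let p : Fin (m + 1) → Prop := fun w =>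
      if α = true then Odd (b.1.filter (· < w)).card else Even (b.1.filter (· < w)).card
    -- Lift every vertex of `b` to the last or to the first vertex above it.
    have lift : ∀ w ∈ b.1, ∃ u ∈ x.1, f u = w ∧ ∀ u' ∈ x.1, f u' = w →
        (p w → u' ≤ u) ∧ (¬ p w → u ≤ u') := by
      intro w hw
      obtain ⟨u₀, hu₀, rfl⟩ := Finset.mem_image.1 (h₁ hw)
      have hne : (x.1.filter (fun u => f u = f u₀)).Nonempty :=
        ⟨u₀, Finset.mem_filter.2 ⟨hu₀, rfl⟩⟩
      by_cases hp : p (f u₀)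
      · have hm := Finset.mem_filter.1 (Finset.max'_mem _ hne)
        exact ⟨_, hm.1, hm.2, fun u' hu' e =>
          ⟨fun _ => Finset.le_max' _ _ (Finset.mem_filter.2 ⟨hu', e⟩), fun h => absurd hp h⟩⟩
      · have hm := Finset.mem_filter.1 (Finset.min'_mem _ hne)
        exact ⟨_, hm.1, hm.2, fun u' hu' e =>
          ⟨fun h => absurd h hp, fun _ => Finset.min'_le _ _ (Finset.mem_filter.2 ⟨hu', e⟩)⟩⟩
    choose! g hgx hfg hg using lift
    have himg : (b.1.image g).image f = b.1 := by
      rw [Finset.image_image]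
      exact (Finset.image_congr (fun w hw => hfg w hw)).trans Finset.image_id
    have hginj : Set.InjOn g b.1 := fun w hw w' hw' e => by
      rw [← hfg w hw, ← hfg w' hw', e]
    have hfinj : Set.InjOn f (b.1.image g : Finset _) := by
      refine Finset.card_image_iff.1 ?_
      rw [himg, Finset.card_image_of_injOn hginj]
    have hmem : ∀ {u}, u ∈ b.1.image g → f u ∈ b.1 ∧ g (f u) = u := by
      intro u hu
      obtain ⟨w, hw, rfl⟩ := Finset.mem_image.1 hu
      rw [hfg w hw]
      exact ⟨hw, rfl⟩
    have cardlt : ∀ w, ((b.1.image g).filter (fun u => f u < w)).card =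
        (b.1.filter (· < w)).card := by
      intro w
      rw [← Finset.card_image_of_injOn
        (hfinj.mono (Finset.coe_subset.2 (Finset.filter_subset (fun u => f u < w) _)))]
      congr 1
      ext w'
      simp only [Finset.mem_filter, Finset.mem_image]
      constructor
      · rintro ⟨u, ⟨⟨w₀, hw₀, rfl⟩, h⟩, rfl⟩
        exact ⟨(hfg w₀ hw₀).symm ▸ hw₀, h⟩
      · rintro ⟨hw', h⟩
        exact ⟨g w', ⟨⟨w', hw', rfl⟩, (hfg w' hw').symm ▸ h⟩, hfg w' hw'⟩
    refine ⟨⟨b.1.image g, b.2.image g⟩, (simplex_mem_atom _ _ _ _).2 ⟨?_, ?_, ?_⟩,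
      Subtype.ext himg⟩
    · intro u hu
      obtain ⟨w, hw, rfl⟩ := Finset.mem_image.1 hu
      exact hgx w hw
    · change (b.1.image g).card = k + 1
      rw [Finset.card_image_of_injOn hginj, h₂]
    · intro v hv hva
      change v ∉ b.1.image g at hva
      change if α = true then Odd ((b.1.image g).filter (· < v)).card else
        Even ((b.1.image g).filter (· < v)).card
      by_cases hw : f v ∈ b.1
      · have hgv : g (f v) ≠ v := fun e => hva (e ▸ Finset.mem_image_of_mem g hw)
        have hlt : ∀ u ∈ b.1.image g, u ≠ g (f v) → (u < v ↔ f u < f v) := by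
          intro u hu hne
          refine ⟨fun h => lt_of_le_of_ne (f.monotone h.le) fun e => hne ?_,
            fun h => lt_of_not_ge fun h' => absurd h (f.monotone h').not_gt⟩
          rw [← (hmem hu).2, e]
        have hspec := hg (f v) hw v hv rfl
        by_cases hp : p (f v)
        · have hvg : v < g (f v) := lt_of_le_of_ne (hspec.1 hp) (Ne.symm hgv)
          have e : (b.1.image g).filter (· < v) =
              (b.1.image g).filter (fun u => f u < f v) := by
            refine Finset.filter_congr fun u hu => ?_
            by_cases hne : u = g (f v)
            · subst hne
              rw [hfg _ hw]
              exact ⟨fun h => absurd h hvg.not_gt, fun h => absurd h (lt_irrefl _)⟩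
            · exact hlt u hu hne
          rw [e, cardlt]
          exact hp
        · have hvg : g (f v) < v := lt_of_le_of_ne (hspec.2 hp) hgv
          have e : (b.1.image g).filter (· < v) =
              insert (g (f v)) ((b.1.image g).filter (fun u => f u < f v)) := by
            ext u
            rw [Finset.mem_insert, Finset.mem_filter, Finset.mem_filter]
            by_cases hne : u = g (f v)
            · subst hne
              exact ⟨fun _ => .inl rfl, fun _ => ⟨Finset.mem_image_of_mem g hw, hvg⟩⟩
            · constructor
              · exact fun h => .inr ⟨h.1, (hlt u h.1 hne).1 h.2⟩
              · rintro (h | h)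
                · exact absurd h hne
                · exact ⟨h.1, (hlt u h.1 hne).2 h.2⟩
          rw [e, Finset.card_insert_of_notMem, cardlt]
          · simp only [p] at hp
            split_ifs at hp ⊢ with hα
            · simpa [Nat.odd_add_one] using hp
            · simpa [Nat.even_add_one] using hp
          · rw [Finset.mem_filter, hfg _ hw]
            exact fun h => lt_irrefl _ h.2
      · have hw' : f v ∉ (b.1.image g).image f := by rwa [himg]
        rw [← count (b.1.image g) hfinj v hw', himg]
        exact h₃ (f v) (Finset.mem_image_of_mem f hv) hw

/-- The `ω`-functor between simplices that is induced by a monotone map of vertices. -/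
def orientalMap {n m : ℕ} (f : Fin (n + 1) →o Fin (m + 1)) : oriental n ⟶ oriental m :=
  FaceComplex.mapOmega (simplexMap f) (simplexMap_atom f)

theorem simplexMap_dim {n m : ℕ} (f : Fin (n + 1) →o Fin (m + 1)) (x : (simplexComplex n).Face) :
    (simplexComplex m).dim (simplexMap f x) ≤ (simplexComplex n).dim x :=
  Nat.sub_le_sub_right Finset.card_image_le 1

/-- The functor `Δ* : [n] ↦ Δⁿ` from the simplex category to `ωCat`. -/
def orientalFunctor : SimplexCategory ⥤ OmegaCat.{0} where
  obj a := oriental a.len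
  map f := orientalMap f.toOrderHom
  map_id a := by
    refine OmegaCat.hom_ext fun T => Subtype.ext ?_
    refine FaceComplex.Table.ext (funext fun α => funext fun n => Set.ext fun b => ?_)
    have e : ∀ c, simplexMap (SimplexCategory.Hom.toOrderHom (𝟙 a)) c = c :=
      fun c => Subtype.ext Finset.image_id
    constructor
    · rintro ⟨_, c, hc, rfl⟩
      rw [e]
      exact hc
    · exact fun hb => ⟨T.1.dim_eq _ _ _ hb, b, hb, e b⟩
  map_comp {a b c} f g := by
    refine OmegaCat.hom_ext fun T => Subtype.ext ?_
    refine FaceComplex.Table.ext (funext fun α => funext fun n => Set.ext fun y => ?_)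
    have e : ∀ x, simplexMap (SimplexCategory.Hom.toOrderHom (f ≫ g)) x =
        simplexMap g.toOrderHom (simplexMap f.toOrderHom x) :=
      fun x => Subtype.ext (by
        change Finset.image (g.toOrderHom ∘ f.toOrderHom) x.1 = _
        exact Finset.image_image.symm)
    constructor
    · rintro ⟨hy, x, hx, rfl⟩
      rw [e] at hy ⊢
      refine ⟨hy, _, ⟨?_, x, hx, rfl⟩, rfl⟩
      have h₁ := simplexMap_dim f.toOrderHom x
      have h₂ := simplexMap_dim g.toOrderHom (simplexMap f.toOrderHom x)
      have h₃ := T.1.dim_eq _ _ _ hx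
      omega
    · rintro ⟨hy, _, ⟨_, x, hx, rfl⟩, rfl⟩
      exact ⟨hy, x, hx, e x⟩

/-! ### Cubes -/

/-- The faces of the `n`-cube are the words of length `n` in the letters `-`, `0`, `+`.  In the
source (target) of a face, the `k`-th letter `0` is replaced by the sign `(-)^k`
(by `(-)^(k + 1)`). -/
def cubeComplex (n : ℕ) : FaceComplex where
  Face := Fin n → SignType
  dim x := (Finset.univ.filter (fun i => x i = 0)).card
  sub a x := ∀ i, x i = 0 ∨ a i = x i
  bd α x := {y | ∃ i, x i = 0 ∧ y = Function.update x i
    ((-1) ^ ((Finset.univ.filter (fun j => j ≤ i ∧ x j = 0)).card + if α = true then 1 else 0))}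
  dim_le a x h := Finset.card_le_card fun i hi => by
    rw [Finset.mem_filter] at hi ⊢
    refine ⟨hi.1, (h i).elim id fun e => ?_⟩
    rw [← e, hi.2]

/-- The `ω`-category `Iⁿ` of the `n`-cube. -/
def cube (n : ℕ) : OmegaCat.{0} := (cubeComplex n).omega

/-- The number of letters `0` of a word before position `i`. -/
def zerosBefore {n : ℕ} (a : Fin n → SignType) (i : Fin n) : ℕ :=
  (Finset.univ.filter (fun j => j < i ∧ a j = 0)).card

theorem sign_pow_ne_zero (k : ℕ) : ((-1 : SignType) ^ k) ≠ 0 := by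
  rcases Nat.even_or_odd k with h | h
  · rw [h.neg_one_pow]; decide
  · rw [h.neg_one_pow]; decide

theorem cube_mem_atom {n : ℕ} (x a : Fin n → SignType) (α : Bool) (m : ℕ) :
    a ∈ ((cubeComplex n).atom x).val α m ↔ (∀ i, x i = 0 ∨ a i = x i) ∧
      (Finset.univ.filter (fun i => a i = 0)).card = m ∧
      ∀ i, x i = 0 → a i ≠ 0 →
        a i = (-1) ^ (zerosBefore a i + 1 + if α = true then 1 else 0) := by
  have key : ∀ (i : Fin n), a i ≠ 0 → (Finset.univ.filter
      (fun j => j ≤ i ∧ Function.update a i 0 j = 0)).card = zerosBefore a i + 1 := by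
    intro i hi
    have e : Finset.univ.filter (fun j => j ≤ i ∧ Function.update a i 0 j = 0) =
        insert i (Finset.univ.filter (fun j => j < i ∧ a j = 0)) := by
      ext j
      by_cases hj : j = i
      · subst hj; simp
      · simp [hj, lt_iff_le_and_ne]
    rw [e, Finset.card_insert_of_notMem (by simp)]
    rfl
  have keyd : ∀ (i : Fin n), a i ≠ 0 → (Finset.univ.filter
      (fun j => Function.update a i 0 j = 0)).card =
        (Finset.univ.filter (fun j => a j = 0)).card + 1 := by
    intro i hi
    have e : Finset.univ.filter (fun j => Function.update a i 0 j = 0) =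
        insert i (Finset.univ.filter (fun j => a j = 0)) := by
      ext j
      by_cases hj : j = i
      · subst hj; simp
      · simp [hj]
    rw [e, Finset.card_insert_of_notMem (by simpa using hi)]
  change ((∀ i, x i = 0 ∨ a i = x i) ∧ (Finset.univ.filter (fun i => a i = 0)).card = m ∧
    ∀ b : Fin n → SignType, (∀ i, x i = 0 ∨ b i = x i) →
      (Finset.univ.filter (fun i => b i = 0)).card = m + 1 → (∀ i, b i = 0 ∨ a i = b i) →
      ∃ c : Fin n → SignType, (∃ i, b i = 0 ∧ c = Function.update b i
        ((-1) ^ ((Finset.univ.filter (fun j => j ≤ i ∧ b j = 0)).card +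
          if α = true then 1 else 0))) ∧ ∀ i, c i = 0 ∨ a i = c i) ↔ _
  refine and_congr_right fun hax => and_congr_right fun hm => ?_
  constructor
  · intro h i hxi hai
    obtain ⟨c, ⟨j, hj, rfl⟩, hac⟩ := h (Function.update a i 0) (fun j => by
        by_cases hj : j = i
        · subst hj; exact .inl hxi
        · rw [Function.update_of_ne hj]; exact hax j)
      (by rw [keyd i hai, hm]) (fun j => by
        by_cases hj : j = i
        · subst hj; simp
        · rw [Function.update_of_ne hj]; exact .inr rfl)
    have hji : j = i := by
      by_contra hne
      rw [Function.update_of_ne hne] at hj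
      have := (hac j).resolve_left (by
        rw [Function.update_self]; exact sign_pow_ne_zero _)
      rw [Function.update_self, hj] at this
      exact sign_pow_ne_zero _ this.symm
    subst hji
    have := (hac j).resolve_left (by
      rw [Function.update_self]; exact sign_pow_ne_zero _)
    rw [Function.update_self, key j hai] at this
    exact this
  · intro h b hbx hb hab
    obtain ⟨i, hbi, hai⟩ : ∃ i, b i = 0 ∧ a i ≠ 0 := by
      by_contra hcon
      push Not at hcon
      have : (Finset.univ.filter (fun i => b i = 0)).card ≤
          (Finset.univ.filter (fun i => a i = 0)).card :=
        Finset.card_le_card fun i hi => by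
          rw [Finset.mem_filter] at hi ⊢
          exact ⟨hi.1, hcon i hi.2⟩
      omega
    have hba : b = Function.update a i 0 := by
      have hsub : Finset.univ.filter (fun j => Function.update a i 0 j = 0) ⊆
          Finset.univ.filter (fun j => b j = 0) := fun j hj => by
        rw [Finset.mem_filter] at hj ⊢
        refine ⟨hj.1, ?_⟩
        by_cases hji : j = i
        · rw [hji, hbi]
        · rw [Function.update_of_ne hji] at hj
          exact (hab j).elim id fun e => by rw [← e, hj.2]
      have heq := Finset.eq_of_subset_of_card_le hsub (by rw [keyd i hai]; omega)
      funext j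
      by_cases hji : j = i
      · rw [hji, hbi, Function.update_self]
      · rw [Function.update_of_ne hji]
        refine (hab j).elim (fun h0 => ?_) Eq.symm
        have : j ∈ Finset.univ.filter (fun j => Function.update a i 0 j = 0) := by
          rw [heq]; exact Finset.mem_filter.2 ⟨Finset.mem_univ _, h0⟩
        rw [Finset.mem_filter, Function.update_of_ne hji] at this
        rw [h0, this.2]
    refine ⟨a, ⟨i, hbi, ?_⟩, fun _ => .inr rfl⟩
    have hxi : x i = 0 := (hbx i).elim id fun e => by rw [← e, hbi]
    rw [hba, key i hai, Function.update_idem, ← h i hxi hai, Function.update_eq_self]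

theorem cube_nonContracting (n : ℕ) : (cube n).NonContracting := by
  refine FaceComplex.omega_nonContracting _ fun (x : Fin n → SignType) α hx => ?_
  -- Keep the first zero and replace the later ones by a sign.
  have hne : (Finset.univ.filter (fun i => x i = 0)).Nonempty := Finset.card_pos.1 hx
  have hi₀ := Finset.mem_filter.1 (Finset.min'_mem _ hne)
  have hmin : ∀ i, x i = 0 → (Finset.univ.filter (fun i => x i = 0)).min' hne ≤ i := fun i hi =>
    Finset.min'_le (Finset.univ.filter (fun i => x i = 0)) i
      (Finset.mem_filter.2 ⟨Finset.mem_univ i, hi⟩)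
  generalize (Finset.univ.filter (fun i => x i = 0)).min' hne = i₀ at hi₀ hmin
  let a : Fin n → SignType := fun i => if x i = 0 then
    (if i = i₀ then 0 else (-1) ^ (2 + if α = true then 1 else 0)) else x i
  have ha : ∀ i, a i = 0 ↔ i = i₀ := by
    intro i
    by_cases h₁ : x i = 0
    · by_cases h₂ : i = i₀
      · have e : a i = 0 := by simp only [a]; rw [if_pos h₁, if_pos h₂]
        exact ⟨fun _ => h₂, fun _ => e⟩
      · have e : a i = (-1) ^ (2 + if α = true then 1 else 0) := by
          simp only [a]; rw [if_pos h₁, if_neg h₂]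
        rw [e]
        exact ⟨fun h => absurd h (sign_pow_ne_zero _), fun h => absurd h h₂⟩
    · have e : a i = x i := by simp only [a]; rw [if_neg h₁]
      rw [e]
      exact ⟨fun h => absurd h h₁, fun h => h ▸ hi₀.2⟩
  refine ⟨a, (cube_mem_atom x a α 1).2 ⟨fun i => ?_, ?_, fun i hxi hai => ?_⟩⟩
  · by_cases h : x i = 0
    · exact .inl h
    · exact .inr (by simp only [a, if_neg h])
  · have e : Finset.univ.filter (fun i => a i = 0) = {i₀} := by
      ext i
      simp [ha i]
    rw [e, Finset.card_singleton]
  · have hne : i ≠ i₀ := fun h => hai ((ha i).2 h)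
    have hz : zerosBefore a i = 1 := by
      have e : Finset.univ.filter (fun j => j < i ∧ a j = 0) = {i₀} := by
        ext j
        rw [Finset.mem_filter, Finset.mem_singleton, ha]
        exact ⟨fun h => h.2.2, fun h => ⟨Finset.mem_univ _, h ▸
          lt_of_le_of_ne (hmin i hxi) hne.symm, h⟩⟩
      rw [zerosBefore, e, Finset.card_singleton]
    simp only [a, if_pos hxi, if_neg hne, hz]

/-- The face map `δ⁻ᵢ₊₁`, which inserts the letter `-` after the first `i` letters of a word. -/
def cubeFace {n : ℕ} (i : Fin (n + 1)) (k : Fin n → SignType) : Fin (n + 1) → SignType :=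
  i.insertNth (-1) k

/-- The connection `γ⁻ᵢ₊₁`, which replaces the letters of a word in the positions `i + 1` and
`i + 2` by the greater of the two, for the order `- < 0 < +`. -/
def cubeConnection {n : ℕ} (i : Fin (n + 1)) (k : Fin (n + 2) → SignType) :
    Fin (n + 1) → SignType :=
  fun j => if j < i then k j.castSucc else if j = i then max (k i.castSucc) (k i.succ) else k j.succ

theorem zeros_transport {M N : ℕ} {p : Fin M → Fin N} (hp : Monotone p) {a : Fin M → SignType}
    {b : Fin N → SignType} (hinj : ∀ j k, a j = 0 → a k = 0 → p j = p k → j = k)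
    (hz : ∀ j, a j = 0 → b (p j) = 0) (hs : ∀ j', b j' = 0 → ∃ j, a j = 0 ∧ p j = j') :
    (Finset.univ.filter (fun i => b i = 0)).card = (Finset.univ.filter (fun i => a i = 0)).card ∧
      (∀ j, (∀ k < j, a k = 0 → p k ≠ p j) → zerosBefore a j = zerosBefore b (p j)) ∧
      ∀ j k, k < j → a k = 0 → p k = p j → zerosBefore a j = zerosBefore b (p j) + 1 := by
  have inj : ∀ S : Finset (Fin M), (∀ j ∈ S, a j = 0) → Set.InjOn p S :=
    fun S hS j hj k hk e => hinj j k (hS j hj) (hS k hk) e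
  have low : ∀ j, zerosBefore b (p j) =
      (Finset.univ.filter (fun k => p k < p j ∧ a k = 0)).card := by
    intro j
    rw [← Finset.card_image_of_injOn (inj _ (fun k hk => (Finset.mem_filter.1 hk).2.2)),
      zerosBefore]
    congr 1
    ext j'
    simp only [Finset.mem_filter, Finset.mem_univ, true_and, Finset.mem_image]
    constructor
    · rintro ⟨h, h'⟩
      obtain ⟨k, hk, rfl⟩ := hs j' h'
      exact ⟨k, ⟨h, hk⟩, rfl⟩
    · rintro ⟨k, ⟨h, h'⟩, rfl⟩
      exact ⟨h, hz k h'⟩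
  refine ⟨?_, fun j hj => ?_, fun j k hkj hk e => ?_⟩
  · rw [← Finset.card_image_of_injOn (inj (Finset.univ.filter (fun i => a i = 0))
      (fun k hk => (Finset.mem_filter.1 hk).2))]
    congr 1
    ext j'
    simp only [Finset.mem_filter, Finset.mem_univ, true_and, Finset.mem_image]
    exact ⟨hs j', by rintro ⟨k, hk, rfl⟩; exact hz k hk⟩
  · rw [low, zerosBefore]
    congr 1
    ext k
    simp only [Finset.mem_filter, Finset.mem_univ, true_and]
    exact ⟨fun h => ⟨lt_of_le_of_ne (hp h.1.le) (hj k h.1 h.2), h.2⟩,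
      fun h => ⟨lt_of_not_ge fun h' => absurd h.1 (hp h').not_gt, h.2⟩⟩
  · rw [low, zerosBefore]
    rw [← Finset.card_insert_of_notMem (a := k) (by simp [e])]
    congr 1
    ext l
    simp only [Finset.mem_filter, Finset.mem_univ, true_and, Finset.mem_insert]
    constructor
    · rintro ⟨h, h'⟩
      by_cases hlk : l = k
      · exact .inl hlk
      · refine .inr ⟨lt_of_le_of_ne (hp h.le) fun e' => hlk ?_, h'⟩
        exact hinj l k h' hk (e'.trans e.symm)
    · rintro (rfl | ⟨h, h'⟩)
      · exact ⟨hkj, hk⟩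
      · exact ⟨lt_of_not_ge fun h'' => absurd h (hp h'').not_gt, h'⟩

theorem cubeFace_atom {n : ℕ} (i : Fin (n + 1)) (x : Fin n → SignType) :
    FaceComplex.mapTable (K := cubeComplex n) (L := cubeComplex (n + 1)) (cubeFace i)
      ((cubeComplex n).atom x) = (cubeComplex (n + 1)).atom (cubeFace i x) := by
  have same : ∀ k : Fin n → SignType, cubeFace i k i = -1 := fun k => by simp [cubeFace]
  have above : ∀ (k : Fin n → SignType) j, cubeFace i k (i.succAbove j) = k j := fun k j => by
    simp [cubeFace]
  have tr : ∀ k : Fin n → SignType, _ := fun k =>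
    zeros_transport (p := i.succAbove) (Fin.strictMono_succAbove i).monotone
    (a := k) (b := cubeFace i k)
    (fun _ _ _ _ e => Fin.succAbove_right_injective e) (fun j hj => by rw [above, hj])
    (fun j' hj' => by
      rcases Fin.eq_self_or_eq_succAbove i j' with rfl | ⟨j, rfl⟩
      · rw [same] at hj'
        exact absurd hj' (by decide)
      · exact ⟨j, by rw [← above k, hj'], rfl⟩)
  have iff : ∀ (a : Fin n → SignType) (α : Bool) (m : ℕ),
      cubeFace i a ∈ ((cubeComplex (n + 1)).atom (cubeFace i x)).val α m ↔
        a ∈ ((cubeComplex n).atom x).val α m := by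
    intro a α m
    obtain ⟨h₁, h₂, -⟩ := tr a
    rw [cube_mem_atom, cube_mem_atom, Fin.forall_iff_succAbove i, Fin.forall_iff_succAbove i, h₁]
    simp only [same, above]
    have e : ∀ j, zerosBefore (cubeFace i a) (i.succAbove j) = zerosBefore a j := fun j =>
      (h₂ j (fun k hk _ e => hk.ne (Fin.succAbove_right_injective e))).symm
    simp only [e]
    simp
  ext α m b
  constructor
  · rintro ⟨_, a, ha, rfl⟩
    exact (iff a α m).2 ha
  · intro hb
    have hbi : b i = -1 := by
      have := ((cube_mem_atom _ _ _ _).1 hb).1 i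
      rw [same] at this
      exact this.resolve_left (by decide)
    have e : cubeFace i (fun j => b (i.succAbove j)) = b := by
      funext j'
      rcases Fin.eq_self_or_eq_succAbove i j' with rfl | ⟨j, rfl⟩
      · rw [same, hbi]
      · rw [above]
    refine ⟨hb.2.1, _, (iff _ α m).1 ?_, e⟩
    rw [e]
    exact hb

/-- The `ω`-functor `δ⁻ᵢ₊₁ : Iⁿ ⟶ Iⁿ⁺¹`. -/
def cubeδ {n : ℕ} (i : Fin (n + 1)) : cube n ⟶ cube (n + 1) :=
  FaceComplex.mapOmega (K := cubeComplex n) (L := cubeComplex (n + 1)) (cubeFace i)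
    (cubeFace_atom i)

theorem merge_letters : ∀ s : SignType, s ≠ 0 → ∀ x₁ x₂ b₁ : SignType,
    (max x₁ x₂ = 0 ∨ b₁ = max x₁ x₂) →
    (max x₁ x₂ = 0 → b₁ ≠ 0 → b₁ = s) →
    ∃ u v : SignType, max u v = b₁ ∧ (x₁ = 0 ∨ u = x₁) ∧ (x₂ = 0 ∨ v = x₂) ∧
      (x₁ = 0 → u ≠ 0 → u = s) ∧ (x₂ = 0 → v ≠ 0 → v = if u = 0 then -s else s) ∧
      (u = 0 → b₁ = 0) ∧ (v = 0 → b₁ = 0) ∧ ¬ (u = 0 ∧ v = 0) := by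
  intro s hs x₁ x₂ b₁
  cases s <;> cases x₁ <;> cases x₂ <;> cases b₁ <;> first | exact absurd rfl hs | decide

theorem merge_signs : ∀ s : SignType, s ≠ 0 → ∀ x₁ x₂ a₁ a₂ : SignType, max x₁ x₂ = 0 →
    max a₁ a₂ ≠ 0 → (x₁ = 0 → a₁ ≠ 0 → a₁ = s) → (x₂ = 0 → a₂ ≠ 0 → a₂ = s) →
    (x₁ = 0 ∨ a₁ = x₁) → (x₂ = 0 ∨ a₂ = x₂) → (a₁ = 0 → max a₁ a₂ = 0) →
    (a₂ = 0 → max a₁ a₂ = 0) → max a₁ a₂ = s := by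
  intro s hs x₁ x₂ a₁ a₂
  cases s <;> cases x₁ <;> cases x₂ <;> cases a₁ <;>
    first | exact absurd rfl hs | (cases a₂ <;> decide)

theorem cubeConnection_atom {n : ℕ} (i : Fin (n + 1)) (x : Fin (n + 2) → SignType) :
    FaceComplex.mapTable (K := cubeComplex (n + 2)) (L := cubeComplex (n + 1)) (cubeConnection i)
      ((cubeComplex (n + 2)).atom x) = (cubeComplex (n + 1)).atom (cubeConnection i x) := by
  -- The map of positions that identifies the positions `i` and `i + 1`.
  let p : Fin (n + 2) → Fin (n + 1) := fun j =>
    if h : j.1 ≤ i.1 then ⟨j.1, by omega⟩ else ⟨j.1 - 1, by omega⟩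
  have hp : Monotone p := by
    intro j k h
    have h' : j.1 ≤ k.1 := h
    simp only [p]
    split_ifs <;> simp only [Fin.mk_le_mk] <;> omega
  have pl : ∀ j' : Fin (n + 1), j' < i → p j'.castSucc = j' := by
    intro j' h
    have h' : j'.1 < i.1 := h
    simp only [p]
    rw [dif_pos (by simp only [Fin.val_castSucc]; omega)]
    rfl
  have pr : ∀ j' : Fin (n + 1), i < j' → p j'.succ = j' := by
    intro j' h
    have h' : i.1 < j'.1 := h
    simp only [p]
    rw [dif_neg (by simp only [Fin.val_succ]; omega)]
    rfl
  have pi : p i.castSucc = i := by simp [p]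
  have pi' : p i.succ = i := by simp [p]
  have lt : i.castSucc < i.succ := Fin.castSucc_lt_succ
  have cl : ∀ (k : Fin (n + 2) → SignType) (j' : Fin (n + 1)), j' < i →
      cubeConnection i k j' = k j'.castSucc := fun k j' h => by simp only [cubeConnection, if_pos h]
  have ci : ∀ (k : Fin (n + 2) → SignType),
      cubeConnection i k i = max (k i.castSucc) (k i.succ) := fun k => by simp [cubeConnection]
  have cr : ∀ (k : Fin (n + 2) → SignType) (j' : Fin (n + 1)), i < j' →
      cubeConnection i k j' = k j'.succ := fun k j' h => by
    simp only [cubeConnection, if_neg h.not_gt, if_neg h.ne']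
  have cases : ∀ j : Fin (n + 2), (∃ j' < i, j = j'.castSucc) ∨ j = i.castSucc ∨ j = i.succ ∨
      ∃ j', i < j' ∧ j = j'.succ := by
    intro j
    rcases lt_or_ge j.1 i.1 with h | h
    · exact .inl ⟨⟨j.1, by omega⟩, h, rfl⟩
    · rcases Nat.eq_or_lt_of_le h with h | h
      · exact .inr (.inl (Fin.ext h.symm))
      · rcases Nat.eq_or_lt_of_le h with h | h
        · exact .inr (.inr (.inl (Fin.ext h.symm)))
        · refine .inr (.inr (.inr ⟨⟨j.1 - 1, by omega⟩, ?_, Fin.ext ?_⟩))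
          · change i.1 < j.1 - 1
            omega
          · simp only [Fin.val_succ]
            omega
  have pinj : ∀ j k, p j = p k → j = k ∨ p j = i := by
    intro j k e
    rcases cases j with ⟨j', hj, rfl⟩ | rfl | rfl | ⟨j', hj, rfl⟩
    · left
      rw [pl _ hj] at e
      rcases cases k with ⟨k', hk, rfl⟩ | rfl | rfl | ⟨k', hk, rfl⟩
      · rw [e, pl _ hk]
      · exact absurd (e.trans pi) hj.ne
      · exact absurd (e.trans pi') hj.ne
      · rw [pr _ hk] at e
        exact absurd (e ▸ hj) hk.not_gt
    · exact .inr pi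
    · exact .inr pi'
    · left
      rw [pr _ hj] at e
      rcases cases k with ⟨k', hk, rfl⟩ | rfl | rfl | ⟨k', hk, rfl⟩
      · rw [pl _ hk] at e
        exact absurd (e ▸ hj) hk.not_gt
      · exact absurd (e.trans pi) hj.ne'
      · exact absurd (e.trans pi') hj.ne'
      · rw [e, pr _ hk]
  have zsurj : ∀ (a : Fin (n + 2) → SignType) j', cubeConnection i a j' = 0 →
      ∃ j, a j = 0 ∧ p j = j' := by
    intro a j' h
    rcases lt_trichotomy j' i with hj | rfl | hj
    · exact ⟨_, by rw [← h, cl _ _ hj], pl _ hj⟩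
    · rw [ci] at h
      rcases max_choice (a j'.castSucc) (a j'.succ) with h' | h'
      · exact ⟨_, h'.symm.trans h, pi⟩
      · exact ⟨_, h'.symm.trans h, pi'⟩
    · exact ⟨_, by rw [← h, cr _ _ hj], pr _ hj⟩
  ext α m b
  constructor
  · rintro ⟨hb, (a : Fin (n + 2) → SignType), ha, rfl⟩
    change (Finset.univ.filter (fun i' => cubeConnection i a i' = 0)).card = m at hb
    obtain ⟨h₁, h₂, h₃⟩ := (cube_mem_atom x a α m).1 ha
    refine (cube_mem_atom _ _ α m).2 ?_
    -- As the dimension does not drop, no letter `0` is lost.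
    have hsub : Finset.univ.filter (fun i' => cubeConnection i a i' = 0) ⊆
        (Finset.univ.filter (fun j => a j = 0)).image p := fun j' hj' => by
      obtain ⟨j, hj, e⟩ := zsurj a j' (Finset.mem_filter.1 hj').2
      exact Finset.mem_image.2 ⟨j, Finset.mem_filter.2 ⟨Finset.mem_univ _, hj⟩, e⟩
    have hle : ((Finset.univ.filter (fun j => a j = 0)).image p).card ≤
      (Finset.univ.filter (fun j => a j = 0)).card := Finset.card_image_le
    have heq := Finset.eq_of_subset_of_card_le hsub (by omega)
    have hinj : Set.InjOn p (Finset.univ.filter (fun j => a j = 0) : Finset (Fin (n + 2))) :=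
      Finset.card_image_iff.1 (by rw [← heq]; omega)
    have hz : ∀ j, a j = 0 → cubeConnection i a (p j) = 0 := fun j hj => by
      have : p j ∈ Finset.univ.filter (fun i' => cubeConnection i a i' = 0) := by
        rw [heq]
        exact Finset.mem_image_of_mem p (Finset.mem_filter.2 ⟨Finset.mem_univ _, hj⟩)
      exact (Finset.mem_filter.1 this).2
    obtain ⟨-, t, -⟩ := zeros_transport hp
      (fun j k hj hk e => hinj (by simpa using hj) (by simpa using hk) e) hz (zsurj a)
    have t' : ∀ j, cubeConnection i a (p j) ≠ 0 →
        zerosBefore a j = zerosBefore (cubeConnection i a) (p j) := fun j hj =>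
      t j (fun k _ hk e => hj (e ▸ hz k hk))
    refine ⟨fun j' => ?_, hb, fun j' hx hne => ?_⟩
    · rcases lt_trichotomy j' i with hj | rfl | hj
      · rw [cl _ _ hj, cl _ _ hj]; exact h₁ _
      · rw [ci, ci]
        have e₁ := h₁ j'.castSucc
        have e₂ := h₁ j'.succ
        revert e₁ e₂
        generalize x j'.castSucc = x₁, x j'.succ = x₂, a j'.castSucc = a₁, a j'.succ = a₂
        revert x₁ x₂ a₁ a₂
        decide
      · rw [cr _ _ hj, cr _ _ hj]; exact h₁ _
    · rcases lt_trichotomy j' i with hj | rfl | hj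
      · have e := t' j'.castSucc (by rwa [pl _ hj])
        rw [pl _ hj] at e
        rw [cl _ _ hj] at hx hne ⊢
        rw [← e]
        exact h₃ _ hx hne
      · have e₁ := t' j'.castSucc (by rwa [pi])
        have e₂ := t' j'.succ (by rwa [pi'])
        rw [pi] at e₁
        rw [pi'] at e₂
        have f₁ := h₃ j'.castSucc
        have f₂ := h₃ j'.succ
        rw [e₁] at f₁
        rw [e₂] at f₂
        have g₁ := h₁ j'.castSucc
        have g₂ := h₁ j'.succ
        have z₁ := hz j'.castSucc
        have z₂ := hz j'.succ
        rw [pi, ci] at z₁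
        rw [pi', ci] at z₂
        have hs := sign_pow_ne_zero
          (zerosBefore (cubeConnection j' a) j' + 1 + if α = true then 1 else 0)
        rw [ci] at hx hne ⊢
        exact merge_signs _ hs _ _ _ _ hx hne f₁ f₂ g₁ g₂ z₁ z₂
      · have e := t' j'.succ (by rwa [pr _ hj])
        rw [pr _ hj] at e
        rw [cr _ _ hj] at hx hne ⊢
        rw [← e]
        exact h₃ _ hx hne
  · intro hb
    obtain ⟨h₁, h₂, h₃⟩ := (cube_mem_atom _ b α m).1 hb
    -- The two letters that lie over the letter `i` of `b`.
    obtain ⟨u, v, huv, hu, hv, hus, hvs, hu0, hv0, h00⟩ : ∃ u v : SignType, max u v = b i ∧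
        (x i.castSucc = 0 ∨ u = x i.castSucc) ∧ (x i.succ = 0 ∨ v = x i.succ) ∧
        (x i.castSucc = 0 → u ≠ 0 →
          u = (-1) ^ (zerosBefore b i + 1 + if α = true then 1 else 0)) ∧
        (x i.succ = 0 → v ≠ 0 → v = if u = 0 then
          -(-1) ^ (zerosBefore b i + 1 + if α = true then 1 else 0) else
          (-1) ^ (zerosBefore b i + 1 + if α = true then 1 else 0)) ∧
        (u = 0 → b i = 0) ∧ (v = 0 → b i = 0) ∧ ¬ (u = 0 ∧ v = 0) := by
      have g₁ := h₁ i
      have g₂ := h₃ i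
      have hs := sign_pow_ne_zero (zerosBefore b i + 1 + if α = true then 1 else 0)
      rw [ci] at g₁ g₂
      exact merge_letters _ hs _ _ _ g₁ g₂
    let a : Fin (n + 2) → SignType := fun j =>
      if j = i.castSucc then u else if j = i.succ then v else b (p j)
    have au : a i.castSucc = u := by simp only [a, if_true]
    have av : a i.succ = v := by simp only [a, if_neg lt.ne', if_true]
    have ao : ∀ j, p j ≠ i → a j = b (p j) := fun j hj => by
      have n₁ : j ≠ i.castSucc := fun e => hj (e ▸ pi)
      have n₂ : j ≠ i.succ := fun e => hj (e ▸ pi')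
      simp only [a, if_neg n₁, if_neg n₂]
    have hab : cubeConnection i a = b := by
      funext j'
      rcases lt_trichotomy j' i with hj | rfl | hj
      · rw [cl _ _ hj, ao _ (by rw [pl _ hj]; exact hj.ne), pl _ hj]
      · rw [ci, au, av, huv]
      · rw [cr _ _ hj, ao _ (by rw [pr _ hj]; exact hj.ne'), pr _ hj]
    have hi : ∀ j, p j = i → j = i.castSucc ∨ j = i.succ := by
      intro j e
      rcases cases j with ⟨j', hj, rfl⟩ | rfl | rfl | ⟨j', hj, rfl⟩
      · exact absurd ((pl _ hj).symm.trans e) hj.ne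
      · exact .inl rfl
      · exact .inr rfl
      · exact absurd ((pr _ hj).symm.trans e) hj.ne'
    have hz : ∀ j, a j = 0 → b (p j) = 0 := by
      intro j hj
      by_cases h : p j = i
      · rw [h]
        rcases hi j h with rfl | rfl
        · exact hu0 (au.symm.trans hj)
        · exact hv0 (av.symm.trans hj)
      · rw [← ao j h, hj]
    obtain ⟨c, t₂, t₃⟩ := zeros_transport hp (a := a) (b := b) (fun j k hj hk e => by
        rcases pinj j k e with h | h
        · exact h
        · rcases hi j h with rfl | rfl <;> rcases hi k (e ▸ h) with rfl | rfl
          · rfl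
          · exact absurd ⟨au.symm.trans hj, av.symm.trans hk⟩ h00
          · exact absurd ⟨au.symm.trans hk, av.symm.trans hj⟩ h00
          · rfl) hz (fun j' hj' => zsurj a j' (by rw [hab, hj']))
    refine ⟨h₂, a, (cube_mem_atom x a α m).2 ⟨fun j => ?_, c ▸ h₂, fun j hx hne => ?_⟩, hab⟩
    · rcases cases j with ⟨j', hj, rfl⟩ | rfl | rfl | ⟨j', hj, rfl⟩
      · have := h₁ j'
        rwa [cl _ _ hj, ← pl _ hj, ← ao _ (by rw [pl _ hj]; exact hj.ne), pl _ hj] at this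
      · rwa [au]
      · rwa [av]
      · have := h₁ j'
        rwa [cr _ _ hj, ← pr _ hj, ← ao _ (by rw [pr _ hj]; exact hj.ne'), pr _ hj] at this
    · rcases cases j with ⟨j', hj, rfl⟩ | rfl | rfl | ⟨j', hj, rfl⟩
      · have hj' : p j'.castSucc ≠ i := by rw [pl _ hj]; exact hj.ne
        rw [t₂ _ (fun k hk _ e => (pinj k _ e).elim (fun h => hk.ne h) (fun h => hj' (e ▸ h)))]
        rw [ao _ hj', pl _ hj] at hne ⊢
        exact h₃ j' (by rw [cl _ _ hj, hx]) hne
      · rw [t₂ _ (fun k hk _ e => by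
          rcases hi k (e.trans pi) with rfl | rfl
          · exact lt_irrefl _ hk
          · exact absurd hk lt.not_gt), pi, au]
        exact hus hx (au ▸ hne)
      · have := hvs hx (av ▸ hne)
        rw [av, this]
        by_cases hu' : u = 0
        · rw [t₃ i.succ i.castSucc lt (au.trans hu') (pi.trans pi'.symm), pi', if_pos hu']
          rw [show zerosBefore b i + 1 + 1 + (if α = true then 1 else 0) =
            (zerosBefore b i + 1 + if α = true then 1 else 0) + 1 by omega, pow_succ]
          generalize (-1 : SignType) ^ (zerosBefore b i + 1 + if α = true then 1 else 0) = s
          revert s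
          decide
        · rw [t₂ _ (fun k hk hk' e => by
            rcases hi k (e.trans pi') with rfl | rfl
            · exact hu' (au.symm.trans hk')
            · exact lt_irrefl _ hk), pi', if_neg hu']
      · have hj' : p j'.succ ≠ i := by rw [pr _ hj]; exact hj.ne'
        rw [t₂ _ (fun k hk _ e => (pinj k _ e).elim (fun h => hk.ne h) (fun h => hj' (e ▸ h)))]
        rw [ao _ hj', pr _ hj] at hne ⊢
        exact h₃ j' (by rw [cr _ _ hj, hx]) hne

/-- The `ω`-functor `γ⁻ᵢ₊₁ : Iⁿ⁺² ⟶ Iⁿ⁺¹`. -/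
def cubeγ {n : ℕ} (i : Fin (n + 1)) : cube (n + 2) ⟶ cube (n + 1) :=
  FaceComplex.mapOmega (K := cubeComplex (n + 2)) (L := cubeComplex (n + 1)) (cubeConnection i)
    (cubeConnection_atom i)

/-! ### The statement -/

/-- The cell `R(-_n)`: the initial vertex of the `n`-cube. -/
def cubeBase (n : ℕ) : (cube n).carrier := (cubeComplex n).cell (fun _ : Fin n => (-1 : SignType))

/-- The `ω`-category `ℙ⁻_{R(-_n)}(Iⁿ)`. -/
noncomputable def cubeSemiPath (n : ℕ) : OmegaCat.{0} :=
  (cube n).semiPathAt (cube_nonContracting n) (cubeBase n)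

/-- An `ω`-functor `g` between the `ω`-categories `ℙ⁻_{R(-_m)}(Iᵐ)` and `ℙ⁻_{R(-_n)}(Iⁿ)` is induced
by an `ω`-functor `f : Iᵐ ⟶ Iⁿ` if for every path `x` that starts at `R(-_m)`, `f x` is a
path that starts at `R(-_n)` and `g (h⁻ x) = h⁻ (f x)`. -/
def InducedBy {m n : ℕ} (f : cube m ⟶ cube n) (g : cubeSemiPath m ⟶ cubeSemiPath n) : Prop :=
  ∀ (x : (cube m).carrier) (hx : 1 ≤ (cube m).dim x) (hs : (cube m).d false 0 x = cubeBase m),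
    ∃ (hx' : 1 ≤ (cube n).dim (OmegaCat.Hom.toFun f x))
      (hs' : (cube n).d false 0 (OmegaCat.Hom.toFun f x) = cubeBase n),
      OmegaCat.Hom.toFun g ((cube m).germ (cube_nonContracting m) x hx hs) =
        (cube n).germ (cube_nonContracting n) (OmegaCat.Hom.toFun f x) hx' hs'

/-- The map `φ⁻ₙ` from the faces of the `n`-simplex to the faces of the `(n + 1)`-cube: the letter
in position `i + 1` is `0` if `i` is a vertex of the face, and `-` otherwise. -/
def simplexToCube {n : ℕ} (σ : (simplexComplex n).Face) : Fin (n + 1) → SignType :=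
  fun i => if i ∈ σ.1 then 0 else -1

/-! A germ remembers only the faces without a letter `+`. If `x *₀ y` is a composite of two paths in
the cube, then `x` already raises some letter from `-` to `+`, and this letter is `+` in every face
of `y`. Hence the faces of positive dimension of `x *₀ y` that have no letter `+` are those of `x`
(`toSimplex_comp_zero`). These faces are the words `simplexToCube σ`, and on them the sign rule of
the cube becomes the parity rule of the simplex (`has_simplexToCube_atom`). Keeping only them and
lowering degrees by one gives an `ω`-functor from the semi-paths of the `(n + 1)`-cube to tables of
the `n`-simplex, which sends the germ of the face of `σ` to the atom of `σ`.

The task is to show that this functor is injective on the fiber over the initial vertex. Every cell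
of a cube is a composite of cells `R(x)`, with no further sources or targets needed (`decomposes`,
by induction along the product of an interval with a cube). In germs a composite in degree `0`
collapses to its first factor, and a positive-dimensional face that starts at the initial vertex has
no letter `+`. So the fiber is generated under composition alone by one cell over each face `σ`, of
dimension at most `dim σ` (`compGen_germ`). It turns out that this is enough: in any `ω`-category
over the tables of a simplex that is generated in this way, a cell is determined by its table
(`AtomicOver.tab_injective`).

This rigidity has two sources. First, the table of a composite is determined by its maximal faces
(`mem_val_iff`), and the maximal faces of dimension above `k` of a composite in degree `k` are
distributed disjointly over the two factors. Both facts are proved by testing tables against sets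
`H` of cut points, which play the role of sample points: a source or target contains at most one
face with exactly one vertex in each interval of `H`, and this face is extremal, alternately towards
the end and the beginning of the intervals (`Coherent`). Secondly, there is a total order of all
faces in which the faces in the sources of a simplex precede it and those in its targets follow it
(`key_of_inBd`). Two adjacent factors in the wrong order can therefore be interchanged, and a cell
can be cut in degree `j` at any place of this order, as long as it has at most one maximal face of
dimension above `j + 1` (`splitAt`). The tables of the two pieces are forced by the table of the
cell (`IsCut.tab_eq`), so that injectivity follows by induction on `j` and on the number of maximal
faces (`injAt_succ`).

Surjectivity onto the oriental is then formal, because injectivity allows composability of tables to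
be lifted to cells. Induced `ω`-functors are unique since germs generate the fibers. They exist
since they can be transported from the orientals: the face maps and connections act on the words
without a letter `+` as the cofaces and codegeneracies act on subsets (`LiesOver.inducedBy`). -/

/-! ### Counting vertices and covers -/

namespace SimplexFace

variable {N : ℕ}

/-- The number of elements of `s` below `v`. -/
def cntLt (s : Finset (Fin N)) (v : Fin N) : ℕ := (s.filter (· < v)).card

/-- The number of elements of `s` that are at most `v`. -/
def cntLe (s : Finset (Fin N)) (v : Fin N) : ℕ := (s.filter (· ≤ v)).card

theorem cntLt_mono (s : Finset (Fin N)) {v w : Fin N} (h : v ≤ w) : cntLt s v ≤ cntLt s w :=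
  Finset.card_le_card fun _ hu => Finset.mem_filter.2
    ⟨(Finset.mem_filter.1 hu).1, (Finset.mem_filter.1 hu).2.trans_le h⟩

theorem cntLe_mono (s : Finset (Fin N)) {v w : Fin N} (h : v ≤ w) : cntLe s v ≤ cntLe s w :=
  Finset.card_le_card fun _ hu => Finset.mem_filter.2
    ⟨(Finset.mem_filter.1 hu).1, (Finset.mem_filter.1 hu).2.trans h⟩

theorem cntLe_le_cntLt (s : Finset (Fin N)) {v w : Fin N} (h : v < w) : cntLe s v ≤ cntLt s w :=
  Finset.card_le_card fun _ hu => Finset.mem_filter.2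
    ⟨(Finset.mem_filter.1 hu).1, (Finset.mem_filter.1 hu).2.trans_lt h⟩

theorem cntLt_le_cntLe (s : Finset (Fin N)) (v : Fin N) : cntLt s v ≤ cntLe s v :=
  Finset.card_le_card fun _ hu => Finset.mem_filter.2
    ⟨(Finset.mem_filter.1 hu).1, (Finset.mem_filter.1 hu).2.le⟩

theorem cntLe_eq (s : Finset (Fin N)) (v : Fin N) :
    cntLe s v = cntLt s v + if v ∈ s then 1 else 0 := by
  unfold cntLe cntLt
  split_ifs with h
  · rw [← Finset.card_insert_of_notMem (a := v) (by simp)]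
    congr 1
    ext u
    simp only [Finset.mem_filter, Finset.mem_insert]
    constructor
    · rintro ⟨h₁, h₂⟩
      rcases h₂.eq_or_lt with rfl | h₂
      · exact .inl rfl
      · exact .inr ⟨h₁, h₂⟩
    · rintro (rfl | ⟨h₁, h₂⟩)
      · exact ⟨h, le_rfl⟩
      · exact ⟨h₁, h₂.le⟩
  · rw [add_zero]
    congr 1
    refine Finset.filter_congr fun u hu => ⟨fun h₂ => lt_of_le_of_ne h₂ ?_, le_of_lt⟩
    rintro rfl
    exact h hu

theorem cntLe_le_card (s : Finset (Fin N)) (v : Fin N) : cntLe s v ≤ s.card :=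
  Finset.card_le_card (Finset.filter_subset _ _)

/-- The strict counts determine membership of every vertex except the last one, which lies below no
vertex; the cardinality settles that one. -/
theorem ext_of_cntLt {s t : Finset (Fin N)} (h : s.card = t.card)
    (h' : ∀ v, cntLt s v = cntLt t v) : s = t := by
  have key : ∀ v, cntLe s v = cntLe t v := by
    intro v
    by_cases hv : v.1 + 1 < N
    · have e : ∀ r : Finset (Fin N), cntLe r v = cntLt r ⟨v.1 + 1, hv⟩ := fun r => by
        unfold cntLe cntLt
        congr 1
        refine Finset.filter_congr fun u _ => ?_
        rw [Fin.le_def, Fin.lt_def]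
        exact Nat.lt_succ_iff.symm
      rw [e, e, h']
    · have e : ∀ r : Finset (Fin N), cntLe r v = r.card := fun r => by
        unfold cntLe
        congr 1
        refine Finset.filter_true_of_mem fun u _ => ?_
        rw [Fin.le_def]
        omega
      rw [e, e, h]
  ext v
  have h₁ := cntLe_eq s v
  have h₂ := cntLe_eq t v
  rw [key v, h₂, h' v] at h₁
  by_cases hs : v ∈ s <;> by_cases ht : v ∈ t <;> simp [hs, ht] at h₁ ⊢

/-- The face `f` covers the set `H` of cut points: there is exactly one vertex of `f` in each of the
intervals into which `H` cuts the ordered set of all vertices. -/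
def Cov (f H : Finset (Fin N)) : Prop :=
  f.card = H.card + 1 ∧ ∀ v, cntLe H v ≤ cntLt f v ∧ cntLe f v ≤ cntLe H v + 1

/-- The two inequalities of a cover squeeze at a vertex of `f`: the number of its interval is its
rank in `f`. -/
theorem Cov.cntLe_eq_cntLt {f H : Finset (Fin N)} (h : Cov f H) {w : Fin N} (hw : w ∈ f) :
    cntLe H w = cntLt f w := by
  have h₁ := h.2 w
  have h₂ := cntLe_eq f w
  rw [if_pos hw] at h₂
  omega

theorem cntLt_lt {s : Finset (Fin N)} {v w : Fin N} (hv : v ∈ s) (h : v < w) :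
    cntLt s v < cntLt s w := by
  have h₁ := cntLe_eq s v
  rw [if_pos hv] at h₁
  have := cntLe_le_cntLt s h
  omega

/-- Every interval of a cover contains a vertex. -/
theorem Cov.exists_mem {f H : Finset (Fin N)} (h : Cov f H) {i : ℕ} (hi : i ≤ H.card) :
    ∃ w ∈ f, cntLe H w = i := by
  -- By `Cov.cntLe_eq_cntLt` distinct vertices lie in distinct intervals, and there are as many
  -- vertices as intervals.
  have himg : f.image (cntLe H) = Finset.range (H.card + 1) := by
    refine Finset.eq_of_subset_of_card_le (fun i hi => ?_) ?_
    · obtain ⟨w, _, rfl⟩ := Finset.mem_image.1 hi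
      have := cntLe_le_card H w
      rw [Finset.mem_range]
      omega
    · rw [Finset.card_range, Finset.card_image_of_injOn, h.1]
      intro v hv w hw e
      replace e : cntLe H v = cntLe H w := e
      rw [h.cntLe_eq_cntLt hv, h.cntLe_eq_cntLt hw] at e
      rcases lt_trichotomy v w with hlt | rfl | hlt
      · have := cntLt_lt hv hlt
        omega
      · rfl
      · have := cntLt_lt hw hlt
        omega
  have : i ∈ f.image (cntLe H) := by
    rw [himg, Finset.mem_range]
    omega
  exact Finset.mem_image.1 this

/-- A face covers the set of all its vertices but the first. -/
theorem cov_erase_min (f : Finset (Fin N)) (hf : f.Nonempty) : Cov f (f.erase (f.min' hf)) := by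
  have hm := Finset.min'_mem f hf
  refine ⟨by rw [Finset.card_erase_of_mem hm]; have := hf.card_pos; omega, fun v => ?_⟩
  -- If `v` precedes all vertices, both counts vanish and the truncated subtraction does no harm.
  have key : cntLe (f.erase (f.min' hf)) v = cntLe f v - 1 := by
    unfold cntLe
    rw [Finset.filter_erase]
    by_cases h : f.min' hf ≤ v
    · rw [Finset.card_erase_of_mem (Finset.mem_filter.2 ⟨hm, h⟩)]
    · have e : f.filter (· ≤ v) = ∅ :=
        Finset.filter_eq_empty_iff.2 fun u hu hu' => h ((Finset.min'_le f u hu).trans hu')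
      simp [e]
  rw [key]
  have := cntLe_eq f v
  split_ifs at this <;> omega

/-! ### Extremal faces over a set of cut points -/

/-- Comparison of two faces that cover the same set. -/
def Below (α : Bool) (H e a : Finset (Fin N)) : Prop :=
  ∀ v, (Even (cntLe H v + if α = true then 1 else 0) → cntLt e v ≤ cntLt a v) ∧
    (¬ Even (cntLe H v + if α = true then 1 else 0) → cntLt a v ≤ cntLt e v)

theorem Below.trans {α : Bool} {H a b c : Finset (Fin N)} (h : Below α H a b)
    (h' : Below α H b c) : Below α H a c :=
  fun v => ⟨fun e => ((h v).1 e).trans ((h' v).1 e), fun e => ((h' v).2 e).trans ((h v).2 e)⟩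

theorem Below.antisymm {α : Bool} {H a b : Finset (Fin N)} (hc : a.card = b.card)
    (h : Below α H a b) (h' : Below α H b a) : a = b :=
  ext_of_cntLt hc fun v => by
    by_cases e : Even (cntLe H v + if α = true then 1 else 0)
    · exact le_antisymm ((h v).1 e) ((h' v).1 e)
    · exact le_antisymm ((h' v).2 e) ((h v).2 e)

/-- Changing the sign exchanges the two parities of intervals, hence reverses the order. A face that
is extremal both from the side of the source and from that of the target is pinned down in this way
by `Below.antisymm`. -/
theorem below_not {α : Bool} {H a b : Finset (Fin N)} : Below (!α) H a b ↔ Below α H b a := by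
  unfold Below
  refine forall_congr' fun v => ?_
  cases α <;> simp [Nat.even_add_one] <;> tauto

/-- The sources and targets of a simplex `s`. -/
def InBd (α : Bool) (s f : Finset (Fin N)) : Prop :=
  f ⊆ s ∧ ∀ v ∈ s, v ∉ f → ¬ Even (cntLt f v + if α = false then 1 else 0)

theorem InBd.mono {α : Bool} {s t f : Finset (Fin N)} (h : InBd α s f) (ht : t ⊆ s)
    (hf : f ⊆ t) : InBd α t f :=
  ⟨hf, fun v hv hv' => h.2 v (ht hv) hv'⟩

/-- In a simplex, a face of the source or of the target is extremal among the faces that cover a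
given set. -/
theorem InBd.below {α : Bool} {s f a H : Finset (Fin N)} (h : InBd α s f) (hf : Cov f H)
    (ha : a ⊆ s) (hc : Cov a H) : Below α H f a := by
  intro v
  have f₁ := hf.2 v
  have a₁ := hc.2 v
  have f₂ := cntLt_le_cntLe f v
  have a₂ := cntLt_le_cntLe a v
  constructor
  · intro e
    by_contra hlt
    push Not at hlt
    -- The first vertex of `a` that is at least `v`.
    have hne : (a.filter (v ≤ ·)).Nonempty := by
      by_contra hcon
      rw [Finset.not_nonempty_iff_eq_empty, Finset.filter_eq_empty_iff] at hcon
      have e₁ : cntLt a v = a.card := by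
        unfold cntLt
        rw [Finset.filter_true_of_mem fun u hu => lt_of_not_ge (hcon hu)]
      have := cntLe_le_card f v
      have := hf.1
      have := hc.1
      omega
    have hw := Finset.mem_filter.1 (Finset.min'_mem _ hne)
    have hmin : ∀ u ∈ a, v ≤ u → (a.filter (v ≤ ·)).min' hne ≤ u := fun u hu hu' =>
      Finset.min'_le _ u (Finset.mem_filter.2 ⟨hu, hu'⟩)
    generalize (a.filter (v ≤ ·)).min' hne = w at hw hmin
    have e₁ : cntLt a w = cntLt a v := by
      unfold cntLt
      congr 1
      exact Finset.filter_congr fun u hu => ⟨fun h' => lt_of_not_ge fun h'' =>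
        absurd h' (hmin u hu h'').not_gt, fun h' => h'.trans_le hw.2⟩
    have e₂ := hc.cntLe_eq_cntLt hw.1
    have f₃ := hf.2 w
    have f₄ := cntLt_le_cntLe f w
    have f₅ := cntLt_mono f hw.2
    -- The vertex `w` of `a` lies in the interval of `v`, whose only vertex of `f` comes before `v`.
    -- So `w` is a vertex of `s` omitted by `f` with one more vertex of `f` below it than the number
    -- of the interval, a parity that `InBd` forbids.
    have hwf : w ∉ f := fun hwf => by
      have := hf.cntLe_eq_cntLt hwf
      omega
    have := h.2 w (ha hw.1) hwf
    have e₃ : cntLt f w = cntLe H v + 1 := by omega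
    rw [e₃] at this
    revert e this
    generalize cntLe H v = k
    cases α <;> simp [Nat.even_add_one]
  · intro e
    by_contra hlt
    push Not at hlt
    -- The last vertex of `a` below `v`.
    have hne : (a.filter (· < v)).Nonempty := by
      rw [← Finset.card_pos]
      change 0 < cntLt a v
      omega
    have hw := Finset.mem_filter.1 (Finset.max'_mem _ hne)
    have hmax : ∀ u ∈ a, u < v → u ≤ (a.filter (· < v)).max' hne := fun u hu hu' =>
      Finset.le_max' _ u (Finset.mem_filter.2 ⟨hu, hu'⟩)
    generalize (a.filter (· < v)).max' hne = w at hw hmax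
    have e₁ : cntLe a w = cntLt a v := by
      unfold cntLt cntLe
      congr 1
      exact Finset.filter_congr fun u hu => ⟨fun h' => h'.trans_lt hw.2, hmax u hu⟩
    have e₂ := hc.cntLe_eq_cntLt hw.1
    have e₄ := cntLe_eq a w
    rw [if_pos hw.1] at e₄
    have f₃ := hf.2 w
    have f₄ := cntLt_le_cntLe f w
    have f₅ := cntLt_mono f hw.2.le
    have hwf : w ∉ f := fun hwf => by
      have := cntLt_lt hwf hw.2
      omega
    have := h.2 w (ha hw.1) hwf
    have e₃ : cntLt f w = cntLe H v := by omega
    rw [e₃] at this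
    revert e this
    generalize cntLe H v = k
    cases α <;> simp [Nat.even_add_one]

/-- In a simplex, there is a face of the source and one of the target above every covered set. -/
theorem exists_inBd (α : Bool) {s a H : Finset (Fin N)} (ha : a ⊆ s) (hc : Cov a H) :
    ∃ f, InBd α s f ∧ Cov f H := by
  classical
  -- The intervals in which the last vertex of `s` is chosen; in the others the first one is. For
  -- the source these are the intervals of even number, for the target those of odd number.
  let p : ℕ → Prop := fun i => Even (i + if α = true then 1 else 0)
  have lift : ∀ i ≤ H.card, ∃ w ∈ s, cntLe H w = i ∧ ∀ u ∈ s, cntLe H u = i →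
      (p i → u ≤ w) ∧ (¬ p i → w ≤ u) := by
    intro i hi
    have hne : (s.filter (fun w => cntLe H w = i)).Nonempty := by
      obtain ⟨w, hw, e⟩ := hc.exists_mem hi
      exact ⟨w, Finset.mem_filter.2 ⟨ha hw, e⟩⟩
    by_cases hp : p i
    · have hm := Finset.mem_filter.1 (Finset.max'_mem _ hne)
      exact ⟨_, hm.1, hm.2, fun u hu e =>
        ⟨fun _ => Finset.le_max' _ u (Finset.mem_filter.2 ⟨hu, e⟩), fun h => absurd hp h⟩⟩
    · have hm := Finset.mem_filter.1 (Finset.min'_mem _ hne)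
      exact ⟨_, hm.1, hm.2, fun u hu e =>
        ⟨fun h => absurd h hp, fun _ => Finset.min'_le _ u (Finset.mem_filter.2 ⟨hu, e⟩)⟩⟩
  have : Nonempty (Fin N) := ⟨(lift 0 (Nat.zero_le _)).choose⟩
  choose! w hws hwi hw using lift
  let f : Finset (Fin N) := (Finset.range (H.card + 1)).image w
  have mem : ∀ {u}, u ∈ f → cntLe H u ≤ H.card ∧ w (cntLe H u) = u := by
    intro u hu
    obtain ⟨i, hi, rfl⟩ := Finset.mem_image.1 hu
    rw [Finset.mem_range] at hi
    rw [hwi i (by omega)]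
    exact ⟨by omega, rfl⟩
  have mem' : ∀ i ≤ H.card, w i ∈ f := fun i hi =>
    Finset.mem_image_of_mem w (Finset.mem_range.2 (by omega))
  have winj : Set.InjOn w (Finset.range (H.card + 1) : Finset ℕ) := by
    intro i hi j hj e
    rw [Finset.mem_coe, Finset.mem_range] at hi hj
    rw [← hwi i (by omega), ← hwi j (by omega), e]
  have hf : Cov f H := by
    refine ⟨by rw [Finset.card_image_of_injOn winj, Finset.card_range], fun v => ⟨?_, ?_⟩⟩
    · rw [← Finset.card_range (cntLe H v), cntLt]
      have hle := cntLe_le_card H v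
      refine Finset.card_le_card_of_injOn w (fun i hi => ?_)
        (winj.mono fun i hi => ?_)
      · rw [Finset.mem_coe, Finset.mem_range] at hi
        rw [Finset.mem_coe, Finset.mem_filter]
        refine ⟨mem' i (by omega), lt_of_not_ge fun h => ?_⟩
        have := cntLe_mono H h
        rw [hwi i (by omega)] at this
        omega
      · rw [Finset.mem_coe, Finset.mem_range] at hi ⊢
        omega
    · rw [← Finset.card_range (cntLe H v + 1), cntLe]
      refine Finset.card_le_card_of_injOn (cntLe H) (fun u hu => ?_) (fun u hu u' hu' e => ?_)
      · rw [Finset.mem_coe, Finset.mem_filter] at hu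
        rw [Finset.mem_coe, Finset.mem_range]
        have := cntLe_mono H hu.2
        omega
      · rw [Finset.mem_coe, Finset.mem_filter] at hu hu'
        rw [← (mem hu.1).2, ← (mem hu'.1).2, e]
  refine ⟨f, ⟨fun u hu => ?_, fun v hv hvf => ?_⟩, hf⟩
  · obtain ⟨h₁, h₂⟩ := mem hu
    rw [← h₂]
    exact hws _ h₁
  · have hle := cntLe_le_card H v
    have hm := mem' _ hle
    have hne : v ≠ w (cntLe H v) := fun e => hvf (e ▸ hm)
    have h₁ := hf.cntLe_eq_cntLt hm
    rw [hwi _ hle] at h₁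
    have h₂ := hf.2 v
    have h₃ := cntLt_le_cntLe f v
    have h₄ := hw _ hle v hv rfl
    -- An omitted vertex lies before the chosen vertex of its interval in the first case and after
    -- it in the second. The number of vertices of `f` below it is thus the number of the interval,
    -- or one more, and has the required parity.
    by_cases hp : p (cntLe H v)
    · have h₅ := cntLe_le_cntLt f (lt_of_le_of_ne (h₄.1 hp) hne)
      have e : cntLt f v = cntLe H v := by omega
      rw [e]
      simp only [p] at hp
      revert hp
      cases α <;> simp [Nat.even_add_one]
    · have h₅ := cntLt_lt hm (lt_of_le_of_ne (h₄.2 hp) hne.symm)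
      have e : cntLt f v = cntLe H v + 1 := by omega
      rw [e]
      simp only [p] at hp
      revert hp
      cases α <;> simp [Nat.even_add_one]

/-- Removing the first cut point and one of the first two vertices of a cover. -/
theorem Cov.drop {f H : Finset (Fin N)} (h : Cov f H) (hH : H.Nonempty) :
    ∃ a ⊆ f, ∃ a' ⊆ f, Cov a (H.erase (H.min' hH)) ∧ Cov a' (H.erase (H.min' hH)) ∧
      cntLe (H.erase (H.min' hH)) (H.min' hH) = 0 ∧
      cntLt a (H.min' hH) = 0 ∧ 1 ≤ cntLt a' (H.min' hH) := by
  have hm := Finset.min'_mem H hH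
  have hmin : ∀ u ∈ H, H.min' hH ≤ u := fun u hu => Finset.min'_le H u hu
  have hpos := hH.card_pos
  generalize H.min' hH = x at hm hmin
  have cH : (H.erase x).card = H.card - 1 := Finset.card_erase_of_mem hm
  have er : ∀ {s : Finset (Fin N)} {y v : Fin N}, y ∈ s → y ≤ v →
      cntLe (s.erase y) v = cntLe s v - 1 := by
    intro s y v hy h
    unfold cntLe
    rw [Finset.filter_erase, Finset.card_erase_of_mem (Finset.mem_filter.2 ⟨hy, h⟩)]
  have er' : ∀ {s : Finset (Fin N)} {y v : Fin N}, y ∈ s → y < v →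
      cntLt (s.erase y) v = cntLt s v - 1 := by
    intro s y v hy h
    unfold cntLt
    rw [Finset.filter_erase, Finset.card_erase_of_mem (Finset.mem_filter.2 ⟨hy, h⟩)]
  have er₂ : ∀ {s : Finset (Fin N)} {y v : Fin N}, cntLe (s.erase y) v ≤ cntLe s v :=
    fun {s y v} => Finset.card_le_card (Finset.filter_subset_filter _ (Finset.erase_subset _ _))
  have er₃ : ∀ {s : Finset (Fin N)} {y v : Fin N}, v ≤ y →
      cntLt (s.erase y) v = cntLt s v := by
    intro s y v h
    unfold cntLt
    rw [Finset.filter_erase, Finset.erase_eq_of_notMem]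
    rw [Finset.mem_filter]
    exact fun h' => absurd h'.2 h.not_gt
  have er₄ : ∀ {s : Finset (Fin N)} {y v : Fin N}, v < y →
      cntLe (s.erase y) v = cntLe s v := by
    intro s y v h
    unfold cntLe
    rw [Finset.filter_erase, Finset.erase_eq_of_notMem]
    rw [Finset.mem_filter]
    exact fun h' => absurd h'.2 h.not_ge
  have er₅ : ∀ {s : Finset (Fin N)} {y v : Fin N}, cntLt s v - 1 ≤ cntLt (s.erase y) v := by
    intro s y v
    unfold cntLt
    rw [Finset.filter_erase]
    exact Finset.pred_card_le_card_erase
  have zH : ∀ v, v < x → cntLe H v = 0 := fun v hv => by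
    unfold cntLe
    rw [Finset.card_eq_zero, Finset.filter_eq_empty_iff]
    exact fun u hu hu' => absurd (hmin u hu) (hu'.trans_lt hv).not_ge
  have oH : cntLe H x = 1 := by
    have e := cntLe_eq H x
    rw [if_pos hm] at e
    have : cntLt H x = 0 := by
      unfold cntLt
      rw [Finset.card_eq_zero, Finset.filter_eq_empty_iff]
      exact fun u hu hu' => absurd (hmin u hu) hu'.not_ge
    omega
  have oH' : ∀ v, x ≤ v → 1 ≤ cntLe H v := fun v hv => oH ▸ cntLe_mono H hv
  -- The vertices `y < x ≤ z` of the first two intervals. Dropping the cut point `x` merges these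
  -- intervals, so removing either `y` or `z` leaves a cover; the remaining one of the two lies
  -- after or before `x`.
  obtain ⟨y, hy, hy'⟩ := h.exists_mem (Nat.zero_le _)
  obtain ⟨z, hz, hz'⟩ := h.exists_mem (i := 1) hpos
  have hyx : y < x := lt_of_not_ge fun h' => by have := oH' y h'; omega
  have hxz : x ≤ z := le_of_not_gt fun h' => by have := zH z h'; omega
  have zf : cntLt f x = 1 := by
    have h₁ := h.2 x
    have h₂ := cntLt_mono f hxz
    rw [← h.cntLe_eq_cntLt hz] at h₂
    omega
  refine ⟨f.erase y, Finset.erase_subset _ _, f.erase z, Finset.erase_subset _ _,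
    ⟨?_, fun v => ?_⟩, ⟨?_, fun v => ?_⟩, ?_, ?_, ?_⟩
  · rw [Finset.card_erase_of_mem hy, cH, h.1]; omega
  · have h₁ := h.2 v
    rcases lt_or_ge v x with hv | hv
    · have := zH v hv
      have := er₂ (s := f) (y := y) (v := v)
      have := er₂ (s := H) (y := x) (v := v)
      omega
    · have := oH' v hv
      rw [er hm hv, er hy (hyx.le.trans hv), er' hy (hyx.trans_le hv)]
      omega
  · rw [Finset.card_erase_of_mem hz, cH, h.1]; omega
  · have h₁ := h.2 v
    rcases lt_or_ge v x with hv | hv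
    · have := zH v hv
      have := er₂ (s := f) (y := z) (v := v)
      have := er₂ (s := H) (y := x) (v := v)
      omega
    · have := oH' v hv
      have h₂ := er₅ (s := f) (y := z) (v := v)
      rw [er hm hv]
      rcases lt_or_ge v z with hz₁ | hz₁
      · rw [er₄ hz₁]
        have h₃ := cntLe_le_cntLt f hz₁
        rw [← h.cntLe_eq_cntLt hz] at h₃
        omega
      · rw [er hz hz₁]
        omega
  · rw [er hm le_rfl, oH]
  · rw [er' hy hyx, zf]
  · rw [er₃ hxz, zf]

end SimplexFace

/-! ### Composites of atoms -/

namespace FaceComplex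

namespace Table

variable {K : FaceComplex}

theorem comp_val_lt {n m : ℕ} (S T : K.Table) (h : m < n) (α : Bool) :
    (S.comp n T).val α m = S.val α m := by
  simp only [comp, if_pos h]

theorem comp_val_source {n : ℕ} (S T : K.Table) : (S.comp n T).val false n = S.val false n := by
  simp [comp]

theorem comp_val_target {n : ℕ} (S T : K.Table) : (S.comp n T).val true n = T.val true n := by
  simp [comp]

theorem comp_val_gt {n m : ℕ} (S T : K.Table) (h : n < m) (α : Bool) :
    (S.comp n T).val α m = S.val α m ∪ T.val α m := by
  simp only [comp, if_neg h.not_gt, if_neg h.ne']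

theorem d_val_lt {n m : ℕ} (T : K.Table) (h : m < n) (α β : Bool) :
    (T.d α n).val β m = T.val β m := by
  simp only [d, if_pos h]

theorem d_val_eq {n : ℕ} (T : K.Table) (α β : Bool) : (T.d α n).val β n = T.val α n := by
  simp [d]

theorem d_val_gt {n m : ℕ} (T : K.Table) (h : n < m) (α β : Bool) :
    (T.d α n).val β m = ∅ := by
  simp only [d, if_neg h.not_gt, if_neg h.ne']

/-- A face of a composite is a face of one of the factors. -/
theorem mem_comp {n : ℕ} {S T : K.Table} {α : Bool} {m : ℕ} {a : K.Face}
    (h : a ∈ (S.comp n T).val α m) : a ∈ S.val α m ∨ a ∈ T.val α m := by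
  rcases lt_trichotomy m n with hm | rfl | hm
  · rw [comp_val_lt _ _ hm] at h
    exact .inl h
  · cases α
    · rw [comp_val_source] at h
      exact .inl h
    · rw [comp_val_target] at h
      exact .inr h
  · rwa [comp_val_gt _ _ hm] at h

end Table

/-- The tables that are obtained from atoms by composition only. -/
inductive Composite (K : FaceComplex) : K.Table → Prop
  | atom (x : K.Face) : Composite K (K.atom x)
  | comp (n : ℕ) (S T : K.Table) (h : S.d true n = T.d false n) :
      Composite K S → Composite K T → Composite K (S.comp n T)

end FaceComplex

/-! ### Tables of simplices -/

namespace SimplexFace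

open FaceComplex

variable {n : ℕ}

theorem mem_atom_iff {x a : (simplexComplex n).Face} {α : Bool} {m : ℕ} :
    a ∈ ((simplexComplex n).atom x).val α m ↔ InBd α x.1 a.1 ∧ a.1.card = m + 1 := by
  rw [simplex_mem_atom]
  unfold InBd cntLt
  constructor
  · rintro ⟨h₁, h₂, h₃⟩
    refine ⟨⟨h₁, fun v hv hv' => ?_⟩, h₂⟩
    have := h₃ v hv hv'
    cases α <;> simpa [Nat.even_add_one] using this
  · rintro ⟨⟨h₁, h₃⟩, h₂⟩
    refine ⟨h₁, h₂, fun v hv hv' => ?_⟩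
    have := h₃ v hv hv'
    cases α <;> simpa [Nat.even_add_one] using this

theorem card_eq {T : (simplexComplex n).Table} {α : Bool} {m : ℕ} {a : (simplexComplex n).Face}
    (h : a ∈ T.val α m) : a.1.card = m + 1 := by
  have h₁ := T.dim_eq _ _ _ h
  change a.1.card - 1 = m at h₁
  have := a.2.card_pos
  omega

theorem dim_add_one (a : (simplexComplex n).Face) :
    (simplexComplex n).dim a + 1 = a.1.card := by
  change a.1.card - 1 + 1 = _
  have := a.2.card_pos
  omega

/-! ### Coherent tables -/

/-- The properties of the tables of cells that control which faces lie over a set of cut points. -/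
structure Coherent (T : (simplexComplex n).Table) : Prop where
  uniq : ∀ {α : Bool} {m : ℕ} {H : Finset (Fin (n + 1))} {e e' : (simplexComplex n).Face},
    e ∈ T.val α m → e' ∈ T.val α m → Cov e.1 H → Cov e'.1 H → e = e'
  between : ∀ (α : Bool) {β : Bool} {m : ℕ} {H : Finset (Fin (n + 1))}
    {a b : (simplexComplex n).Face}, b ∈ T.val β m → a.1 ⊆ b.1 → Cov a.1 H →
      ∃ e ∈ T.val α H.card, Cov e.1 H ∧ Below α H e.1 a.1

/-- A face of the source or target of a simplex is extremal among all its faces with the same cut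
points, so two of them are equal by antisymmetry; `exists_inBd` supplies one. -/
theorem coherent_atom (x : (simplexComplex n).Face) :
    Coherent ((simplexComplex n).atom x) where
  uniq {α m H e e'} he he' hc hc' := by
    rw [mem_atom_iff] at he he'
    exact Subtype.ext (Below.antisymm (he.2.trans he'.2.symm) (he.1.below hc he'.1.1 hc')
      (he'.1.below hc' he.1.1 hc))
  between α β m H a b hb hab hc := by
    rw [mem_atom_iff] at hb
    have hax := hab.trans hb.1.1
    obtain ⟨f, hf, hfH⟩ := exists_inBd α hax hc
    refine ⟨⟨f, ?_⟩, mem_atom_iff.2 ⟨hf, hfH.1⟩, hfH, hf.below hfH hax hc⟩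
    rw [← Finset.card_pos, hfH.1]
    omega

/-- The factors of a composite in degree `k` have no common faces in degrees above `k`, not even up
to covering the same cut points. -/
theorem Coherent.disjoint {k : ℕ} {S T : (simplexComplex n).Table} (hS : Coherent S)
    (hT : Coherent T) (h : S.d true k = T.d false k) {H : Finset (Fin (n + 1))}
    (hk : k < H.card) {α β : Bool} {m m' : ℕ} {a b a' b' : (simplexComplex n).Face}
    (hb : b ∈ S.val α m) (hab : a.1 ⊆ b.1) (hc : Cov a.1 H)
    (hb' : b' ∈ T.val β m') (hab' : a'.1 ⊆ b'.1) (hc' : Cov a'.1 H) : False := by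
  -- Dropping cut points reduces to `H.card = k + 1`, where one more drop lands in the common
  -- boundary of degree `k`.
  induction hj : H.card generalizing H a a' with
  | zero => omega
  | succ j ih =>
    have hH : H.Nonempty := by rw [← Finset.card_pos]; omega
    have ne : ∀ {s : Finset (Fin (n + 1))}, Cov s (H.erase (H.min' hH)) → s.Nonempty :=
      fun hs => by rw [← Finset.card_pos, hs.1]; omega
    have cj : (H.erase (H.min' hH)).card = j := by
      rw [Finset.card_erase_of_mem (Finset.min'_mem H hH)]; omega
    obtain ⟨a₁, ha₁, a₂, ha₂, c₁, c₂, z, z₁, z₂⟩ := hc.drop hH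
    obtain ⟨a₁', ha₁', a₂', ha₂', c₁', c₂', -, z₁', z₂'⟩ := hc'.drop hH
    by_cases hjk : k < j
    · exact ih (H := H.erase (H.min' hH)) (by omega) (a := ⟨a₁, ne c₁⟩) (ha₁.trans hab) c₁
        (a' := ⟨a₁', ne c₁'⟩) (ha₁'.trans hab') c₁' cj
    · obtain rfl : k = j := by omega
      -- The early choice in `S` pushes the face of the target of `S` to have its first vertex
      -- before the dropped cut point; the late choice in `T` forces the face of the source of `T`
      -- to have its first vertex at or after it. Both faces lie in the common boundary over the
      -- same cut points, so they are equal.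
      obtain ⟨e, he, hec, hel⟩ := hS.between true (a := ⟨a₂, ne c₂⟩) hb (ha₂.trans hab) c₂
      obtain ⟨e', he', hec', hel'⟩ :=
        hT.between false (a := ⟨a₁', ne c₁'⟩) hb' (ha₁'.trans hab') c₁'
      rw [cj, Table.eq_at h] at he
      rw [cj] at he'
      obtain rfl := hT.uniq he he' hec hec'
      have l₁ := (hel (H.min' hH)).2 (by rw [z]; decide)
      have l₂ := (hel' (H.min' hH)).1 (by rw [z]; decide)
      simp only at l₁ l₂
      omega

/-- Above degree `k`, uniqueness is the disjointness of the factors. In degree `k` itself, a face of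
the far factor is compared through the common boundary: an extremal face there lies again above an
extremal face of the near factor, and `Below` is transitive. -/
theorem Coherent.comp {k : ℕ} {S T : (simplexComplex n).Table} (hS : Coherent S)
    (hT : Coherent T) (h : S.d true k = T.d false k) : Coherent (S.comp k T) where
  uniq {α m H e e'} he he' hc hc' := by
    rcases lt_trichotomy m k with hm | rfl | hm
    · rw [Table.comp_val_lt _ _ hm] at he he'
      exact hS.uniq he he' hc hc'
    · cases α
      · rw [Table.comp_val_source] at he he'
        exact hS.uniq he he' hc hc'
      · rw [Table.comp_val_target] at he he'
        exact hT.uniq he he' hc hc'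
    · have hH : k < H.card := by
        have h₁ := hc.1
        have h₂ := card_eq he
        omega
      rw [Table.comp_val_gt _ _ hm] at he he'
      rcases he with he | he <;> rcases he' with he' | he'
      · exact hS.uniq he he' hc hc'
      · exact (hS.disjoint hT h hH he subset_rfl hc he' subset_rfl hc').elim
      · exact (hS.disjoint hT h hH he' subset_rfl hc' he subset_rfl hc).elim
      · exact hT.uniq he he' hc hc'
  between α β m H a b hb hab hc := by
    rcases lt_trichotomy H.card k with hH | hH | hH
    · rw [Table.comp_val_lt _ _ hH]
      rcases Table.mem_comp hb with hb | hb
      · exact hS.between α hb hab hc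
      · rw [Table.eq_of_lt h hH]
        exact hT.between α hb hab hc
    · subst hH
      cases α
      · rw [Table.comp_val_source]
        rcases Table.mem_comp hb with hb | hb
        · exact hS.between false hb hab hc
        · obtain ⟨e, he, hec, hel⟩ := hT.between false hb hab hc
          rw [← Table.eq_at h] at he
          obtain ⟨e', he', hec', hel'⟩ := hS.between false he subset_rfl hec
          exact ⟨e', he', hec', hel'.trans hel⟩
      · rw [Table.comp_val_target]
        rcases Table.mem_comp hb with hb | hb
        · obtain ⟨e, he, hec, hel⟩ := hS.between true hb hab hc
          rw [Table.eq_at h] at he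
          obtain ⟨e', he', hec', hel'⟩ := hT.between true he subset_rfl hec
          exact ⟨e', he', hec', hel'.trans hel⟩
        · exact hT.between true hb hab hc
    · rw [Table.comp_val_gt _ _ hH]
      rcases Table.mem_comp hb with hb | hb
      · obtain ⟨e, he, hec⟩ := hS.between α hb hab hc
        exact ⟨e, .inl he, hec⟩
      · obtain ⟨e, he, hec⟩ := hT.between α hb hab hc
        exact ⟨e, .inr he, hec⟩

theorem coherent {T : (simplexComplex n).Table} (hT : (simplexComplex n).Composite T) :
    Coherent T := by
  induction hT with
  | atom x => exact coherent_atom x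
  | comp k S T h _ _ hS hT => exact hS.comp hT h

/-! ### Maximal faces -/

/-- The maximal faces of a table: those that belong to the source and to the target. -/
def maxFaces (T : (simplexComplex n).Table) : Set (simplexComplex n).Face :=
  {a | ∀ α, a ∈ T.val α ((simplexComplex n).dim a)}

theorem mem_maxFaces {T : (simplexComplex n).Table} {a : (simplexComplex n).Face} {m : ℕ}
    (h : ∀ α, a ∈ T.val α m) : a ∈ maxFaces T := fun α => by
  rw [T.dim_eq _ _ _ (h true)]
  exact h α

/-- Statements about covered sets apply in this way to single faces, in the right degree. -/
theorem exists_cov (a : (simplexComplex n).Face) :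
    ∃ H, Cov a.1 H ∧ H.card = (simplexComplex n).dim a := by
  have h := cov_erase_min a.1 a.2
  refine ⟨_, h, ?_⟩
  have := h.1
  have := dim_add_one a
  omega

theorem Coherent.disjoint_faces {k : ℕ} {S T : (simplexComplex n).Table} (hS : Coherent S)
    (hT : Coherent T) (h : S.d true k = T.d false k) {α β : Bool} {m m' : ℕ}
    {a b b' : (simplexComplex n).Face} (hk : k < (simplexComplex n).dim a)
    (hb : b ∈ S.val α m) (hab : a.1 ⊆ b.1) (hb' : b' ∈ T.val β m') (hab' : a.1 ⊆ b'.1) :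
    False := by
  obtain ⟨H, hH, hH'⟩ := exists_cov a
  exact hS.disjoint hT h (hH' ▸ hk) hb hab hH hb' hab' hH

/-- A face that belongs to the source of the first factor and to the target of the second one is
a common face. -/
theorem Coherent.mem_middle {k : ℕ} {S T : (simplexComplex n).Table} (hS : Coherent S)
    (hT : Coherent T) (h : S.d true k = T.d false k) {a : (simplexComplex n).Face}
    (ha : a ∈ S.val false k) (ha' : a ∈ T.val true k) : a ∈ S.val true k := by
  obtain ⟨H, hH, hH'⟩ := exists_cov a
  have hk := S.dim_eq _ _ _ ha
  -- The faces of the target of `S` and of the source of `T` over the cut points of `a` coincide.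
  -- They bound `a` from opposite sides, so they are equal to `a`.
  obtain ⟨e, he, hec, hel⟩ := hS.between true ha subset_rfl hH
  obtain ⟨e', he', hec', hel'⟩ := hT.between false ha' subset_rfl hH
  rw [hH', hk] at he he'
  have he₁ := he
  rw [Table.eq_at h] at he
  obtain rfl := hT.uniq he he' hec hec'
  have : e.1 = a.1 := Below.antisymm (by rw [hec.1, hH.1]) hel' (below_not.1 hel)
  rwa [← Subtype.ext this]

/-- The maximal faces of a composite. -/
theorem Coherent.maxFaces_comp {k : ℕ} {S T : (simplexComplex n).Table} (hS : Coherent S)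
    (hT : Coherent T) (h : S.d true k = T.d false k) (a : (simplexComplex n).Face) :
    a ∈ maxFaces (S.comp k T) ↔ if k < (simplexComplex n).dim a then
      a ∈ maxFaces S ∨ a ∈ maxFaces T else a ∈ maxFaces S ∧ a ∈ maxFaces T := by
  split_ifs with hk
  · unfold maxFaces
    simp only [Set.mem_ofPred_eq, Table.comp_val_gt _ _ hk, Set.mem_union]
    constructor
    · intro h'
      rcases h' false with h₁ | h₁ <;> rcases h' true with h₂ | h₂
      · exact .inl (by rintro (_ | _) <;> assumption)
      · exact (hS.disjoint_faces hT h hk h₁ subset_rfl h₂ subset_rfl).elim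
      · exact (hS.disjoint_faces hT h hk h₂ subset_rfl h₁ subset_rfl).elim
      · exact .inr (by rintro (_ | _) <;> assumption)
    · rintro (h' | h') α
      · exact .inl (h' α)
      · exact .inr (h' α)
  · unfold maxFaces
    simp only [Set.mem_ofPred_eq]
    rcases (not_lt.1 hk).eq_or_lt with hk | hk
    · rw [hk]
      constructor
      · intro h'
        have h₁ := h' false
        have h₂ := h' true
        rw [Table.comp_val_source] at h₁
        rw [Table.comp_val_target] at h₂
        have h₃ := hS.mem_middle hT h h₁ h₂
        have h₄ := h₃
        rw [Table.eq_at h] at h₄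
        exact ⟨by rintro (_ | _) <;> assumption, by rintro (_ | _) <;> assumption⟩
      · rintro ⟨h₁, h₂⟩ (_ | _)
        · rw [Table.comp_val_source]; exact h₁ _
        · rw [Table.comp_val_target]; exact h₂ _
    · simp only [Table.comp_val_lt _ _ hk]
      refine ⟨fun h' => ⟨h', fun α => ?_⟩, fun h' => h'.1⟩
      rw [← Table.eq_of_lt h hk]
      exact h' α

/-- If a face of `x` omits a vertex `v` and lies in both source and target, then the number of its
vertices below `v` is both even and odd. -/
theorem maxFaces_atom (x : (simplexComplex n).Face) :
    maxFaces ((simplexComplex n).atom x) = {x} := by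
  ext a
  constructor
  · intro h
    have h₁ := (mem_atom_iff.1 (h false)).1
    have h₂ := (mem_atom_iff.1 (h true)).1
    refine Subtype.ext (subset_antisymm h₁.1 fun v hv => ?_)
    by_contra hva
    have h₃ := h₁.2 v hv hva
    have h₄ := h₂.2 v hv hva
    simp [Nat.even_add_one] at h₃ h₄
    exact Nat.not_even_iff_odd.2 h₄ h₃
  · rintro rfl α
    exact mem_atom_iff.2 ⟨⟨subset_rfl, fun v hv hv' => absurd hv hv'⟩, (dim_add_one a).symm⟩

/-- If a face of the source or target is contained in a face `b`, then it belongs to the source or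
target of `b`. -/
theorem inBd_of_subset {T : (simplexComplex n).Table} (hT : (simplexComplex n).Composite T)
    {α β : Bool} {j m : ℕ} {a b : (simplexComplex n).Face} (ha : a ∈ T.val α j)
    (hb : b ∈ T.val β m) (hab : a.1 ⊆ b.1) : InBd α b.1 a.1 := by
  induction hT generalizing α β j m a b with
  | atom x =>
    rw [mem_atom_iff] at ha hb
    exact ha.1.mono hb.1.1 hab
  | comp k S T h cS cT ihS ihT =>
    have hS := coherent cS
    have hT := coherent cT
    rcases lt_trichotomy j k with hj | rfl | hj
    · rw [Table.comp_val_lt _ _ hj] at ha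
      rcases Table.mem_comp hb with hb | hb
      · exact ihS ha hb hab
      · rw [Table.eq_of_lt h hj] at ha
        exact ihT ha hb hab
    · obtain ⟨H, hH, hH'⟩ := exists_cov a
      have hd := Table.dim_eq _ _ _ _ ha
      cases α
      · rw [Table.comp_val_source] at ha
        rcases Table.mem_comp hb with hb | hb
        · exact ihS ha hb hab
        -- Here `b` belongs to `T`, while `a` is only known to belong to the source of `S`. The face
        -- of the common boundary over the cut points of `a` bounds `a` from both sides, hence is
        -- `a`, which therefore also belongs to the source of `T`.
        · obtain ⟨e, he, hec, hel⟩ := hT.between false hb hab hH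
          obtain ⟨e', he', hec', hel'⟩ := hS.between true ha subset_rfl hH
          rw [hH', hd] at he he'
          rw [Table.eq_at h] at he'
          obtain rfl := hT.uniq he he' hec hec'
          have : e = a :=
            Subtype.ext (Below.antisymm (by rw [hec.1, hH.1]) hel (below_not.1 hel'))
          subst this
          exact ihT he hb hab
      · rw [Table.comp_val_target] at ha
        rcases Table.mem_comp hb with hb | hb
        · obtain ⟨e, he, hec, hel⟩ := hS.between true hb hab hH
          obtain ⟨e', he', hec', hel'⟩ := hT.between false ha subset_rfl hH
          rw [hH', hd] at he he'
          rw [← Table.eq_at h] at he'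
          obtain rfl := hS.uniq he he' hec hec'
          have : e = a :=
            Subtype.ext (Below.antisymm (by rw [hec.1, hH.1]) hel (below_not.1 hel'))
          subst this
          exact ihS he hb hab
        · exact ihT ha hb hab
    · have hd := Table.dim_eq _ _ _ _ ha
      rw [Table.comp_val_gt _ _ hj] at ha
      rcases ha with ha | ha <;> rcases Table.mem_comp hb with hb | hb
      · exact ihS ha hb hab
      · exact (hS.disjoint_faces hT h (hd.symm ▸ hj) ha subset_rfl hb hab).elim
      · exact (hS.disjoint_faces hT h (hd.symm ▸ hj) hb hab ha subset_rfl).elim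
      · exact ihT ha hb hab

theorem eq_of_subset_of_dim_le {b c : (simplexComplex n).Face} (h : b.1 ⊆ c.1)
    (hd : (simplexComplex n).dim c ≤ (simplexComplex n).dim b) : b = c :=
  Subtype.ext (Finset.eq_of_subset_of_card_le h (by rw [← dim_add_one, ← dim_add_one]; omega))

theorem dim_le_of_subset {b c : (simplexComplex n).Face} (h : b.1 ⊆ c.1) :
    (simplexComplex n).dim b ≤ (simplexComplex n).dim c :=
  (simplexComplex n).dim_le b c h

/-- Every face is contained in a maximal face. -/
theorem exists_maxFace {T : (simplexComplex n).Table} (hT : (simplexComplex n).Composite T)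
    {α : Bool} {j : ℕ} {a : (simplexComplex n).Face} (ha : a ∈ T.val α j) :
    ∃ b ∈ maxFaces T, a.1 ⊆ b.1 := by
  -- A maximal face of one factor extends to one of the composite.
  suffices H : ∀ (k : ℕ) (S T : (simplexComplex n).Table), S.d true k = T.d false k →
      Coherent S → Coherent T →
      (∀ {α j a}, a ∈ S.val α j → ∃ b ∈ maxFaces S, a.1 ⊆ b.1) →
      (∀ {α j a}, a ∈ T.val α j → ∃ b ∈ maxFaces T, a.1 ⊆ b.1) →
      ∀ b, b ∈ maxFaces S ∨ b ∈ maxFaces T → ∃ c ∈ maxFaces (S.comp k T), b.1 ⊆ c.1 by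
    induction hT generalizing α j a with
    | atom x => exact ⟨x, by rw [maxFaces_atom]; rfl, (mem_atom_iff.1 ha).1.1⟩
    | comp k S T h cS cT ihS ihT =>
      have ext := H k S T h (coherent cS) (coherent cT) ihS ihT
      rcases Table.mem_comp ha with ha | ha
      · obtain ⟨b, hb, hab⟩ := ihS ha
        obtain ⟨c, hc, hbc⟩ := ext b (.inl hb)
        exact ⟨c, hc, hab.trans hbc⟩
      · obtain ⟨b, hb, hab⟩ := ihT ha
        obtain ⟨c, hc, hbc⟩ := ext b (.inr hb)
        exact ⟨c, hc, hab.trans hbc⟩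
  intro k S T h hS hT ihS ihT b hb
  have mk := hS.maxFaces_comp hT h
  rcases lt_trichotomy ((simplexComplex n).dim b) k with hk | hk | hk
  · refine ⟨b, (mk b).2 ?_, subset_rfl⟩
    rw [if_neg hk.not_gt]
    rcases hb with hb | hb
    · refine ⟨hb, fun α => ?_⟩
      rw [← Table.eq_of_lt h hk]
      exact hb α
    · refine ⟨fun α => ?_, hb⟩
      rw [Table.eq_of_lt h hk]
      exact hb α
  -- A maximal face of one factor of dimension exactly `k` lies in the common boundary, where a
  -- larger face of the other factor may absorb it. A maximal face of the other factor above it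
  -- works in any case.
  · rcases hb with hb | hb
    · have h₁ := hb true
      rw [hk, Table.eq_at h] at h₁
      obtain ⟨c, hc, hbc⟩ := ihT h₁
      refine ⟨c, (mk c).2 ?_, hbc⟩
      split_ifs with hkc
      · exact .inr hc
      · obtain rfl := eq_of_subset_of_dim_le hbc (by omega)
        exact ⟨hb, hc⟩
    · have h₁ := hb false
      rw [hk, ← Table.eq_at h] at h₁
      obtain ⟨c, hc, hbc⟩ := ihS h₁
      refine ⟨c, (mk c).2 ?_, hbc⟩
      split_ifs with hkc
      · exact .inl hc
      · obtain rfl := eq_of_subset_of_dim_le hbc (by omega)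
        exact ⟨hc, hb⟩
  · exact ⟨b, (mk b).2 (by rw [if_pos hk]; exact hb), subset_rfl⟩

/-- Every maximal face of a factor is contained in a maximal face of the composite. -/
theorem exists_maxFace_comp {k : ℕ} {S T : (simplexComplex n).Table}
    (hS : (simplexComplex n).Composite S) (hT : (simplexComplex n).Composite T)
    (h : S.d true k = T.d false k) {b : (simplexComplex n).Face}
    (hb : b ∈ maxFaces S ∨ b ∈ maxFaces T) : ∃ c ∈ maxFaces (S.comp k T), b.1 ⊆ c.1 := by
  have hST := FaceComplex.Composite.comp k S T h hS hT
  rcases lt_trichotomy ((simplexComplex n).dim b) k with hk | hk | hk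
  · refine exists_maxFace hST (α := true) (j := (simplexComplex n).dim b) ?_
    rw [Table.comp_val_lt _ _ hk]
    rcases hb with hb | hb
    · exact hb true
    · rw [Table.eq_of_lt h hk]
      exact hb true
  · rcases hb with hb | hb
    · refine exists_maxFace hST (α := false) (j := k) ?_
      rw [Table.comp_val_source]
      exact hk ▸ hb false
    · refine exists_maxFace hST (α := true) (j := k) ?_
      rw [Table.comp_val_target]
      exact hk ▸ hb true
  · refine exists_maxFace hST (α := true) (j := (simplexComplex n).dim b) ?_
    rw [Table.comp_val_gt _ _ hk]
    exact hb.imp (fun h => h true) (fun h => h true)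

/-- A table of a cell is determined by its maximal faces. -/
theorem mem_val_iff {T : (simplexComplex n).Table} (hT : (simplexComplex n).Composite T)
    {α : Bool} {m : ℕ} {a : (simplexComplex n).Face} :
    a ∈ T.val α m ↔ (simplexComplex n).dim a = m ∧ (∃ b ∈ maxFaces T, a.1 ⊆ b.1) ∧
      ∀ b ∈ maxFaces T, a.1 ⊆ b.1 → InBd α b.1 a.1 := by
  refine ⟨fun ha => ⟨T.dim_eq _ _ _ ha, exists_maxFace hT ha,
    fun b hb hab => inBd_of_subset hT ha (hb true) hab⟩, ?_⟩
  rintro ⟨rfl, h₁, h₂⟩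
  induction hT with
  | atom x =>
    rw [maxFaces_atom] at h₁ h₂
    obtain ⟨b, rfl, hab⟩ := h₁
    exact mem_atom_iff.2 ⟨h₂ _ rfl hab, (dim_add_one a).symm⟩
  | comp k S T h cS cT ihS ihT =>
    -- A maximal face of the factor may cease to be maximal in the composite, but it stays contained
    -- in a maximal face, and the boundary condition passes to smaller simplices.
    have kS : (∃ b ∈ maxFaces S, a.1 ⊆ b.1) → a ∈ S.val α ((simplexComplex n).dim a) := fun h' =>
      ihS h' fun b hb hab => by
        obtain ⟨c, hc, hbc⟩ := exists_maxFace_comp cS cT h (.inl hb)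
        exact (h₂ c hc (hab.trans hbc)).mono hbc hab
    have kT : (∃ b ∈ maxFaces T, a.1 ⊆ b.1) → a ∈ T.val α ((simplexComplex n).dim a) := fun h' =>
      ihT h' fun b hb hab => by
        obtain ⟨c, hc, hbc⟩ := exists_maxFace_comp cS cT h (.inr hb)
        exact (h₂ c hc (hab.trans hbc)).mono hbc hab
    have hor : a ∈ S.val α ((simplexComplex n).dim a) ∨
        a ∈ T.val α ((simplexComplex n).dim a) := by
      obtain ⟨b, hb, hab⟩ := h₁
      rw [(coherent cS).maxFaces_comp (coherent cT) h] at hb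
      split_ifs at hb
      · exact hb.imp (fun hb => kS ⟨b, hb, hab⟩) (fun hb => kT ⟨b, hb, hab⟩)
      · exact .inl (kS ⟨b, hb.1, hab⟩)
    rcases lt_trichotomy ((simplexComplex n).dim a) k with hk | hk | hk
    · rw [Table.comp_val_lt _ _ hk]
      rcases hor with h' | h'
      · exact h'
      · rwa [Table.eq_of_lt h hk]
    · cases α
      · rw [hk, Table.comp_val_source, ← hk]
        rcases hor with h' | h'
        · exact h'
        · rw [hk, ← Table.eq_at h] at h'
          exact kS (exists_maxFace cS h')
      · rw [hk, Table.comp_val_target, ← hk]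
        rcases hor with h' | h'
        · rw [hk, Table.eq_at h] at h'
          exact kT (exists_maxFace cT h')
        · exact h'
    · rwa [Table.comp_val_gt _ _ hk]

/-- The maximal faces of dimension greater than `j`. -/
def maxAbove (T : (simplexComplex n).Table) (j : ℕ) : Set (simplexComplex n).Face :=
  {a | a ∈ maxFaces T ∧ j < (simplexComplex n).dim a}

/-- A table of a cell is determined by its source or target in degree `j`, and its maximal faces of
dimension greater than `j`. -/
theorem eq_of_maxAbove {S T : (simplexComplex n).Table} (hS : (simplexComplex n).Composite S)
    (hT : (simplexComplex n).Composite T) {γ : Bool} {j : ℕ} (h : S.d γ j = T.d γ j)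
    (h' : maxAbove S j = maxAbove T j) : S = T := by
  have main : ∀ {S T : (simplexComplex n).Table}, (simplexComplex n).Composite S →
      (simplexComplex n).Composite T → S.d γ j = T.d γ j → maxAbove S j = maxAbove T j →
      ∀ α m, S.val α m ⊆ T.val α m := by
    intro S T hS hT h h' α m a ha
    have tr : ∀ b, j < (simplexComplex n).dim b → (b ∈ maxFaces S ↔ b ∈ maxFaces T) := by
      intro b hb
      have : b ∈ maxAbove S j ↔ b ∈ maxAbove T j := by rw [h']
      exact ⟨fun hb' => (this.1 ⟨hb', hb⟩).1, fun hb' => (this.2 ⟨hb', hb⟩).1⟩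
    have vd : ∀ β m, (S.d γ j).val β m = (T.d γ j).val β m := fun β m => by rw [h]
    rcases lt_or_ge m j with hm | hm
    · have := vd α m
      rw [Table.d_val_lt _ hm, Table.d_val_lt _ hm] at this
      exact this ▸ ha
    · obtain ⟨hd, ⟨b, hb, hab⟩, h₂⟩ := (mem_val_iff hS).1 ha
      rcases lt_or_ge j ((simplexComplex n).dim b) with hj | hj
      · refine (mem_val_iff hT).2 ⟨hd, ⟨b, (tr b hj).1 hb, hab⟩, fun c hc hac => ?_⟩
        rcases lt_or_ge j ((simplexComplex n).dim c) with hjc | hjc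
        · exact h₂ c ((tr c hjc).2 hc) hac
        · obtain rfl := eq_of_subset_of_dim_le hac (by omega)
          exact ⟨subset_rfl, fun v hv hv' => absurd hv hv'⟩
      · obtain rfl := eq_of_subset_of_dim_le hab (by omega)
        have h₃ := dim_le_of_subset hab
        obtain rfl : m = j := by omega
        have e := vd γ m
        rw [Table.d_val_eq, Table.d_val_eq] at e
        have h₄ := hb γ
        rw [hd, e] at h₄
        obtain ⟨c, hc, hac⟩ := exists_maxFace hT h₄
        -- If `c` had dimension above `j`, it would also be a maximal face of `S`. Since `a` is
        -- maximal in `S`, it lies in both source and target of `S`, hence of `c`, and would be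
        -- equal to `c`.
        rcases lt_or_ge m ((simplexComplex n).dim c) with hjc | hjc
        · have hc' := (tr c hjc).2 hc
          have h₅ := inBd_of_subset hS (hb true) (hc' true) hac
          have h₆ := inBd_of_subset hS (hb false) (hc' true) hac
          have : a.1 = c.1 := subset_antisymm hac fun v hv => by
            by_contra hva
            have h₃ := h₅.2 v hv hva
            have h₄ := h₆.2 v hv hva
            simp [Nat.even_add_one] at h₃ h₄
            exact Nat.not_even_iff_odd.2 h₃ h₄
          obtain rfl := Subtype.ext this
          omega
        · obtain rfl := eq_of_subset_of_dim_le hac (by omega)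
          exact hd ▸ hc α
  ext α m : 3
  exact subset_antisymm (main hS hT h h' α m) (main hT hS h.symm h'.symm α m)

theorem maxAbove_comp {k j : ℕ} {S T : (simplexComplex n).Table}
    (hS : (simplexComplex n).Composite S) (hT : (simplexComplex n).Composite T)
    (h : S.d true k = T.d false k) (hk : k ≤ j) :
    maxAbove (S.comp k T) j = maxAbove S j ∪ maxAbove T j := by
  ext a
  simp only [maxAbove, Set.mem_ofPred_eq, Set.mem_union,
    (coherent hS).maxFaces_comp (coherent hT) h]
  constructor
  · rintro ⟨h₁, h₂⟩
    rw [if_pos (by omega)] at h₁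
    exact h₁.imp (fun h => ⟨h, h₂⟩) (fun h => ⟨h, h₂⟩)
  · intro h'
    have h₂ : j < (simplexComplex n).dim a := h'.elim And.right And.right
    rw [if_pos (by omega)]
    exact ⟨h'.imp And.left And.left, h₂⟩

theorem maxAbove_disjoint {k j : ℕ} {S T : (simplexComplex n).Table}
    (hS : (simplexComplex n).Composite S) (hT : (simplexComplex n).Composite T)
    (h : S.d true k = T.d false k) (hk : k ≤ j) : Disjoint (maxAbove S j) (maxAbove T j) :=
  Set.disjoint_left.2 fun _ ha ha' => (coherent hS).disjoint_faces (coherent hT) h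
    (hk.trans_lt ha.2) (ha.1 true) subset_rfl (ha'.1 true) subset_rfl

theorem maxAbove_atom (x : (simplexComplex n).Face) (j : ℕ) :
    maxAbove ((simplexComplex n).atom x) j ⊆ {x} := by
  intro a ha
  rw [← maxFaces_atom]
  exact ha.1

theorem maxAbove_anti (T : (simplexComplex n).Table) {i j : ℕ} (h : i ≤ j) :
    maxAbove T j ⊆ maxAbove T i :=
  fun _ ha => ⟨ha.1, h.trans_lt ha.2⟩

theorem maxAbove_d (T : (simplexComplex n).Table) (α : Bool) (j : ℕ) :
    maxAbove (T.d α j) j = ∅ :=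
  Set.eq_empty_of_forall_notMem fun a ha => by
    have := ha.1 true
    rwa [Table.d_val_gt _ ha.2] at this

/-! ### The order of the faces -/

/-- The key of a face for the alternating lexicographic order. -/
def key (a : (simplexComplex n).Face) : Lex (Fin (n + 1) → ℤ) :=
  toLex fun v => if v ∈ a.1 then (if Even (cntLt a.1 v) then 1 else -1) else 0

theorem key_injective : Function.Injective (key (n := n)) := by
  intro a b h
  refine Subtype.ext (Finset.ext fun v => ?_)
  have : key a v = key b v := by rw [h]
  change (if v ∈ a.1 then (if Even (cntLt a.1 v) then (1 : ℤ) else -1) else 0) =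
    if v ∈ b.1 then (if Even (cntLt b.1 v) then 1 else -1) else 0 at this
  by_cases h₁ : v ∈ a.1 <;> by_cases h₂ : v ∈ b.1 <;>
    simp only [h₁, h₂, if_true, if_false] at this ⊢ <;> split_ifs at this <;> simp_all

/-- At the first vertex `v` of `b` that is missing in `a` the keys differ for the first time,
because ranks below `v` agree. There `a` has entry `0`, and the entry of `b` is `1` or `-1` by the
same parity that decides between source and target. -/
theorem key_of_inBd {α : Bool} {a b : (simplexComplex n).Face} (h : InBd α b.1 a.1)
    (hne : a ≠ b) : if α = true then key b < key a else key a < key b := by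
  have hex : (b.1 \ a.1).Nonempty := by
    rw [Finset.sdiff_nonempty]
    exact fun h' => hne (Subtype.ext (subset_antisymm h.1 h'))
  have hm := Finset.mem_sdiff.1 (Finset.min'_mem _ hex)
  have hmin : ∀ u < (b.1 \ a.1).min' hex, u ∈ b.1 → u ∈ a.1 := fun u hu hub => by
    by_contra hua
    exact absurd (Finset.min'_le _ u (Finset.mem_sdiff.2 ⟨hub, hua⟩)) hu.not_ge
  generalize (b.1 \ a.1).min' hex = v at hm hmin
  have cnt : ∀ u ≤ v, cntLt a.1 u = cntLt b.1 u := fun u hu => by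
    unfold cntLt
    congr 1
    ext w
    simp only [Finset.mem_filter]
    exact ⟨fun hw => ⟨h.1 hw.1, hw.2⟩, fun hw => ⟨hmin w (hw.2.trans_le hu) hw.1, hw.2⟩⟩
  have low : ∀ u < v, key a u = key b u := fun u hu => by
    change (if u ∈ a.1 then (if Even (cntLt a.1 u) then (1 : ℤ) else -1) else 0) =
      if u ∈ b.1 then (if Even (cntLt b.1 u) then 1 else -1) else 0
    rw [cnt u hu.le]
    by_cases hub : u ∈ b.1
    · rw [if_pos hub, if_pos (hmin u hu hub)]
    · rw [if_neg hub, if_neg fun hua => hub (h.1 hua)]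
  have hp := h.2 v hm.1 hm.2
  have ka : key a v = 0 := if_neg hm.2
  have kb : key b v = if Even (cntLt a.1 v) then 1 else -1 := by
    rw [cnt v le_rfl]
    exact if_pos hm.1
  cases α
  · simp only [Bool.false_eq_true, if_false]
    refine ⟨v, low, ?_⟩
    simp [Nat.even_add_one] at hp
    rw [ka, kb, if_pos hp]
    norm_num
  · simp only [if_true]
    refine ⟨v, fun u hu => (low u hu).symm, ?_⟩
    simp at hp
    rw [ka, kb, if_neg (Nat.not_even_iff_odd.2 hp)]
    norm_num

/-- A face that belongs to only one of source and target is not maximal, so it is a proper boundary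
face of a maximal face of higher dimension, and `key_of_inBd` compares the two. -/
theorem exists_key_lt_of_mem {T : (simplexComplex n).Table}
    (hT : (simplexComplex n).Composite T) {α : Bool} {j : ℕ} {a : (simplexComplex n).Face}
    (ha : a ∈ T.val α j) (ha' : a ∉ T.val (!α) j) :
    ∃ b ∈ maxAbove T j, if α = true then key b < key a else key a < key b := by
  obtain ⟨b, hb, hab⟩ := exists_maxFace hT ha
  have hd := T.dim_eq _ _ _ ha
  rcases lt_or_ge j ((simplexComplex n).dim b) with hj | hj
  · refine ⟨b, ⟨hb, hj⟩, key_of_inBd (inBd_of_subset hT ha (hb true) hab) ?_⟩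
    rintro rfl
    omega
  · obtain rfl := eq_of_subset_of_dim_le hab (by omega)
    exact absurd (hd ▸ hb (!α)) ha'

/-- A cell with a maximal face of positive dimension has no maximal vertex. -/
theorem maxAbove_zero_eq_empty {T : (simplexComplex n).Table}
    (hT : (simplexComplex n).Composite T) {a : (simplexComplex n).Face}
    (ha : a ∈ maxFaces T) (hd : (simplexComplex n).dim a = 0) : maxAbove T 0 = ∅ := by
  refine Set.eq_empty_of_forall_notMem fun b hb => ?_
  have hc := coherent hT
  have cov : ∀ s : (simplexComplex n).Face, (simplexComplex n).dim s = 0 → Cov s.1 ∅ := by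
    intro s hs
    have := dim_add_one s
    rw [hs] at this
    refine ⟨by simp [← this], fun v => ⟨by simp [cntLe], ?_⟩⟩
    have := cntLe_le_card s.1 v
    simp only [cntLe, Finset.filter_empty, Finset.card_empty] at *
    omega
  -- Every vertex covers the empty set of cut points. It lies between the unique initial and the
  -- unique final vertex of the table, both of which are `a`.
  have all : ∀ v ∈ b.1, v ∈ a.1 := by
    intro v hv
    obtain ⟨e, he, hec, hel⟩ := hc.between false (a := ⟨{v}, Finset.singleton_nonempty v⟩)
      (hb.1 true) (Finset.singleton_subset_iff.2 hv) (cov _ rfl)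
    obtain ⟨e', he', hec', hel'⟩ := hc.between true (a := ⟨{v}, Finset.singleton_nonempty v⟩)
      (hb.1 true) (Finset.singleton_subset_iff.2 hv) (cov _ rfl)
    have hac := cov a hd
    have ha₁ := ha false
    have ha₂ := ha true
    rw [hd] at ha₁ ha₂
    obtain rfl := hc.uniq he ha₁ hec hac
    obtain rfl := hc.uniq he' ha₂ hec' hac
    have : e'.1 = {v} := Below.antisymm (by rw [hac.1]; rfl) hel (below_not.1 hel')
    rw [this]
    exact Finset.mem_singleton_self v
  have h₁ : (simplexComplex n).dim b ≤ (simplexComplex n).dim a := dim_le_of_subset all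
  have := hb.2
  omega

end SimplexFace

/-! ### Composition in omega-categories -/

namespace OmegaCat

variable {C : OmegaCat.{u}}

/-- The smallest set of cells that contains `S` and is closed under composition. -/
inductive CompGen (C : OmegaCat.{u}) (S : C.carrier → Prop) : C.carrier → Prop
  | of (x : C.carrier) : S x → CompGen C S x
  | comp (n : ℕ) (x y : C.carrier) (h : C.d true n x = C.d false n y) :
      CompGen C S x → CompGen C S y → CompGen C S (C.comp n x y h)

theorem exists_assoc {n : ℕ} {x y z : C.carrier} (h₁ : C.d true n x = C.d false n y)
    (h₂ : C.d true n y = C.d false n z) :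
    ∃ (h₃ : C.d true n (C.comp n x y h₁) = C.d false n z)
      (h₄ : C.d true n x = C.d false n (C.comp n y z h₂)),
      C.comp n (C.comp n x y h₁) z h₃ = C.comp n x (C.comp n y z h₂) h₄ := by
  have h₃ : C.d true n (C.comp n x y h₁) = C.d false n z := by rw [C.d_target, h₂]
  have h₄ : C.d true n x = C.d false n (C.comp n y z h₂) := by rw [C.d_source, h₁]
  exact ⟨h₃, h₄, C.assoc n x y z h₁ h₃ h₂ h₄⟩

/-- The inner conditions suffice: a boundary in one degree of a composite in the other degree is
computed factor by factor. -/
theorem exists_interchange {m n : ℕ} (hmn : m ≠ n) {x y z w : C.carrier}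
    (h₁ : C.d true n x = C.d false n y) (h₂ : C.d true n z = C.d false n w)
    (h₄ : C.d true m x = C.d false m z) (h₅ : C.d true m y = C.d false m w) :
    ∃ (h₃ : C.d true m (C.comp n x y h₁) = C.d false m (C.comp n z w h₂))
      (h₆ : C.d true n (C.comp m x z h₄) = C.d false n (C.comp m y w h₅)),
      C.comp m (C.comp n x y h₁) (C.comp n z w h₂) h₃ =
        C.comp n (C.comp m x z h₄) (C.comp m y w h₅) h₆ := by
  have h₃ : C.d true m (C.comp n x y h₁) = C.d false m (C.comp n z w h₂) := by
    obtain ⟨_, e₁⟩ := C.d_comp true m n x y h₁ hmn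
    obtain ⟨_, e₂⟩ := C.d_comp false m n z w h₂ hmn
    rw [e₁, e₂]
    exact C.comp_congr h₄ h₅ _ _
  have h₆ : C.d true n (C.comp m x z h₄) = C.d false n (C.comp m y w h₅) := by
    obtain ⟨_, e₁⟩ := C.d_comp true n m x z h₄ hmn.symm
    obtain ⟨_, e₂⟩ := C.d_comp false n m y w h₅ hmn.symm
    rw [e₁, e₂]
    exact C.comp_congr h₁ h₂ _ _
  exact ⟨h₃, h₆, C.interchange m n x y z w hmn h₁ h₂ h₃ h₄ h₅ h₆⟩

theorem comp_eq_left {n : ℕ} {x y : C.carrier} (h : C.d true n x = C.d false n y)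
    (hy : C.dim y ≤ n) : C.comp n x y h = x := by
  have e : y = C.d true n x := by rw [h, C.d_eq_self_of_dim_le hy]
  subst e
  exact C.comp_target _ _ _

theorem comp_eq_right {n : ℕ} {x y : C.carrier} (h : C.d true n x = C.d false n y)
    (hx : C.dim x ≤ n) : C.comp n x y h = y := by
  have e : x = C.d false n y := by rw [← h, C.d_eq_self_of_dim_le hx]
  subst e
  exact C.source_comp _ _ _

theorem dim_comp_le {n k : ℕ} {x y : C.carrier} (h : C.d true n x = C.d false n y) (hk : n < k)
    (hx : C.dim x ≤ k) (hy : C.dim y ≤ k) : C.dim (C.comp n x y h) ≤ k := by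
  refine C.dim_le_of_d_eq_self (α := true) ?_
  obtain ⟨_, e⟩ := C.d_comp true k n x y h hk.ne'
  rw [e]
  exact C.comp_congr (C.d_eq_self_of_dim_le hx _) (C.d_eq_self_of_dim_le hy _) _ _

theorem d_comp_of_lt {m n : ℕ} (hmn : m < n) {x y : C.carrier}
    (h : C.d true n x = C.d false n y) (α : Bool) :
    C.d α m (C.comp n x y h) = C.d α m x ∧ C.d α m (C.comp n x y h) = C.d α m y := by
  constructor
  · rw [← C.d_d_lt false α m n _ hmn, C.d_source, C.d_d_lt _ _ _ _ _ hmn]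
  · rw [← C.d_d_lt true α m n _ hmn, C.d_target, C.d_d_lt _ _ _ _ _ hmn]

end OmegaCat

/-! ### Omega-categories over a simplex that are generated by the faces -/

namespace SimplexFace

open FaceComplex OmegaCat

/-- An `ω`-category over the `ω`-category of tables of a simplex that is generated under composition
by one cell over each face. -/
structure AtomicOver (n : ℕ) where
  E : OmegaCat.{0}
  π : E ⟶ (simplexComplex n).tables
  g : (simplexComplex n).Face → E.carrier
  π_g : ∀ x, Hom.toFun π (g x) = (simplexComplex n).atom x
  dim_g : ∀ x, E.dim (g x) ≤ (simplexComplex n).dim x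
  gen : ∀ x, E.CompGen (fun y => ∃ a, y = g a) x

namespace AtomicOver

variable {n : ℕ} (X : AtomicOver n)

/-- The table of a cell. -/
def tab (x : X.E.carrier) : (simplexComplex n).Table := Hom.toFun X.π x

/-- The maximal faces of a cell of dimension greater than `j`. -/
def above (j : ℕ) (x : X.E.carrier) : Set (simplexComplex n).Face := maxAbove (X.tab x) j

theorem tab_d (α : Bool) (k : ℕ) (x : X.E.carrier) :
    X.tab (X.E.d α k x) = (X.tab x).d α k := X.π.map_d α k x

theorem tab_comp {k : ℕ} {x y : X.E.carrier} (h : X.E.d true k x = X.E.d false k y) :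
    X.tab (X.E.comp k x y h) = (X.tab x).comp k (X.tab y) := (X.π.map_comp k x y h).choose_spec

theorem tab_composable {k : ℕ} {x y : X.E.carrier} (h : X.E.d true k x = X.E.d false k y) :
    (X.tab x).d true k = (X.tab y).d false k := (X.π.map_comp k x y h).choose

theorem tab_g (a : (simplexComplex n).Face) : X.tab (X.g a) = (simplexComplex n).atom a := X.π_g a

theorem composite_tab (x : X.E.carrier) : (simplexComplex n).Composite (X.tab x) := by
  induction X.gen x with
  | of x h =>
    obtain ⟨a, rfl⟩ := h
    rw [tab_g]
    exact .atom a
  | comp k x y h _ _ hx hy =>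
    rw [tab_comp]
    exact .comp k _ _ (X.tab_composable h) hx hy

theorem above_comp {k j : ℕ} {x y : X.E.carrier} (h : X.E.d true k x = X.E.d false k y)
    (hk : k ≤ j) : X.above j (X.E.comp k x y h) = X.above j x ∪ X.above j y := by
  unfold above
  rw [tab_comp]
  exact maxAbove_comp (X.composite_tab x) (X.composite_tab y) (X.tab_composable h) hk

theorem above_disjoint {k j : ℕ} {x y : X.E.carrier} (h : X.E.d true k x = X.E.d false k y)
    (hk : k ≤ j) : Disjoint (X.above j x) (X.above j y) :=
  maxAbove_disjoint (X.composite_tab x) (X.composite_tab y) (X.tab_composable h) hk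

theorem above_anti {i j : ℕ} (h : i ≤ j) (x : X.E.carrier) : X.above j x ⊆ X.above i x :=
  maxAbove_anti _ h

theorem above_d (α : Bool) (j : ℕ) (x : X.E.carrier) : X.above j (X.E.d α j x) = ∅ := by
  unfold above
  rw [tab_d]
  exact maxAbove_d _ _ _

instance : Finite (simplexComplex n).Face :=
  inferInstanceAs (Finite {s : Finset (Fin (n + 1)) // s.Nonempty})

theorem ncard_comp {j : ℕ} {x y : X.E.carrier} (h : X.E.d true j x = X.E.d false j y) :
    (X.above j (X.E.comp j x y h)).ncard = (X.above j x).ncard + (X.above j y).ncard := by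
  rw [X.above_comp h le_rfl]
  exact Set.ncard_union_eq (X.above_disjoint h le_rfl)

/-! ### Nontrivial composites -/

/-- The cells that are obtained from the generators by nontrivial compositions. -/
inductive Tree : X.E.carrier → Prop
  | atom (a : (simplexComplex n).Face) : Tree (X.g a)
  | comp (k : ℕ) (x y : X.E.carrier) (h : X.E.d true k x = X.E.d false k y) : Tree x → Tree y →
      (X.above k x).Nonempty → (X.above k y).Nonempty → Tree (X.E.comp k x y h)

-- A nontrivial composite in degree `k` has faces of dimension above `k`. So if there are none above
-- `j`, then `k < j`, and composing in degree `k` keeps the dimension at most `j`. The table thus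
-- bounds the dimension of the cell itself.
variable {X} in
theorem Tree.dim_le {x : X.E.carrier} (hx : X.Tree x) {j : ℕ} (h : X.above j x = ∅) :
    X.E.dim x ≤ j := by
  induction hx with
  | atom a =>
    refine (X.dim_g a).trans (le_of_not_gt fun hj => ?_)
    have : a ∈ X.above j (X.g a) := by
      unfold above maxAbove
      rw [tab_g, maxFaces_atom]
      exact ⟨rfl, hj⟩
    rw [h] at this
    exact this
  | comp k x y hxy _ _ hx' hy' ihx ihy =>
    have hk : k < j := lt_of_not_ge fun hk => by
      obtain ⟨a, ha⟩ := hx'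
      have h' := X.above_anti hk (X.E.comp k x y hxy)
      rw [h, X.above_comp hxy le_rfl] at h'
      exact h' (Set.mem_union_left _ ha)
    rw [X.above_comp hxy hk.le, Set.union_empty_iff] at h
    exact dim_comp_le hxy hk (ihx h.1) (ihy h.2)

/-- A factor without maximal faces above `k` has dimension at most `k`, so it is an identity for the
composition in degree `k` and can be dropped. -/
theorem tree (x : X.E.carrier) : X.Tree x := by
  induction X.gen x with
  | of x h =>
    obtain ⟨a, rfl⟩ := h
    exact .atom a
  | comp k x y h _ _ hx hy =>
    rcases (X.above k x).eq_empty_or_nonempty with h₁ | h₁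
    · rwa [comp_eq_right h (hx.dim_le h₁)]
    · rcases (X.above k y).eq_empty_or_nonempty with h₂ | h₂
      · rwa [comp_eq_left h (hy.dim_le h₂)]
      · exact .comp k x y h hx hy h₁ h₂

theorem dim_le {x : X.E.carrier} {j : ℕ} (h : X.above j x = ∅) : X.E.dim x ≤ j :=
  (X.tree x).dim_le h

/-! ### Cutting cells along the order of the faces -/

/-- A decomposition of a cell that separates the maximal faces according to their keys. -/
def IsCut (j : ℕ) (c : Lex (Fin (n + 1) → ℤ)) (x y z : X.E.carrier) : Prop :=
  ∃ h, x = X.E.comp j y z h ∧ (∀ a ∈ X.above j y, key a ≤ c) ∧ ∀ a ∈ X.above j z, c < key a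

theorem exists_isCut_of_le {j : ℕ} {c : Lex (Fin (n + 1) → ℤ)} {x : X.E.carrier}
    (h : ∀ a ∈ X.above j x, key a ≤ c) : ∃ y z, X.IsCut j c x y z :=
  ⟨x, X.E.d true j x, (X.E.d_d_ge _ _ _ _ _ le_rfl).symm, (X.E.comp_target _ _ _).symm, h, by
    rw [above_d]
    exact fun _ h => h.elim⟩

theorem exists_isCut_of_lt {j : ℕ} {c : Lex (Fin (n + 1) → ℤ)} {x : X.E.carrier}
    (h : ∀ a ∈ X.above j x, c < key a) : ∃ y z, X.IsCut j c x y z :=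
  ⟨X.E.d false j x, x, X.E.d_d_ge _ _ _ _ _ le_rfl, (X.E.source_comp _ _ _).symm, by
    rw [above_d]
    exact fun _ h => h.elim, h⟩

variable {X} in
/-- The factors of a cut are determined by the table of the cell. -/
theorem IsCut.tab_eq {j : ℕ} {c : Lex (Fin (n + 1) → ℤ)} {x y z x' y' z' : X.E.carrier}
    (h : X.IsCut j c x y z) (h' : X.IsCut j c x' y' z') (hx : X.tab x = X.tab x') :
    X.tab y = X.tab y' ∧ X.tab z = X.tab z' := by
  obtain ⟨k, e, h₁, h₂⟩ := h
  obtain ⟨k', e', h₁', h₂'⟩ := h'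
  have a : X.above j y ∪ X.above j z = X.above j y' ∪ X.above j z' := by
    rw [← X.above_comp k le_rfl, ← X.above_comp k' le_rfl, ← e, ← e']
    unfold above
    rw [hx]
  -- Both cuts distribute the same set of faces, and membership in the first or second factor is
  -- decided by comparing the key with `c`.
  have sep : ∀ a, (a ∈ X.above j y ↔ a ∈ X.above j y') ∧ (a ∈ X.above j z ↔ a ∈ X.above j z') := by
    intro b
    have hb : b ∈ X.above j y ∪ X.above j z ↔ b ∈ X.above j y' ∪ X.above j z' := by rw [a]
    rw [Set.mem_union, Set.mem_union] at hb
    have n₁ : b ∈ X.above j y → b ∉ X.above j z' := fun h h' => (h₁ b h).not_gt (h₂' b h')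
    have n₂ : b ∈ X.above j y' → b ∉ X.above j z := fun h h' => (h₁' b h).not_gt (h₂ b h')
    tauto
  constructor
  · refine eq_of_maxAbove (X.composite_tab y) (X.composite_tab y') (γ := false) (j := j) ?_
      (Set.ext fun a => (sep a).1)
    rw [← tab_d, ← tab_d, ← X.E.d_source j y z k, ← X.E.d_source j y' z' k', ← e, ← e', tab_d,
      tab_d, hx]
  · refine eq_of_maxAbove (X.composite_tab z) (X.composite_tab z') (γ := true) (j := j) ?_
      (Set.ext fun a => (sep a).2)
    rw [← tab_d, ← tab_d, ← X.E.d_target j y z k, ← X.E.d_target j y' z' k', ← e, ← e', tab_d,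
      tab_d, hx]

/-- Cells with at most one maximal face of dimension greater than `j` are determined by their
tables. -/
def InjAt (j : ℕ) : Prop :=
  ∀ x y, X.tab x = X.tab y → (X.above j x).Subsingleton → x = y

/-- Cells with at most one maximal face of dimension greater than `j + 1` can be cut in
degree `j`. -/
def SplitAt (j : ℕ) : Prop :=
  ∀ x c, (X.above (j + 1) x).Subsingleton → ∃ y z, X.IsCut j c x y z

/-- The factors of a nontrivial composite contribute different faces of positive dimension, so a
cell with at most one such face is a generator, which its maximal face identifies. -/
theorem injAt_zero : X.InjAt 0 := by
  have atom : ∀ x, X.Tree x → (X.above 0 x).Subsingleton → ∃ a, x = X.g a := by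
    intro x hx h
    cases hx with
    | atom a => exact ⟨a, rfl⟩
    | comp k x y hxy _ _ h₁ h₂ =>
      obtain ⟨a, ha⟩ := h₁
      obtain ⟨b, hb⟩ := h₂
      have h' := X.above_anti (Nat.zero_le k) (X.E.comp k x y hxy)
      rw [X.above_comp hxy le_rfl] at h'
      have hab := h (h' (.inl ha)) (h' (.inr hb))
      exact (Set.disjoint_left.1 (X.above_disjoint hxy le_rfl) ha (hab ▸ hb)).elim
  intro x y hxy h
  obtain ⟨a, rfl⟩ := atom x (X.tree x) h
  obtain ⟨b, rfl⟩ := atom y (X.tree y) (by unfold above at h ⊢; rwa [← hxy])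
  rw [tab_g, tab_g] at hxy
  have := congrArg maxFaces hxy
  rw [maxFaces_atom, maxFaces_atom] at this
  rw [Set.singleton_injective this]

/-- Cutting both cells at the same key yields pairs of pieces with equal tables and fewer maximal
faces above `j`. The recursion stops at cells with at most one such face, where `InjAt j` applies.
-/
theorem injAt_succ {j : ℕ} (hI : X.InjAt j) (hS : X.SplitAt j) : X.InjAt (j + 1) := by
  intro x y hxy h
  induction hN : (X.above j x).ncard using Nat.strong_induction_on generalizing x y with
  | _ N ih =>
    by_cases hs : (X.above j x).Subsingleton
    · exact hI x y hxy hs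
    · rw [Set.not_subsingleton_iff] at hs
      obtain ⟨a, ha, b, hb, hab⟩ := hs
      wlog hlt : key a < key b generalizing a b
      · exact this b hb a ha hab.symm (lt_of_le_of_ne (not_lt.1 hlt)
          fun e => hab (key_injective e).symm)
      -- Cutting at the smaller of two keys puts `a` into the first piece and `b` into the second,
      -- so both pieces have fewer faces than `x`.
      obtain ⟨x₁, x₂, hx⟩ := hS x (key a) h
      obtain ⟨y₁, y₂, hy⟩ := hS y (key a) (by unfold above at h ⊢; rwa [← hxy])
      obtain ⟨e₁, e₂⟩ := hx.tab_eq hy hxy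
      obtain ⟨k, rfl, h₁, h₂⟩ := hx
      obtain ⟨k', rfl, h₁', h₂'⟩ := hy
      have hc := X.ncard_comp k
      rw [X.above_comp k le_rfl] at ha hb
      rw [X.above_comp k (Nat.le_succ j)] at h
      have p₁ : 0 < (X.above j x₁).ncard := (Set.ncard_pos).2
        ⟨a, ha.resolve_right fun h => (h₂ a h).ne rfl⟩
      have p₂ : 0 < (X.above j x₂).ncard := (Set.ncard_pos).2
        ⟨b, hb.resolve_left fun h => (h₁ b h).not_gt hlt⟩
      exact X.E.comp_congr (ih _ (by omega) x₁ y₁ e₁ (h.anti Set.subset_union_left) rfl)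
        (ih _ (by omega) x₂ y₂ e₂ (h.anti Set.subset_union_right) rfl) _ _

/-- Two cells with one high-dimensional maximal face each, in the wrong order, can be
interchanged. -/
theorem exists_isCut_of_subsingleton {j : ℕ} (hI : X.InjAt j)
    (hS : ∀ i, j = i + 1 → X.SplitAt i) {c : Lex (Fin (n + 1) → ℤ)} {u v : X.E.carrier}
    (h : X.E.d true j u = X.E.d false j v) (hu : (X.above j u).Subsingleton)
    (hv : (X.above j v).Subsingleton) (hu' : (X.above j u).Nonempty)
    (hv' : (X.above j v).Nonempty) (cu : ∀ a ∈ X.above j u, c < key a)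
    (cv : ∀ a ∈ X.above j v, key a ≤ c) : ∃ y z, X.IsCut j c (X.E.comp j u v h) y z := by
  -- Faces of the common boundary that come from the one or the other high-dimensional face.
  have ku : ∀ {w : X.E.carrier} {a}, (∀ b ∈ X.above j w, c < key b) →
      a ∈ (X.tab w).val true j → a ∉ (X.tab w).val false j → c < key a := by
    intro w a hw h₁ h₂
    obtain ⟨b, hb, hlt⟩ := exists_key_lt_of_mem (X.composite_tab w) h₁ h₂
    exact (hw b hb).trans hlt
  have kv : ∀ {w : X.E.carrier} {a}, (∀ b ∈ X.above j w, key b ≤ c) →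
      a ∈ (X.tab w).val false j → a ∉ (X.tab w).val true j → key a ≤ c := by
    intro w a hw h₁ h₂
    obtain ⟨b, hb, hlt⟩ := exists_key_lt_of_mem (X.composite_tab w) h₁ h₂
    exact (lt_of_lt_of_le hlt (hw b hb)).le
  -- In degree `0` the wrong order cannot occur. The vertex where `u` ends and `v` starts is maximal
  -- in neither cell, so its key would exceed that of a face of `u`, hence `c`, and be less than
  -- that of a face of `v`, hence at most `c`.
  rcases j with _ | i
  · exfalso
    obtain ⟨b, hb⟩ := hu'
    obtain ⟨w, hw⟩ := b.2
    have cov : Cov ({w} : Finset (Fin (n + 1))) ∅ := by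
      refine ⟨rfl, fun v => ⟨by simp [cntLe], ?_⟩⟩
      have := cntLe_le_card ({w} : Finset (Fin (n + 1))) v
      rw [Finset.card_singleton] at this
      omega
    obtain ⟨e, he, -, -⟩ := (coherent (X.composite_tab u)).between true
      (a := ⟨{w}, Finset.singleton_nonempty w⟩) (hb.1 true) (Finset.singleton_subset_iff.2 hw) cov
    rw [Finset.card_empty] at he
    have he' := he
    rw [Table.eq_at (X.tab_composable h)] at he'
    have no : ∀ {w : X.E.carrier}, (X.above 0 w).Nonempty → e ∈ (X.tab w).val true 0 →
        e ∉ (X.tab w).val false 0 := by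
      intro w hw h₁ h₂
      have := maxAbove_zero_eq_empty (X.composite_tab w) (a := e)
        (mem_maxFaces (by rintro (_ | _) <;> assumption)) (Table.dim_eq _ _ _ _ h₁)
      exact hw.ne_empty this
    exact (ku cu he (no ⟨b, hb⟩ he)).not_ge (kv cv he' fun h₁ => no hv' h₁ he')
  · have hSi := hS i rfl
    obtain ⟨w, u₂, k, rfl, h₁, h₂⟩ := hSi u c hu
    obtain ⟨v₁, w', k', rfl, h₁', h₂'⟩ := hSi v c hv
    -- All faces of `u` above `i + 1` have key greater than `c`, so they fall into `u₂`. Thus `w`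
    -- has dimension at most `i + 1`, and likewise `w'`: both are only whiskers.
    have hw : X.above (i + 1) w = ∅ := Set.eq_empty_of_forall_notMem fun a ha =>
      (h₁ a (X.above_anti (Nat.le_succ i) _ ha)).not_gt
        (cu a (by rw [X.above_comp k (Nat.le_succ i)]; exact .inl ha))
    have hw' : X.above (i + 1) w' = ∅ := Set.eq_empty_of_forall_notMem fun a ha =>
      (h₂' a (X.above_anti (Nat.le_succ i) _ ha)).not_ge
        (cv a (by rw [X.above_comp k' (Nat.le_succ i)]; exact .inr ha))
    rw [X.above_comp k (Nat.le_succ i), hw, Set.empty_union] at cu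
    rw [X.above_comp k' (Nat.le_succ i), hw', Set.union_empty] at cv
    have dw := fun α => X.E.d_eq_self_of_dim_le (X.dim_le hw) α
    have dw' := fun α => X.E.d_eq_self_of_dim_le (X.dim_le hw') α
    obtain ⟨l, e⟩ := X.E.d_comp true (i + 1) i w u₂ k (by omega)
    obtain ⟨l', e'⟩ := X.E.d_comp false (i + 1) i v₁ w' k' (by omega)
    -- The target of the cut of `u` is again a cut at `c`. A face of dimension `i + 1` in the target
    -- of `u₂` either also lies in its source, and is then a maximal face of `u₂`, or comes after a
    -- higher face in the order. The source of the cut of `v` behaves dually, so the common boundary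
    -- is cut twice at `c`, and the pieces agree.
    have cut : X.IsCut i c (X.E.d true (i + 1) (X.E.comp i w u₂ k)) (X.E.d true (i + 1) w)
        (X.E.d true (i + 1) u₂) := by
      refine ⟨l, e, by rwa [dw], fun a ha => ?_⟩
      have hd : a ∈ (X.tab u₂).val true (i + 1) := by
        have h₃ := ha.1 true
        rw [tab_d] at h₃
        rcases (Nat.succ_le_of_lt ha.2).eq_or_lt with h₄ | h₄
        · rw [← h₄] at h₃
          rwa [Table.d_val_eq] at h₃
        · rw [Table.d_val_gt _ h₄] at h₃
          exact h₃.elim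
      by_cases hd' : a ∈ (X.tab u₂).val false (i + 1)
      · refine h₂ a ⟨mem_maxFaces (by rintro (_ | _) <;> assumption), ?_⟩
        rw [Table.dim_eq _ _ _ _ hd]
        exact Nat.lt_succ_self i
      · exact ku cu hd hd'
    have cut' : X.IsCut i c (X.E.d false (i + 1) (X.E.comp i v₁ w' k')) (X.E.d false (i + 1) v₁)
        (X.E.d false (i + 1) w') := by
      refine ⟨l', e', fun a ha => ?_, by rwa [dw']⟩
      have hd : a ∈ (X.tab v₁).val false (i + 1) := by
        have h₃ := ha.1 true
        rw [tab_d] at h₃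
        rcases (Nat.succ_le_of_lt ha.2).eq_or_lt with h₄ | h₄
        · rw [← h₄] at h₃
          rwa [Table.d_val_eq] at h₃
        · rw [Table.d_val_gt _ h₄] at h₃
          exact h₃.elim
      by_cases hd' : a ∈ (X.tab v₁).val true (i + 1)
      · refine h₁' a ⟨mem_maxFaces (by rintro (_ | _) <;> assumption), ?_⟩
        rw [Table.dim_eq _ _ _ _ hd]
        exact Nat.lt_succ_self i
      · exact kv cv hd hd'
    obtain ⟨e₁, e₂⟩ := cut.tab_eq cut' (by rw [h])
    have g₁ : X.E.d true (i + 1) w = X.E.d false (i + 1) v₁ :=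
      hI _ _ e₁ (by rw [above_d]; exact Set.subsingleton_empty)
    have g₂ : X.E.d true (i + 1) u₂ = X.E.d false (i + 1) w' :=
      hI _ _ e₂ (by rw [above_d]; exact Set.subsingleton_empty)
    -- Both sides are the composite of `v₁` and `u₂` in degree `i`.
    obtain ⟨p₁, p₂, e₃⟩ := exists_interchange (C := X.E) (m := i + 1) (n := i) (by omega) k k' g₁ g₂
    have t₁ : X.E.d true (i + 1) v₁ = X.E.d false (i + 1) (X.E.d true (i + 1) v₁) :=
      (X.E.d_d_ge _ _ _ _ _ le_rfl).symm
    have t₂ : X.E.d true (i + 1) (X.E.d false (i + 1) u₂) = X.E.d false (i + 1) u₂ :=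
      X.E.d_d_ge _ _ _ _ _ le_rfl
    have f₁ : X.E.comp (i + 1) w v₁ g₁ = v₁ := comp_eq_right _ (X.dim_le hw)
    have f₂ : X.E.comp (i + 1) u₂ w' g₂ = u₂ := comp_eq_left _ (X.dim_le hw')
    have q : X.E.d true i v₁ = X.E.d false i u₂ := by
      have := p₂
      rwa [f₁, f₂] at this
    have k₁ : X.E.d true i v₁ = X.E.d false i (X.E.d false (i + 1) u₂) := by
      rw [X.E.d_d_lt _ _ _ _ _ (Nat.lt_succ_self i), q]
    have k₂ : X.E.d true i (X.E.d true (i + 1) v₁) = X.E.d false i u₂ := by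
      rw [X.E.d_d_lt _ _ _ _ _ (Nat.lt_succ_self i), q]
    obtain ⟨p₃, p₄, e₄⟩ := exists_interchange (C := X.E) (m := i + 1) (n := i) (by omega) k₁ k₂ t₁ t₂
    have f₃ : X.E.comp (i + 1) v₁ (X.E.d true (i + 1) v₁) t₁ = v₁ := X.E.comp_target _ _ _
    have f₄ : X.E.comp (i + 1) (X.E.d false (i + 1) u₂) u₂ t₂ = u₂ := X.E.source_comp _ _ _
    refine ⟨_, _, p₃, (e₃.trans ((X.E.comp_congr (f₁.trans f₃.symm) (f₂.trans f₄.symm) _ _).trans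
      e₄.symm)), ?_, ?_⟩
    · rw [X.above_comp k₁ (Nat.le_succ i), above_d, Set.union_empty]
      exact cv
    · rw [X.above_comp k₂ (Nat.le_succ i), above_d, Set.empty_union]
      exact cu

variable {X} in
theorem IsCut.comp_left {j : ℕ} {c : Lex (Fin (n + 1) → ℤ)} {x y z w : X.E.carrier}
    (hx : X.IsCut j c x y z) (h : X.E.d true j w = X.E.d false j x)
    (hw : ∀ a ∈ X.above j w, key a ≤ c) : ∃ y', X.IsCut j c (X.E.comp j w x h) y' z := by
  obtain ⟨k, rfl, h₁, h₂⟩ := hx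
  have h' : X.E.d true j w = X.E.d false j y := by rw [h, X.E.d_source]
  obtain ⟨k₁, k₂, e⟩ := exists_assoc h' k
  refine ⟨_, k₁, e.symm, fun a ha => ?_, h₂⟩
  rw [X.above_comp h' le_rfl] at ha
  exact ha.elim (hw a) (h₁ a)

variable {X} in
theorem IsCut.comp_right {j : ℕ} {c : Lex (Fin (n + 1) → ℤ)} {x y z w : X.E.carrier}
    (hx : X.IsCut j c x y z) (h : X.E.d true j x = X.E.d false j w)
    (hw : ∀ a ∈ X.above j w, c < key a) : ∃ z', X.IsCut j c (X.E.comp j x w h) y z' := by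
  obtain ⟨k, rfl, h₁, h₂⟩ := hx
  have h' : X.E.d true j z = X.E.d false j w := by rw [← h, X.E.d_target]
  obtain ⟨k₁, k₂, e⟩ := exists_assoc k h'
  refine ⟨_, k₂, e, h₁, fun a ha => ?_⟩
  rw [X.above_comp h' le_rfl] at ha
  exact ha.elim (h₂ a) (hw a)

/-- Two cells in the wrong order can be interchanged. -/
theorem exists_isCut_comp {j : ℕ} (hI : X.InjAt j) (hS : ∀ i, j = i + 1 → X.SplitAt i) {N : ℕ}
    (ih : ∀ x c, (X.above j x).ncard < N → (X.above (j + 1) x).Subsingleton →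
      ∃ y z, X.IsCut j c x y z) {c : Lex (Fin (n + 1) → ℤ)} {u v : X.E.carrier}
    (h : X.E.d true j u = X.E.d false j v) (hN : (X.above j (X.E.comp j u v h)).ncard ≤ N)
    (hs : (X.above (j + 1) (X.E.comp j u v h)).Subsingleton)
    (cu : ∀ a ∈ X.above j u, c < key a) (cv : ∀ a ∈ X.above j v, key a ≤ c) :
    ∃ y z, X.IsCut j c (X.E.comp j u v h) y z := by
  rcases (X.above j u).eq_empty_or_nonempty with hu' | hu'
  · refine X.exists_isCut_of_le ?_
    rwa [X.above_comp h le_rfl, hu', Set.empty_union]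
  rcases (X.above j v).eq_empty_or_nonempty with hv' | hv'
  · refine X.exists_isCut_of_lt ?_
    rwa [X.above_comp h le_rfl, hv', Set.union_empty]
  have pu := (Set.ncard_pos).2 hu'
  have pv := (Set.ncard_pos).2 hv'
  rw [X.ncard_comp h] at hN
  rw [X.above_comp h (Nat.le_succ j)] at hs
  have su := hs.anti Set.subset_union_left
  have sv := hs.anti Set.subset_union_right
  -- A cell with several maximal faces can be cut into two nontrivial pieces.
  have nontriv : ∀ w, (X.above j w).ncard < N → (X.above (j + 1) w).Subsingleton →
      ¬ (X.above j w).Subsingleton → ∃ y z, ∃ k : X.E.d true j y = X.E.d false j z,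
        w = X.E.comp j y z k ∧ 0 < (X.above j y).ncard ∧ 0 < (X.above j z).ncard := by
    intro w hw hw' hw''
    rw [Set.not_subsingleton_iff] at hw''
    obtain ⟨a, ha, b, hb, hab⟩ := hw''
    wlog hlt : key a < key b generalizing a b
    · exact this b hb a ha hab.symm (lt_of_le_of_ne (not_lt.1 hlt)
        fun e => hab (key_injective e).symm)
    obtain ⟨y, z, k, rfl, h₁, h₂⟩ := ih w (key a) hw hw'
    rw [X.above_comp k le_rfl] at ha hb
    exact ⟨y, z, k, rfl, (Set.ncard_pos).2 ⟨a, ha.resolve_right fun h => (h₂ a h).ne rfl⟩,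
      (Set.ncard_pos).2 ⟨b, hb.resolve_left fun h => (h₁ b h).not_gt hlt⟩⟩
  by_cases hu : (X.above j u).Subsingleton
  · by_cases hv : (X.above j v).Subsingleton
    · exact X.exists_isCut_of_subsingleton hI hS h hu hv hu' hv' cu cv
    -- With `v = p * q`, the shorter composite `u * p` is recut as `y * z`, and then `z * q` is
    -- recut; the part up to `c` of the latter is absorbed by `y`.
    · obtain ⟨p, q, k, rfl, hp, hq⟩ := nontriv v (by omega) sv hv
      have hc := X.ncard_comp k
      rw [X.above_comp k le_rfl] at cv
      rw [X.above_comp k (Nat.le_succ j), ← Set.union_assoc] at hs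
      have k₀ : X.E.d true j u = X.E.d false j p := by rw [h, X.E.d_source]
      obtain ⟨k₁, k₂, e⟩ := exists_assoc k₀ k
      obtain ⟨y, z, hyz⟩ := ih (X.E.comp j u p k₀) c (by rw [X.ncard_comp]; omega)
        (by rw [X.above_comp k₀ (Nat.le_succ j)]; exact hs.anti Set.subset_union_left)
      obtain ⟨l, e', h₁, h₂⟩ := hyz
      -- Since the faces of `p` have keys at most `c`, only faces of `u` remain in `z`. As `p`
      -- contributes at least one face, `z * q` has fewer faces than `u * v`, which permits the
      -- second use of `ih`.
      have cz : X.above j z ⊆ X.above j u := fun a ha => by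
        have := X.above_comp k₀ le_rfl
        rw [e', X.above_comp l le_rfl] at this
        have h₃ : a ∈ X.above j u ∪ X.above j p := this ▸ .inr ha
        exact h₃.resolve_right fun h₄ => (h₂ a ha).not_ge (cv a (.inl h₄))
      have sz : X.above (j + 1) z ⊆ X.above (j + 1) u := fun a ha =>
        ⟨(cz ⟨ha.1, (Nat.lt_succ_self j).trans ha.2⟩).1, ha.2⟩
      have l₁ : X.E.d true j z = X.E.d false j q := by
        rw [← X.E.d_target j y z l, ← e', X.E.d_target, k]
      obtain ⟨y', z', hyz'⟩ := ih (X.E.comp j z q l₁) c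
        (by rw [X.ncard_comp]; have := Set.ncard_le_ncard cz; omega)
        (by
          rw [X.above_comp l₁ (Nat.le_succ j)]
          refine hs.anti (Set.union_subset_union_left _ (sz.trans Set.subset_union_left)))
      obtain ⟨l₂, l₃, e''⟩ := exists_assoc l l₁
      obtain ⟨y'', h₅⟩ := hyz'.comp_left l₃ h₁
      refine ⟨y'', z', ?_⟩
      rwa [← e, X.E.comp_congr e' rfl k₁ l₂, e'']
  · obtain ⟨p, q, k, rfl, hp, hq⟩ := nontriv u (by omega) su hu
    have hc := X.ncard_comp k
    rw [X.above_comp k le_rfl] at cu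
    rw [X.above_comp k (Nat.le_succ j), Set.union_assoc] at hs
    have k₀ : X.E.d true j q = X.E.d false j v := by rw [← h, X.E.d_target]
    obtain ⟨k₁, k₂, e⟩ := exists_assoc k k₀
    obtain ⟨y, z, hyz⟩ := ih (X.E.comp j q v k₀) c (by rw [X.ncard_comp]; omega)
      (by rw [X.above_comp k₀ (Nat.le_succ j)]; exact hs.anti Set.subset_union_right)
    obtain ⟨l, e', h₁, h₂⟩ := hyz
    have cy : X.above j y ⊆ X.above j v := fun a ha => by
      have := X.above_comp k₀ le_rfl
      rw [e', X.above_comp l le_rfl] at this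
      have h₃ : a ∈ X.above j q ∪ X.above j v := this ▸ .inl ha
      exact h₃.resolve_left fun h₄ => (cu a (.inr h₄)).not_ge (h₁ a ha)
    have sy : X.above (j + 1) y ⊆ X.above (j + 1) v := fun a ha =>
      ⟨(cy ⟨ha.1, (Nat.lt_succ_self j).trans ha.2⟩).1, ha.2⟩
    have l₁ : X.E.d true j p = X.E.d false j y := by
      rw [← X.E.d_source j y z l, ← e', X.E.d_source, k]
    obtain ⟨y', z', hyz'⟩ := ih (X.E.comp j p y l₁) c
      (by rw [X.ncard_comp]; have := Set.ncard_le_ncard cy; omega)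
      (by
        rw [X.above_comp l₁ (Nat.le_succ j)]
        refine hs.anti (Set.union_subset_union_right _ (sy.trans Set.subset_union_right)))
    obtain ⟨l₂, l₃, e''⟩ := exists_assoc l₁ l
    obtain ⟨z'', h₅⟩ := hyz'.comp_right l₂ h₂
    refine ⟨y', z'', ?_⟩
    rwa [e, X.E.comp_congr rfl e' k₂ l₃, ← e'']

/-- Induction on the number of maximal faces above `j`, and inside it on the way the cell is
composed. The order of the factors of a composite in degree `j` is repaired by interchanges as in
sorting. -/
theorem splitAt {j : ℕ} (hI : X.InjAt j) (hS : ∀ i, j = i + 1 → X.SplitAt i) : X.SplitAt j := by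
  suffices H : ∀ N x c, (X.above j x).ncard ≤ N → (X.above (j + 1) x).Subsingleton →
      ∃ y z, X.IsCut j c x y z from fun x c => H _ x c le_rfl
  intro N
  induction N using Nat.strong_induction_on with
  | _ N ihN =>
    have ih : ∀ x c, (X.above j x).ncard < N → (X.above (j + 1) x).Subsingleton →
        ∃ y z, X.IsCut j c x y z := fun x c h => ihN _ h x c le_rfl
    intro x c hN hs
    induction X.tree x with
    | atom a =>
      have ha : X.above j (X.g a) ⊆ {a} := by
        unfold above
        rw [tab_g]
        exact maxAbove_atom a j
      rcases le_or_gt (key a) c with hc | hc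
      · exact X.exists_isCut_of_le fun b hb => (ha hb) ▸ hc
      · exact X.exists_isCut_of_lt fun b hb => (ha hb) ▸ hc
    | comp k u v h _ _ hu hv ihu ihv =>
      -- For `k < j` the cuts of the two factors are composed by the interchange law. For `k = j`
      -- the factors are cut into `u₁ * u₂` and `v₁ * v₂`, and only the middle part `u₂ * v₁` is in
      -- the wrong order.
      rcases lt_trichotomy k j with hk | rfl | hk
      · rw [X.above_comp h (hk.le.trans (Nat.le_succ j))] at hs
        have e := X.above_comp h hk.le
        rw [e] at hN
        obtain ⟨u₁, u₂, ku, rfl, hu₁, hu₂⟩ := ihu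
          ((Set.ncard_le_ncard Set.subset_union_left).trans hN) (hs.anti Set.subset_union_left)
        obtain ⟨v₁, v₂, kv, rfl, hv₁, hv₂⟩ := ihv
          ((Set.ncard_le_ncard Set.subset_union_right).trans hN) (hs.anti Set.subset_union_right)
        have h₁ : X.E.d true k u₁ = X.E.d false k v₁ := by
          rw [← (d_comp_of_lt hk ku true).1, h, (d_comp_of_lt hk kv false).1]
        have h₂ : X.E.d true k u₂ = X.E.d false k v₂ := by
          rw [← (d_comp_of_lt hk ku true).2, h, (d_comp_of_lt hk kv false).2]
        obtain ⟨l₁, l₂, e⟩ := exists_interchange hk.ne ku kv h₁ h₂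
        refine ⟨_, _, l₂, e, fun a ha => ?_, fun a ha => ?_⟩
        · rw [X.above_comp h₁ hk.le] at ha
          exact ha.elim (hu₁ a) (hv₁ a)
        · rw [X.above_comp h₂ hk.le] at ha
          exact ha.elim (hu₂ a) (hv₂ a)
      · rw [X.above_comp h (Nat.le_succ k)] at hs
        rw [X.ncard_comp h] at hN
        have pu := (Set.ncard_pos).2 hu
        have pv := (Set.ncard_pos).2 hv
        obtain ⟨u₁, u₂, ku, rfl, hu₁, hu₂⟩ := ih u c (by omega) (hs.anti Set.subset_union_left)
        obtain ⟨v₁, v₂, kv, rfl, hv₁, hv₂⟩ := ih v c (by omega) (hs.anti Set.subset_union_right)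
        rw [X.ncard_comp ku, X.ncard_comp kv] at hN
        rw [X.above_comp ku (Nat.le_succ k), X.above_comp kv (Nat.le_succ k)] at hs
        have h₁ : X.E.d true k u₂ = X.E.d false k v₁ := by
          rw [← X.E.d_target k u₁ u₂ ku, h, X.E.d_source]
        obtain ⟨y, z, hyz⟩ := X.exists_isCut_comp hI hS ih h₁ (by rw [X.ncard_comp]; omega)
          (by
            rw [X.above_comp h₁ (Nat.le_succ k)]
            exact hs.anti (Set.union_subset_union Set.subset_union_right Set.subset_union_left))
          hu₂ hv₁
        have h₂ : X.E.d true k (X.E.comp k u₂ v₁ h₁) = X.E.d false k v₂ := by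
          rw [X.E.d_target, kv]
        obtain ⟨z', hyz'⟩ := hyz.comp_right h₂ hv₂
        have h₃ : X.E.d true k u₁ =
            X.E.d false k (X.E.comp k (X.E.comp k u₂ v₁ h₁) v₂ h₂) := by
          rw [X.E.d_source, X.E.d_source, ku]
        obtain ⟨y', hyz''⟩ := hyz'.comp_left h₃ hu₁
        refine ⟨y', z', ?_⟩
        have h₄ : X.E.d true k u₂ = X.E.d false k (X.E.comp k v₁ v₂ kv) := by
          rw [← X.E.d_target k u₁ u₂ ku, h]
        obtain ⟨_, h₅, e₁⟩ := exists_assoc ku h₄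
        obtain ⟨_, h₆, e₂⟩ := exists_assoc h₁ kv
        rw [e₁, X.E.comp_congr rfl e₂.symm h₅ h₃]
        exact hyz''
      -- A nontrivial composite in a degree above `j` has two maximal faces of dimension above `j +
      -- 1`.
      · exfalso
        obtain ⟨a, ha⟩ := hu
        obtain ⟨b, hb⟩ := hv
        have h' := X.above_anti (Nat.succ_le_of_lt hk) (X.E.comp k u v h)
        rw [X.above_comp h le_rfl] at h'
        have hab := hs (h' (.inl ha)) (h' (.inr hb))
        exact Set.disjoint_left.1 (X.above_disjoint h le_rfl) ha (hab ▸ hb)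

/-- The two properties support each other: injectivity at `j + 1` uses cuts in degree `j`, and cuts
in degree `j + 1` use injectivity at `j + 1` to identify the pieces of a common boundary. -/
theorem injAt_and_splitAt (j : ℕ) : X.InjAt j ∧ X.SplitAt j := by
  induction j with
  | zero => exact ⟨X.injAt_zero, X.splitAt X.injAt_zero (fun i h => by omega)⟩
  | succ j ih =>
    have h := X.injAt_succ ih.1 ih.2
    exact ⟨h, X.splitAt h fun i e => by
      obtain rfl : j = i := by omega
      exact ih.2⟩

/-- The cells over a simplex are determined by their tables. -/
theorem tab_injective : Function.Injective X.tab := by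
  intro x y h
  -- In a degree beyond all faces of the table the condition on maximal faces is vacuous.
  obtain ⟨N, hN⟩ := (X.tab x).finite
  refine (X.injAt_and_splitAt N).1 x y h ?_
  have : X.above N x = ∅ := Set.eq_empty_of_forall_notMem fun a ha => by
    have h' := ha.1 true
    rw [hN _ _ ha.2.le] at h'
    exact h'
  rw [this]
  exact Set.subsingleton_empty

/-- The tables of the cells over a simplex are the tables of the cells of the simplex. -/
theorem exists_tab_eq {T : (simplexComplex n).tables.carrier}
    (hT : (simplexComplex n).tables.Generated (fun T => ∃ x, T = (simplexComplex n).atom x) T) :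
    ∃ x, X.tab x = T := by
  induction hT with
  | of T h =>
    obtain ⟨a, rfl⟩ := h
    exact ⟨X.g a, X.tab_g a⟩
  | d α k T _ ih =>
    obtain ⟨x, rfl⟩ := ih
    exact ⟨X.E.d α k x, X.tab_d α k x⟩
  | comp k S T h _ _ ihS ihT =>
    obtain ⟨x, rfl⟩ := ihS
    obtain ⟨y, rfl⟩ := ihT
    -- Injectivity turns equality of the boundaries of the tables into composability of the cells.
    have h' : X.E.d true k x = X.E.d false k y := X.tab_injective (by
      rw [tab_d, tab_d]
      exact h)
    exact ⟨X.E.comp k x y h', X.tab_comp h'⟩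

theorem generated_of_composite {T : (simplexComplex n).Table}
    (hT : (simplexComplex n).Composite T) :
    (simplexComplex n).tables.Generated (fun T => ∃ x, T = (simplexComplex n).atom x) T := by
  induction hT with
  | atom x => exact .of _ ⟨x, rfl⟩
  | comp k S T h _ _ ihS ihT =>
    exact OmegaCat.Generated.comp (C := (simplexComplex n).tables) k S T h ihS ihT

end AtomicOver

end SimplexFace

/-! ### The universal property of the semi-path omega-category -/

namespace OmegaCat

theorem free_map_freeCell {G H : GlobularSet.{u}} (f : G ⟶ H) (n : ℕ) (x : G.cells n) :
    Hom.toFun (free.map f) (freeCell G n x) = freeCell H n (GlobularSet.Hom.app f n x) :=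
  freeLift_freeCell _ n x

theorem counit_freeCell (C : OmegaCat.{u}) (n : ℕ) (x : (underlying.obj C).cells n) :
    Hom.toFun (freeAdjunction.counit.app C) (freeCell (underlying.obj C) n x) = x.1 := by
  have e : freeAdjunction.counit.app C = freeLift (𝟙 (underlying.obj C)) := by
    simp [freeAdjunction]
    rfl
  rw [e]
  exact freeLift_freeCell _ n x

theorem free_hom_ext {G : GlobularSet.{u}} {D : OmegaCat.{u}} {f g : freeObj G ⟶ D}
    (h : ∀ n x, Hom.toFun f (freeCell G n x) = Hom.toFun g (freeCell G n x)) : f = g :=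
  (freeEquiv G D).injective (GlobularSet.hom_ext fun n x => Subtype.ext (h n x))

section CompGen

variable {C D : OmegaCat.{u}}

theorem CompGen.trans {S S' : C.carrier → Prop} (h : ∀ x, S x → C.CompGen S' x) {x : C.carrier}
    (hx : C.CompGen S x) : C.CompGen S' x := by
  induction hx with
  | of x hx => exact h x hx
  | comp n x y e _ _ hx hy => exact .comp n x y e hx hy

/-- A set of cells that is closed under sources and targets generates a set of cells that is closed
under sources and targets. -/
theorem CompGen.d {S : C.carrier → Prop} (h : ∀ α n x, S x → S (C.d α n x)) {x : C.carrier}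
    (hx : C.CompGen S x) (α : Bool) (n : ℕ) : C.CompGen S (C.d α n x) := by
  induction hx with
  | of x hx => exact .of _ (h α n x hx)
  | comp k x y e _ _ hx hy =>
    by_cases hk : n = k
    · subst hk
      cases α
      · rwa [C.d_source]
      · rwa [C.d_target]
    · obtain ⟨e', he⟩ := C.d_comp α n k x y e hk
      rw [he]
      exact .comp k _ _ e' hx hy

theorem hom_eq_of_compGen {S : C.carrier → Prop} {f g : C ⟶ D}
    (h : ∀ x, S x → Hom.toFun f x = Hom.toFun g x) {x : C.carrier} (hx : C.CompGen S x) :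
    Hom.toFun f x = Hom.toFun g x := by
  induction hx with
  | of x hx => exact h x hx
  | comp n x y e _ _ hx hy =>
    obtain ⟨h₁, e₁⟩ := Hom.map_comp f n x y e
    obtain ⟨h₂, e₂⟩ := Hom.map_comp g n x y e
    rw [e₁, e₂]
    exact D.comp_congr hx hy _ _

end CompGen

section SemiPath

variable (C : OmegaCat.{u}) (hC : C.NonContracting)

variable {C hC} in
theorem eq_of_germRel {A : Type*} {f : (C.path hC).carrier → A}
    (hf : ∀ a b, C.GermStep hC a b → f a = f b) {a b : (C.path hC).carrier}
    (h : C.GermRel hC a b) : f a = f b := by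
  induction h with
  | rel a b h => exact hf a b h
  | refl a => rfl
  | symm a b _ ih => exact ih.symm
  | trans a b c _ _ ih ih' => exact ih.trans ih'

/-- An `ω`-functor on `ℙC` that is constant on germs factors through `ℙ⁻C`. -/
theorem exists_semiPath_desc {D : OmegaCat.{u}} (f : C.path hC ⟶ D)
    (hf : ∀ a b, C.GermStep hC a b → Hom.toFun f a = Hom.toFun f b) :
    ∃ F : C.semiPath hC ⟶ D, C.toSemiPath hC ≫ F = f := by
  let f' : C.germGlobularSet hC ⟶ underlying.obj D :=
    { app := fun n => Quotient.lift (GlobularSet.Hom.app (underlying.map f) n)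
        (fun _ _ h => Subtype.ext (eq_of_germRel hf h))
      app_bd := fun α n x => by
        induction x using Quotient.inductionOn with | _ x =>
        exact GlobularSet.Hom.app_bd (underlying.map f) α n x }
  have e : C.germProj hC ≫ f' = underlying.map f := rfl
  refine ⟨Limits.pushout.desc (free.map f' ≫ freeAdjunction.counit.app D) f ?_,
    Limits.pushout.inr_desc _ _ _⟩
  rw [← Category.assoc, ← free.map_comp, e]
  exact freeAdjunction.counit_naturality f

/-- The canonical `ω`-functor is compatible with the inclusion of the germs. -/
theorem inl_freeCell (n : ℕ) (x : (underlying.obj (C.path hC)).cells n) :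
    Hom.toFun (Limits.pushout.inl (free.map (C.germProj hC))
      (freeAdjunction.counit.app (C.path hC)))
      (freeCell (C.germGlobularSet hC) n (GlobularSet.Hom.app (C.germProj hC) n x)) =
    Hom.toFun (C.toSemiPath hC) x.1 := by
  have h : Hom.toFun (Limits.pushout.inl (free.map (C.germProj hC)) _)
      (Hom.toFun (free.map (C.germProj hC)) (freeCell _ n x)) =
      Hom.toFun (C.toSemiPath hC)
        (Hom.toFun (freeAdjunction.counit.app (C.path hC)) (freeCell _ n x)) :=
    congrArg (fun k => Hom.toFun k (freeCell _ n x))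
      (Limits.pushout.condition (f := free.map (C.germProj hC))
        (g := freeAdjunction.counit.app (C.path hC)))
  rwa [free_map_freeCell, counit_freeCell] at h

-- The generating globular set is graded, so both cells are first viewed as cells of a common
-- degree; there the projection identifies them, and the pushout square carries this over to
-- `toSemiPath`.
variable {C hC} in
theorem toSemiPath_eq_of_germStep {a b : (C.path hC).carrier} (h : C.GermStep hC a b) :
    Hom.toFun (C.toSemiPath hC) a = Hom.toFun (C.toSemiPath hC) b := by
  have ha := le_max_left ((C.path hC).dim a) ((C.path hC).dim b)
  have hb := le_max_right ((C.path hC).dim a) ((C.path hC).dim b)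
  have h₁ := C.inl_freeCell hC _ ⟨a, ha⟩
  have h₂ := C.inl_freeCell hC _ ⟨b, hb⟩
  have e : GlobularSet.Hom.app (C.germProj hC) _ ⟨a, ha⟩ =
      GlobularSet.Hom.app (C.germProj hC) _ ⟨b, hb⟩ :=
    Quotient.sound (Relation.EqvGen.rel _ _ h)
  rw [e] at h₁
  exact h₁.symm.trans h₂

-- On the other leg of the pushout the generators are classes of cells of `ℙC`, and the square
-- expresses their images by `toSemiPath`. So `h⁻` is an epimorphism.
variable {C hC} in
theorem semiPath_hom_ext {D : OmegaCat.{u}} {F F' : C.semiPath hC ⟶ D}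
    (h : C.toSemiPath hC ≫ F = C.toSemiPath hC ≫ F') : F = F' := by
  refine Limits.pushout.hom_ext (free_hom_ext ?_) h
  intro n x
  induction x using Quotient.inductionOn with | _ x =>
  have e := C.inl_freeCell hC n x
  have h' : Hom.toFun F (Hom.toFun (C.toSemiPath hC) x.1) =
      Hom.toFun F' (Hom.toFun (C.toSemiPath hC) x.1) := congrArg (fun k => Hom.toFun k x.1) h
  rw [← e] at h'
  exact h'

/-- The semi-path `ω`-category is generated by germs under composition. -/
theorem compGen_semiPath (z : (C.semiPath hC).carrier) :
    (C.semiPath hC).CompGen (fun z => ∃ x, z = Hom.toFun (C.toSemiPath hC) x) z := by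
  let S := (C.semiPath hC).CompGen (fun z => ∃ x, z = Hom.toFun (C.toSemiPath hC) x)
  let D := (C.semiPath hC).sub S
    (fun α n x hx => hx.d (by
      rintro α n _ ⟨x, rfl⟩
      exact ⟨(C.path hC).d α n x, (Hom.map_d _ α n x).symm⟩) α n)
    (fun n x y h hx hy => .comp n x y h hx hy)
  let f : C.path hC ⟶ D :=
    { toFun := fun x => ⟨Hom.toFun (C.toSemiPath hC) x, .of _ ⟨x, rfl⟩⟩
      map_d := fun α n x => Subtype.ext (Hom.map_d (C.toSemiPath hC) α n x)
      map_comp := fun n x y h => by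
        obtain ⟨h', e⟩ := Hom.map_comp (C.toSemiPath hC) n x y h
        exact ⟨Subtype.ext h', Subtype.ext e⟩ }
  let i : D ⟶ C.semiPath hC :=
    { toFun := fun x => x.1
      map_d := fun _ _ _ => rfl
      map_comp := fun n x y h => ⟨congrArg Subtype.val h, rfl⟩ }
  obtain ⟨F, hF⟩ := C.exists_semiPath_desc hC f
    (fun a b h => Subtype.ext (toSemiPath_eq_of_germStep h))
  -- The inclusion of the composites of germs has a section by the universal property, so every cell
  -- is such a composite.
  have e : F ≫ i = 𝟙 _ := semiPath_hom_ext (by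
    rw [← Category.assoc, hF]
    rfl)
  have h := congrArg (fun k => Hom.toFun k z) e
  simp only [comp_apply, id_apply] at h
  rw [← h]
  exact (Hom.toFun F z).2

/-- The fibers of the semi-path `ω`-category are generated by germs under composition. -/
theorem compGen_semiPathAt {a : C.carrier} (z : (C.semiPathAt hC a).carrier) :
    (C.semiPathAt hC a).CompGen
      (fun z => ∃ x hx hs, z = C.germ hC x hx hs) z := by
  obtain ⟨z, hz⟩ := z
  induction C.compGen_semiPath hC z with
  | of z h =>
    obtain ⟨x, rfl⟩ := h
    refine .of _ ⟨x.1, x.2, ?_, rfl⟩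
    rw [semiPathStart_toSemiPath] at hz
    exact hz
  | comp n x y h _ _ hx hy =>
    -- The grading takes values in a discrete `ω`-category, so the factors of a composite lie in the
    -- same fiber as the composite.
    obtain ⟨h', e⟩ := Hom.map_comp (C.semiPathStart hC) n x y h
    have hx' : Hom.toFun (C.semiPathStart hC) x = a := (e.symm.trans hz :)
    have hy' : Hom.toFun (C.semiPathStart hC) y = a := (Eq.trans h'.symm hx' :)
    exact CompGen.comp (C := C.semiPathAt hC a) n ⟨x, hx'⟩ ⟨y, hy'⟩ (Subtype.ext h)
      (hx hx') (hy hy')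

variable {C hC} in
/-- `ω`-functors on a fiber of the semi-path `ω`-category are determined by their values on
germs. -/
theorem semiPathAt_hom_ext {a : C.carrier} {D : OmegaCat.{u}} {F F' : C.semiPathAt hC a ⟶ D}
    (h : ∀ x hx hs, Hom.toFun F (C.germ hC x hx hs) = Hom.toFun F' (C.germ hC x hx hs)) :
    F = F' :=
  hom_ext fun z => hom_eq_of_compGen (by
    rintro _ ⟨x, hx, hs, rfl⟩
    exact h x hx hs) (C.compGen_semiPathAt hC z)

end SemiPath

end OmegaCat

/-! ### Composites of low-dimensional atoms -/

namespace FaceComplex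

open OmegaCat

variable {K : FaceComplex}

/-- In degree `k` the condition on faces of dimension `k + 1` is vacuous, so source and target
coincide there, and above `k` there are no faces. -/
theorem atom_d (x : K.Face) {α : Bool} {k : ℕ} (h : K.dim x ≤ k) : (K.atom x).d α k = K.atom x := by
  ext β m a
  have hk : ∀ γ a, a ∈ (K.atom x).val γ k ↔ K.sub a x ∧ K.dim a = k := fun γ a => by
    refine ⟨fun h => ⟨h.1, h.2.1⟩, fun h' => ⟨h'.1, h'.2, fun b hb hb' => ?_⟩⟩
    have := K.dim_le b x hb
    omega
  rcases lt_trichotomy m k with hm | rfl | hm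
  · rw [Table.d_val_lt _ hm]
  · rw [Table.d_val_eq, hk, hk]
  · rw [Table.d_val_gt _ hm]
    refine ⟨fun h => h.elim, fun ha => ?_⟩
    have := K.dim_le a x ha.1
    have := ha.2.1
    omega

variable (K) in
/-- The tables that are obtained by composition from atoms of dimension at most `k`. -/
inductive CompositeLE (k : ℕ) : K.Table → Prop
  | atom (x : K.Face) (h : K.dim x ≤ k) : CompositeLE k (K.atom x)
  | comp (n : ℕ) (S T : K.Table) (h : S.d true n = T.d false n) :
      CompositeLE k S → CompositeLE k T → CompositeLE k (S.comp n T)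

theorem CompositeLE.mono {k l : ℕ} (h : k ≤ l) {T : K.Table} (hT : K.CompositeLE k T) :
    K.CompositeLE l T := by
  induction hT with
  | atom x hx => exact .atom x (hx.trans h)
  | comp n S T e _ _ hS hT => exact .comp n S T e hS hT

theorem CompositeLE.composite {k : ℕ} {T : K.Table} (hT : K.CompositeLE k T) : K.Composite T := by
  induction hT with
  | atom x hx => exact .atom x
  | comp n S T e _ _ hS hT => exact .comp n S T e hS hT

theorem Composite.exists_compositeLE {T : K.Table} (hT : K.Composite T) :
    ∃ k, K.CompositeLE k T := by
  induction hT with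
  | atom x => exact ⟨_, .atom x le_rfl⟩
  | comp n S T e _ _ hS hT =>
    obtain ⟨k, hk⟩ := hS
    obtain ⟨l, hl⟩ := hT
    exact ⟨max k l, .comp n S T e (hk.mono (le_max_left k l)) (hl.mono (le_max_right k l))⟩

theorem Table.d_comp {i n : ℕ} (h : i ≠ n) {S T : K.Table} (e : S.d true n = T.d false n)
    (α : Bool) : (S.d α i).d true n = (T.d α i).d false n ∧
      (S.comp n T).d α i = (S.d α i).comp n (T.d α i) := by
  obtain ⟨h₁, h₂⟩ := K.tables.d_comp α i n S T e h
  exact ⟨h₁, h₂⟩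

theorem Table.comp_eq_left {j : ℕ} {S T : K.Table} (e : S.d true j = T.d false j)
    (hS : S.d true j = S) (hT : T.d false j = T) : S.comp j T = S ∧ S = T := by
  have h : S = T := by rw [← hS, e, hT]
  refine ⟨?_, h⟩
  have e' : S.d true j = (S.d true j).d false j := by rw [hS, h, hT]
  have := K.tables.comp_target j S e'
  change S.comp j (S.d true j) = S at this
  rwa [hS.trans h] at this

theorem CompositeLE.d_eq {k j : ℕ} {T : K.Table} (hT : K.CompositeLE k T) (h : k ≤ j) (α : Bool) :
    T.d α j = T := by
  induction hT generalizing α with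
  | atom x hx => exact atom_d x (hx.trans h)
  | comp n S T e _ _ hS hT =>
    by_cases hj : j = n
    · subst hj
      obtain ⟨h₁, h₂⟩ := Table.comp_eq_left e (hS true) (hT false)
      rw [h₁, hS]
    · rw [(Table.d_comp hj e α).2, hS, hT]

theorem CompositeLE.comp_eq {k j : ℕ} {S T : K.Table} (hS : K.CompositeLE k S)
    (hT : K.CompositeLE k T) (h : k ≤ j) (e : S.d true j = T.d false j) : S.comp j T = S :=
  (Table.comp_eq_left e (hS.d_eq h true) (hT.d_eq h false)).1

/-- Only atoms have to be checked: a boundary of a composite is a boundary of one factor in the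
degree of composition, and a composite of boundaries in every other degree. -/
theorem CompositeLE.d (hK : ∀ x α i, K.CompositeLE i ((K.atom x).d α i)) {k : ℕ} {T : K.Table}
    (hT : K.CompositeLE k T) (α : Bool) (i : ℕ) : K.CompositeLE i (T.d α i) := by
  induction hT with
  | atom x _ => exact hK x α i
  | comp n S T e _ _ hS hT =>
    by_cases hi : i = n
    · subst hi
      cases α
      · rwa [show (S.comp i T).d false i = S.d false i from K.tables.d_source i S T e]
      · rwa [show (S.comp i T).d true i = T.d true i from K.tables.d_target i S T e]
    · obtain ⟨e', h⟩ := Table.d_comp hi e α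
      rw [h]
      exact .comp n _ _ e' hS hT

end FaceComplex

/-! ### Decomposition of the cells of cubes -/

namespace CubeTable

open FaceComplex

variable {n : ℕ}

theorem dim_eq (b : Fin (n + 1) → SignType) : (cubeComplex (n + 1)).dim b =
    (cubeComplex n).dim (Fin.tail b) + if b 0 = 0 then 1 else 0 := by
  change (Finset.univ.filter (fun i => b i = 0)).card =
    (Finset.univ.filter (fun i => b (Fin.succ i) = 0)).card + _
  simp only [Finset.card_filter]
  rw [Fin.sum_univ_succ, add_comm]

theorem dim_cons (ε : SignType) (c : Fin n → SignType) :
    (cubeComplex (n + 1)).dim (Fin.cons ε c : Fin (n + 1) → SignType) =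
      (cubeComplex n).dim c + if ε = 0 then 1 else 0 :=
  dim_eq _

theorem zerosBefore_zero (b : Fin (n + 1) → SignType) : zerosBefore b 0 = 0 := by
  simp [zerosBefore]

theorem zerosBefore_succ (b : Fin (n + 1) → SignType) (i : Fin n) :
    zerosBefore b i.succ = zerosBefore (Fin.tail b) i + if b 0 = 0 then 1 else 0 := by
  unfold zerosBefore
  simp only [Finset.card_filter]
  rw [Fin.sum_univ_succ, add_comm]
  simp only [Fin.succ_lt_succ_iff, Fin.succ_pos, true_and]
  rfl

/-- The sign of a direction. -/
def sgn (σ : Bool) : SignType := if σ = true then 1 else -1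

/-- The word `c` belongs to the `m`-source (`α = false`) or `m`-target (`α = true`) of `T`. -/
def Has (T : (cubeComplex n).Table) (α : Bool) (m : ℕ) (c : Fin n → SignType) : Prop :=
  c ∈ T.val α m

theorem has_d {T : (cubeComplex n).Table} {α β : Bool} {k m : ℕ} {c : Fin n → SignType} :
    Has (T.d α k) β m c ↔ (m < k ∧ Has T β m c) ∨ (m = k ∧ Has T α m c) := by
  unfold Has
  rcases lt_trichotomy m k with h | rfl | h
  · rw [Table.d_val_lt _ h]
    simp [h, h.ne]
  · rw [Table.d_val_eq]
    simp
  · rw [Table.d_val_gt _ h]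
    simp only [h.ne', h.not_gt, false_and, or_self, iff_false]
    exact id

theorem has_comp {S T : (cubeComplex n).Table} {β : Bool} {k m : ℕ} {c : Fin n → SignType} :
    Has (S.comp k T) β m c ↔ (m < k ∧ Has S β m c) ∨
      (m = k ∧ ((β = false ∧ Has S β m c) ∨ (β = true ∧ Has T β m c))) ∨
      (k < m ∧ (Has S β m c ∨ Has T β m c)) := by
  unfold Has
  rcases lt_trichotomy m k with h | rfl | h
  · rw [Table.comp_val_lt _ _ h]
    simp [h, h.ne, h.not_gt]
  · cases β
    · rw [Table.comp_val_source]
      simp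
    · rw [Table.comp_val_target]
      simp
  · rw [Table.comp_val_gt _ _ h]
    simp only [h, h.ne', h.not_gt, false_and, true_and, false_or]
    exact Iff.rfl

theorem table_ext {S T : (cubeComplex (n + 1)).Table}
    (h : ∀ α m ε (c : Fin n → SignType), Has S α m (Fin.cons ε c) ↔ Has T α m (Fin.cons ε c)) :
    S = T := by
  ext α m (b : Fin (n + 1) → SignType)
  rw [← Fin.cons_self_tail b]
  exact h α m _ _

/-! ### Cylinders over tables -/

/-- The product of the interval with a table. -/
def cyl (T : (cubeComplex n).Table) : (cubeComplex (n + 1)).Table where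
  val α m := {b : Fin (n + 1) → SignType |
    (b 0 = 0 ∧ 0 < m ∧ Has T (!α) (m - 1) (Fin.tail b)) ∨ (b 0 = sgn α ∧ Has T α m (Fin.tail b))}
  dim_eq := by
    rintro α m b (⟨h, hm, hb⟩ | ⟨h, hb⟩) <;> refine (dim_eq b).trans ?_
    · rw [T.dim_eq _ _ _ hb, if_pos h, Nat.sub_add_cancel hm]
    · rw [T.dim_eq _ _ _ hb, if_neg (by rw [h]; cases α <;> decide)]
      rfl
  finite := by
    obtain ⟨N, hN⟩ := T.finite
    refine ⟨N + 1, fun α m hm => Set.eq_empty_of_forall_notMem ?_⟩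
    rintro b (⟨h, -, hb⟩ | ⟨h, hb⟩) <;>
    · unfold Has at hb
      rw [hN _ _ (by omega)] at hb
      exact hb

/-- The table that extends the end in direction `σ` of the product of the interval with `A` by the
parts of the product of dimension at most `i`. -/
def side (σ : Bool) (A : (cubeComplex n).Table) (i : ℕ) : (cubeComplex (n + 1)).Table where
  val α m := {b : Fin (n + 1) → SignType |
    (b 0 = sgn σ ∧ (α = σ ∨ i ≤ m) ∧ Has A α m (Fin.tail b)) ∨
      (b 0 = 0 ∧ 0 < m ∧ ((m < i ∧ Has A (!α) (m - 1) (Fin.tail b)) ∨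
        (m = i ∧ Has A (!σ) (m - 1) (Fin.tail b)))) ∨
      (b 0 = sgn (!σ) ∧ α = !σ ∧ m < i ∧ Has A α m (Fin.tail b))}
  dim_eq := by
    rintro α m b (⟨h, -, hb⟩ | ⟨h, hm, (⟨-, hb⟩ | ⟨-, hb⟩)⟩ | ⟨h, -, -, hb⟩) <;>
      refine (dim_eq b).trans ?_ <;> rw [A.dim_eq _ _ _ hb]
    · rw [if_neg (by rw [h]; cases σ <;> decide)]
      rfl
    · rw [if_pos h, Nat.sub_add_cancel hm]
    · rw [if_pos h, Nat.sub_add_cancel hm]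
    · rw [if_neg (by rw [h]; cases σ <;> decide)]
      rfl
  finite := by
    obtain ⟨N, hN⟩ := A.finite
    refine ⟨N + 1, fun α m hm => Set.eq_empty_of_forall_notMem ?_⟩
    rintro b (⟨h, -, hb⟩ | ⟨h, -, (⟨-, hb⟩ | ⟨-, hb⟩)⟩ | ⟨h, -, -, hb⟩) <;>
    · unfold Has at hb
      rw [hN _ _ (by omega)] at hb
      exact hb

theorem has_cyl {T : (cubeComplex n).Table} {α : Bool} {m : ℕ} {ε : SignType}
    {c : Fin n → SignType} : Has (cyl T) α m (Fin.cons ε c) ↔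
      (ε = 0 ∧ 0 < m ∧ Has T (!α) (m - 1) c) ∨ (ε = sgn α ∧ Has T α m c) := Iff.rfl

theorem has_side {A : (cubeComplex n).Table} {σ α : Bool} {i m : ℕ} {ε : SignType}
    {c : Fin n → SignType} : Has (side σ A i) α m (Fin.cons ε c) ↔
      (ε = sgn σ ∧ (α = σ ∨ i ≤ m) ∧ Has A α m c) ∨
      (ε = 0 ∧ 0 < m ∧ ((m < i ∧ Has A (!α) (m - 1) c) ∨ (m = i ∧ Has A (!σ) (m - 1) c))) ∨
      (ε = sgn (!σ) ∧ α = !σ ∧ m < i ∧ Has A α m c) := Iff.rfl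

theorem has_atom {x c : Fin n → SignType} {α : Bool} {m : ℕ} :
    Has ((cubeComplex n).atom x) α m c ↔ (∀ i, x i = 0 ∨ c i = x i) ∧
      (cubeComplex n).dim c = m ∧ ∀ i, x i = 0 → c i ≠ 0 →
        c i = (-1) ^ (zerosBefore c i + 1 + if α = true then 1 else 0) := cube_mem_atom x c α m

/-- A letter `0` in front adds one to the number of zeros before every later letter. This changes
all later signs, so source and target of the remaining word are exchanged. -/
theorem has_atom_cons {ε ε' : SignType} {x c : Fin n → SignType} {α : Bool} {m : ℕ} :
    Has ((cubeComplex (n + 1)).atom (Fin.cons ε' x : Fin (n + 1) → SignType)) α m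
        (Fin.cons ε c) ↔
      (if ε' = 0 then (ε = 0 ∧ 0 < m ∧ Has ((cubeComplex n).atom x) (!α) (m - 1) c) ∨
        (ε = sgn α ∧ Has ((cubeComplex n).atom x) α m c) else
        ε = ε' ∧ Has ((cubeComplex n).atom x) α m c) := by
  rw [has_atom, has_atom, has_atom, dim_eq, Fin.forall_fin_succ, Fin.forall_fin_succ]
  simp only [zerosBefore_zero, zerosBefore_succ, Fin.cons_zero, Fin.cons_succ, Fin.tail_cons]
  by_cases h' : ε' = 0
  · subst h'
    by_cases h : ε = 0
    · subst h
      have e : ∀ z : ℕ, (-1 : SignType) ^ (z + 1 + 1 + if α = true then 1 else 0) =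
          (-1) ^ (z + 1 + if (!α) = true then 1 else 0) := fun z => by
        cases α <;> simp [pow_succ]
      have hs : (0 : SignType) ≠ sgn α := by cases α <;> decide
      simp [e, hs]
      grind
    · have hs : (-1 : SignType) ^ (0 + 1 + if α = true then 1 else 0) = sgn α := by
        cases α <;> simp [sgn]
      rw [hs]
      simp [h]
      grind
  · by_cases h : ε = ε'
    · subst h
      simp [h']
    · simp [h, h']

theorem cyl_atom (x : Fin n → SignType) : cyl ((cubeComplex n).atom x) =
    (cubeComplex (n + 1)).atom (Fin.cons 0 x : Fin (n + 1) → SignType) :=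
  table_ext fun _ _ _ _ => by rw [has_cyl, has_atom_cons, if_pos rfl]

theorem side_atom (σ : Bool) (x : Fin n → SignType) : side σ ((cubeComplex n).atom x) 0 =
    (cubeComplex (n + 1)).atom (Fin.cons (sgn σ) x : Fin (n + 1) → SignType) :=
  table_ext fun α m ε c => by
    rw [has_side, has_atom_cons, if_neg (by cases σ <;> decide)]
    simp
    omega

/-- In degree `k` the boundary of the product in direction `σ` has two kinds of faces: those in the
end `σ` over the boundary of `X` in the same direction, and those along the interval over the
opposite boundary of degree `k - 1`. The definition of `side` is made to record this. -/
theorem d_cyl (σ : Bool) (k : ℕ) (X : (cubeComplex n).Table) :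
    (cyl X).d σ k = side σ (X.d σ k) k := by
  refine table_ext fun α m ε c => ?_
  simp only [has_side, has_d, has_cyl]
  cases σ <;> cases α <;> cases ε <;> simp [sgn] <;> grind

/-- Iterating, a side is an end of the product with the cylinders over the lower boundaries attached
one degree after the other. This reduces sides to cylinders over cells of smaller dimension. -/
theorem side_false_succ (A : (cubeComplex n).Table) (i : ℕ) :
    (side false A i).d true i = (cyl (A.d true i)).d false i ∧
      side false A (i + 1) = (side false A i).comp i (cyl (A.d true i)) := by
  constructor <;> refine table_ext fun α m ε c => ?_
  · simp only [has_side, has_d, has_cyl]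
    cases α <;> cases ε <;> simp [sgn] <;> grind
  · simp only [has_side, has_d, has_cyl, has_comp]
    cases α <;> cases ε <;> simp [sgn] <;> grind

theorem side_true_succ (B : (cubeComplex n).Table) (i : ℕ) :
    (cyl (B.d false i)).d true i = (side true B i).d false i ∧
      side true B (i + 1) = (cyl (B.d false i)).comp i (side true B i) := by
  constructor <;> refine table_ext fun α m ε c => ?_
  · simp only [has_side, has_d, has_cyl]
    cases α <;> cases ε <;> simp [sgn] <;> grind
  · simp only [has_side, has_d, has_cyl, has_comp]
    cases α <;> cases ε <;> simp [sgn] <;> grind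

/-- The product of the interval with a composite. -/
theorem cyl_comp {A B : (cubeComplex n).Table} {j : ℕ} (h : A.d true j = B.d false j) :
    (side false (A.d false (j + 1)) j).d true j = (cyl B).d false j ∧
    (cyl A).d true j = (side true (B.d true (j + 1)) j).d false j ∧
    ((side false (A.d false (j + 1)) j).comp j (cyl B)).d true (j + 1) =
      ((cyl A).comp j (side true (B.d true (j + 1)) j)).d false (j + 1) ∧
    cyl (A.comp j B) = ((side false (A.d false (j + 1)) j).comp j (cyl B)).comp (j + 1)
      ((cyl A).comp j (side true (B.d true (j + 1)) j)) := by
  have lt : ∀ m < j, ∀ α c, Has A α m c ↔ Has B α m c := fun m hm α c => by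
    unfold Has
    rw [Table.eq_of_lt h hm]
  have eq : ∀ c, Has A true j c ↔ Has B false j c := fun c => by
    unfold Has
    rw [Table.eq_at h]
  -- In the formula, `B` is swept along the interval first and then `A`; the sides are whiskers that
  -- supply the missing part of the other factor. Each identity is an equivalence of memberships,
  -- checked separately below `j`, at `j`, at `j + 1` and above.
  refine ⟨?_, ?_, ?_, ?_⟩ <;> refine table_ext fun α m ε c => ?_ <;>
    simp only [has_side, has_d, has_cyl, has_comp] <;> clear h <;>
    (obtain hm | rfl | rfl | hm : m < j ∨ m = j ∨ m = j + 1 ∨ j + 1 < m := by omega)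
  all_goals
    first
    | have l₁ := fun α => lt m hm α c
      have l₂ := fun α => lt (m - 1) (by omega) α c
      clear lt eq
      have : ¬ m = j := by omega
      have : ¬ m = j + 1 := by omega
      have : ¬ j < m := by omega
      have : m < j + 1 := by omega
      cases α <;> cases ε <;> simp [sgn, *] <;> grind
    | have : ¬ m = j := by omega
      have : ¬ m = j + 1 := by omega
      have : ¬ m < j := by omega
      have : ¬ m < j + 1 := by omega
      have : j < m := by omega
      have : ¬ m - 1 < j + 1 := by omega
      clear lt eq
      cases α <;> cases ε <;> simp [sgn, *] <;> grind
    | skip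
  all_goals cases α <;> cases ε <;> simp [sgn, *] <;> grind

/-- Every source and target of every atom of the cube of dimension `n` is a composite of atoms of the
right dimension. -/
def Decomposes (n : ℕ) : Prop :=
  ∀ (x : (cubeComplex n).Face) α i, (cubeComplex n).CompositeLE i (((cubeComplex n).atom x).d α i)

/-- Placing a table in one end of the interval changes neither degrees nor signs, so it respects
composition. -/
theorem side_zero_compositeLE (σ : Bool) {k : ℕ} {A : (cubeComplex n).Table}
    (hA : (cubeComplex n).CompositeLE k A) : (cubeComplex (n + 1)).CompositeLE k (side σ A 0) := by
  induction hA with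
  | atom x hx =>
    rw [side_atom σ x]
    refine .atom _ ((dim_cons _ x).trans_le ?_)
    rw [if_neg (by cases σ <;> decide)]
    exact hx
  | comp j S T e _ _ hS hT =>
    have h : (side σ S 0).d true j = (side σ T 0).d false j ∧
        side σ (S.comp j T) 0 = (side σ S 0).comp j (side σ T 0) := by
      have lt : ∀ m < j, ∀ α c, Has S α m c ↔ Has T α m c := fun m hm α c => by
        unfold Has
        rw [Table.eq_of_lt e hm]
      have eq : ∀ c, Has S true j c ↔ Has T false j c := fun c => by
        unfold Has
        rw [Table.eq_at e]
      constructor <;> refine table_ext fun α m ε c => ?_ <;>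
        simp only [has_side, has_d, has_comp] <;> grind
    rw [h.2]
    exact .comp j _ _ h.1 hS hT

theorem side_compositeLE (hn : Decomposes n) {k : ℕ}
    (hc : ∀ i < k, ∀ A : (cubeComplex n).Table, (cubeComplex n).CompositeLE i A →
      (cubeComplex (n + 1)).CompositeLE k (cyl A))
    (σ : Bool) {A : (cubeComplex n).Table} (hA : (cubeComplex n).CompositeLE k A) {i : ℕ}
    (hi : i ≤ k) : (cubeComplex (n + 1)).CompositeLE k (side σ A i) := by
  induction i with
  | zero => exact side_zero_compositeLE σ hA
  | succ i ih =>
    cases σ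
    · obtain ⟨h₁, h₂⟩ := side_false_succ A i
      rw [h₂]
      exact .comp i _ _ h₁ (ih (by omega)) (hc i (by omega) _ (hA.d hn true i))
    · obtain ⟨h₁, h₂⟩ := side_true_succ A i
      rw [h₂]
      exact .comp i _ _ h₁ (hc i (by omega) _ (hA.d hn false i)) (ih (by omega))

/-- The whiskers in `cyl_comp` are sides of boundaries of dimension at most `k`, built from
cylinders over cells of dimension less than `k`. Hence the outer induction is on `k` and the inner
one on the composite. -/
theorem cyl_compositeLE (hn : Decomposes n) {k : ℕ} {A : (cubeComplex n).Table}
    (hA : (cubeComplex n).CompositeLE k A) : (cubeComplex (n + 1)).CompositeLE (k + 1) (cyl A) := by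
  induction k using Nat.strong_induction_on generalizing A with
  | _ k ih =>
    have hc : ∀ i < k, ∀ A : (cubeComplex n).Table, (cubeComplex n).CompositeLE i A →
        (cubeComplex (n + 1)).CompositeLE k (cyl A) := fun i hi A hA => (ih i hi hA).mono hi
    induction hA with
    | atom x hx =>
      rw [cyl_atom x]
      refine .atom _ ((dim_cons _ x).trans_le ?_)
      rw [if_pos rfl]
      exact Nat.succ_le_succ hx
    | comp j S T e cS cT hS hT =>
      -- In a degree at or above the dimension the composition is trivial.
      rcases le_or_gt k j with hj | hj
      · rwa [cS.comp_eq cT hj e]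
      · obtain ⟨h₁, h₂, h₃, h₄⟩ := cyl_comp e
        rw [h₄]
        refine .comp _ _ _ h₃ (.comp j _ _ h₁ ?_ hT) (.comp j _ _ h₂ hS ?_)
        · exact (side_compositeLE hn hc false ((cS.d hn false (j + 1)).mono hj) hj.le).mono
            (Nat.le_succ k)
        · exact (side_compositeLE hn hc true ((cT.d hn true (j + 1)).mono hj) hj.le).mono
            (Nat.le_succ k)

theorem d_side_zero (σ α : Bool) (k : ℕ) (X : (cubeComplex n).Table) :
    (side σ X 0).d α k = side σ (X.d α k) 0 := by
  refine table_ext fun β m ε c => ?_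
  simp only [has_side, has_d]
  grind

/-- According to its first letter, an atom of the larger cube is a cylinder over an atom or an atom
in one end. The boundary of a cylinder is a side, which is handled by `side_compositeLE`. -/
theorem decomposes (n : ℕ) : Decomposes n := by
  induction n with
  | zero =>
    intro x α i
    have h : ∀ c : Fin 0 → SignType, (cubeComplex 0).dim c ≤ i := fun c => by
      change (Finset.univ.filter (fun j => c j = 0)).card ≤ i
      simp
    rw [atom_d x (h x)]
    exact .atom x (h x)
  | succ n ih =>
    intro (x : Fin (n + 1) → SignType) α i
    rw [← Fin.cons_self_tail x]
    by_cases h : x 0 = 0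
    · rw [h, ← cyl_atom, d_cyl]
      exact side_compositeLE ih (fun j hj A hA => (cyl_compositeLE ih hA).mono hj) α
        (ih _ α i) le_rfl
    · obtain ⟨σ, hσ⟩ : ∃ σ, x 0 = sgn σ := by
        revert h
        generalize x 0 = ε
        revert ε
        decide
      rw [hσ, ← side_atom, d_side_zero]
      exact side_zero_compositeLE σ (ih _ α i)

/-- The tables of the cells of a cube are composites of atoms. -/
theorem composite_of_generated {T : (cubeComplex n).tables.carrier}
    (hT : (cubeComplex n).tables.Generated (fun T => ∃ x, T = (cubeComplex n).atom x) T) :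
    (cubeComplex n).Composite T := by
  induction hT with
  | of T h =>
    obtain ⟨x, rfl⟩ := h
    exact .atom x
  | d α k T _ ih =>
    obtain ⟨l, hl⟩ := ih.exists_compositeLE
    exact (hl.d (decomposes n) α k).composite
  | comp k S T h _ _ ihS ihT => exact .comp k S T h ihS ihT

end CubeTable

/-! ### The corners of a cell of a cube -/

namespace CubeTable

open FaceComplex OmegaCat

variable {n : ℕ}

/-- The words `p` and `q` are the initial and final vertices of `T`. -/
structure Corners (T : (cubeComplex n).Table) (p q : Fin n → SignType) : Prop where
  source : ∀ c, Has T false 0 c ↔ c = p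
  target : ∀ c, Has T true 0 c ↔ c = q
  bounds : ∀ {α m c}, Has T α m c → ∀ i, p i ≤ c i ∧ c i ≤ q i ∧ (c i = 0 → p i = -1 ∧ q i = 1)

theorem dim_eq_zero_iff (c : Fin n → SignType) : (cubeComplex n).dim c = 0 ↔ ∀ i, c i ≠ 0 := by
  change (Finset.univ.filter (fun i => c i = 0)).card = 0 ↔ _
  simp [Finset.filter_eq_empty_iff]

theorem zerosBefore_eq_zero {c : Fin n → SignType} (h : ∀ i, c i ≠ 0) (i : Fin n) :
    zerosBefore c i = 0 := by
  simp [zerosBefore, h]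

/-- A vertex has no zeros, so every position count in the sign rule is `0`, and all zeros of `x` are
replaced by the same sign. -/
theorem corners_atom (x : Fin n → SignType) : Corners ((cubeComplex n).atom x)
    (fun i => if x i = 0 then -1 else x i) (fun i => if x i = 0 then 1 else x i) := by
  have key : ∀ α c, Has ((cubeComplex n).atom x) α 0 c ↔
      c = fun i => if x i = 0 then sgn α else x i := by
    intro α c
    have hs : (-1 : SignType) ^ (0 + 1 + if α = true then 1 else 0) = sgn α := by
      cases α <;> simp [sgn]
    have hs' : sgn α ≠ 0 := by cases α <;> decide
    rw [has_atom, dim_eq_zero_iff]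
    constructor
    · rintro ⟨h₁, h₂, h₃⟩
      funext i
      have h₄ := h₃ i
      rw [zerosBefore_eq_zero h₂, hs] at h₄
      split_ifs with h
      · exact h₄ h (h₂ i)
      · exact (h₁ i).resolve_left h
    · rintro rfl
      have h₂ : ∀ i, (if x i = 0 then sgn α else x i) ≠ 0 := fun i => by
        split_ifs with h
        · exact hs'
        · exact h
      refine ⟨fun i => ?_, h₂, fun i hi _ => ?_⟩
      · by_cases h : x i = 0
        · exact .inl h
        · exact .inr (if_neg h)
      · rw [zerosBefore_eq_zero h₂, hs]
        exact if_pos hi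
  refine ⟨key false, key true, fun {α m c} hc i => ?_⟩
  have h := (has_atom.1 hc).1 i
  revert h
  generalize x i = a, c i = b
  revert a b
  decide

theorem Corners.le {T : (cubeComplex n).Table} {p q : Fin n → SignType} (h : Corners T p q)
    (i : Fin n) : p i ≤ q i :=
  (h.bounds ((h.source p).2 rfl) i).2.1

theorem Corners.trans {S T : (cubeComplex n).Table} {p q p' q' : Fin n → SignType}
    (hS : Corners S p q) (hT : Corners T p' q') (h : S.d true 0 = T.d false 0) : q = p' := by
  rw [← hT.source]
  unfold Has
  rw [← Table.eq_at h]
  exact (hS.target q).2 rfl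

theorem exists_corners {T : (cubeComplex n).Table} (hT : (cubeComplex n).Composite T) :
    ∃ p q, Corners T p q := by
  induction hT with
  | atom x => exact ⟨_, _, corners_atom x⟩
  | comp k S T e _ _ hS hT =>
    obtain ⟨p, q, h⟩ := hS
    obtain ⟨p', q', h'⟩ := hT
    rcases Nat.eq_zero_or_pos k with rfl | hk
    -- In degree `0` the two paths are concatenated at the vertex `q`. The order of the corners
    -- carries the bounds of either factor over to the outer corners.
    · obtain rfl := h.trans h' e
      refine ⟨p, q', fun c => ?_, fun c => ?_, fun {α m c} hc i => ?_⟩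
      · simp [has_comp, h.source]
      · simp [has_comp, h'.target]
      · have l := h.le i
        have l' := h'.le i
        rcases Table.mem_comp hc with hc | hc
        · obtain ⟨h₁, h₂, h₃⟩ := h.bounds hc i
          refine ⟨h₁, h₂.trans l', fun h₀ => ⟨(h₃ h₀).1, ?_⟩⟩
          rw [(h₃ h₀).2] at l'
          revert l'
          generalize q' i = a
          revert a
          decide
        · obtain ⟨h₁, h₂, h₃⟩ := h'.bounds hc i
          refine ⟨l.trans h₁, h₂, fun h₀ => ⟨?_, (h₃ h₀).2⟩⟩
          rw [(h₃ h₀).1] at l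
          revert l
          generalize p i = a
          revert a
          decide
    · have e' : ∀ α c, Has S α 0 c ↔ Has T α 0 c := fun α c => by
        unfold Has
        rw [Table.eq_of_lt e hk]
      obtain rfl : p' = p := by rw [← h.source, e', h'.source]
      obtain rfl : q' = q := by rw [← h.target, e', h'.target]
      refine ⟨p', q', fun c => ?_, fun c => ?_, fun {α m c} hc i => ?_⟩
      · simp [has_comp, h.source, hk, hk.ne]
      · simp [has_comp, h.target, hk, hk.ne]
      · rcases Table.mem_comp hc with hc | hc
        · exact h.bounds hc i
        · exact h'.bounds hc i

/-- A letter `0` in any face would make the initial and final vertices differ in that position. -/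
theorem Corners.dim_le_zero {T : (cube n).carrier} {p : Fin n → SignType}
    (h : Corners T.1 p p) : (cube n).dim T ≤ 0 := by
  refine omega_dim_le_zero (fun α m => Set.eq_empty_of_forall_notMem fun c hc => ?_)
    (Set.ext fun c => (h.target c).trans (h.source c).symm)
  have hd := T.1.dim_eq _ _ _ hc
  have : (cubeComplex n).dim c = 0 := (dim_eq_zero_iff c).2 fun i hi => by
    have h' := (h.bounds hc i).2.2 hi
    rw [h'.1] at h'
    exact absurd h'.2 (by decide)
  omega

theorem Corners.ne {T : (cube n).carrier} {p q : Fin n → SignType}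
    (h : Corners T.1 p q) (hT : 1 ≤ (cube n).dim T) : p ≠ q := by
  rintro rfl
  have := h.dim_le_zero
  omega

theorem exists_corners_cell (T : (cube n).carrier) : ∃ p q, Corners T.1 p q :=
  exists_corners (composite_of_generated T.2)

/-- The cells of a cube are composites of the cells of faces. -/
theorem compGen_cube (T : (cube n).carrier) :
    (cube n).CompGen (fun y => ∃ a, y = (cubeComplex n).cell a) T := by
  obtain ⟨T, hT⟩ := T
  have := composite_of_generated hT
  suffices h : ∃ h, (cube n).CompGen (fun y => ∃ a, y = (cubeComplex n).cell a) ⟨T, h⟩ from h.2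
  clear hT
  induction this with
  | atom x => exact ⟨_, .of _ ⟨x, rfl⟩⟩
  | comp k S T e _ _ hS hT =>
    obtain ⟨hS', hS⟩ := hS
    obtain ⟨hT', hT⟩ := hT
    exact ⟨_, CompGen.comp (C := cube n) k ⟨S, hS'⟩ ⟨T, hT'⟩ (Subtype.ext e) hS hT⟩

end CubeTable

/-! ### From cubes to simplices -/

namespace CubeTable

open FaceComplex OmegaCat

variable {n : ℕ}

theorem dim_simplexToCube (σ : (simplexComplex n).Face) :
    (cubeComplex (n + 1)).dim (simplexToCube σ) = (simplexComplex n).dim σ + 1 := by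
  rw [SimplexFace.dim_add_one]
  change (Finset.univ.filter (fun i => (if i ∈ σ.1 then (0 : SignType) else -1) = 0)).card = _
  congr 1
  ext i
  by_cases h : i ∈ σ.1 <;> simp [h]

theorem simplexToCube_injective :
    Function.Injective (simplexToCube : (simplexComplex n).Face → Fin (n + 1) → SignType) := by
  intro σ τ h
  refine Subtype.ext (Finset.ext fun i => ?_)
  have h' := congrFun h i
  unfold simplexToCube at h'
  by_cases h₁ : i ∈ σ.1 <;> by_cases h₂ : i ∈ τ.1 <;> simp_all

theorem exists_simplexToCube {c : Fin (n + 1) → SignType} (h : ∀ i, c i ≠ 1) (h' : ∃ i, c i = 0) :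
    ∃ σ, simplexToCube σ = c := by
  obtain ⟨j, hj⟩ := h'
  refine ⟨⟨Finset.univ.filter (fun i => c i = 0), j, by simpa using hj⟩, funext fun i => ?_⟩
  have hi := h i
  unfold simplexToCube
  simp only [Finset.mem_filter, Finset.mem_univ, true_and]
  revert hi
  generalize c i = a
  revert a
  decide

theorem simplexToCube_ne_one (σ : (simplexComplex n).Face) (i : Fin (n + 1)) :
    simplexToCube σ i ≠ 1 := by
  unfold simplexToCube
  split_ifs <;> decide

/-- The part of a table of the cube that corresponds to the faces of the simplex. -/
def toSimplex (T : (cubeComplex (n + 1)).Table) : (simplexComplex n).Table where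
  val α m := {σ | Has T α (m + 1) (simplexToCube σ)}
  dim_eq α m σ h := by
    have := T.dim_eq _ _ _ h
    rw [dim_simplexToCube] at this
    omega
  finite := by
    obtain ⟨N, hN⟩ := T.finite
    refine ⟨N, fun α m hm => Set.eq_empty_of_forall_notMem fun σ h => ?_⟩
    have h' : simplexToCube σ ∈ T.val α (m + 1) := h
    rw [hN _ _ (by omega)] at h'
    exact h'

theorem mem_toSimplex {T : (cubeComplex (n + 1)).Table} {α : Bool} {m : ℕ}
    {σ : (simplexComplex n).Face} :
    σ ∈ (toSimplex T).val α m ↔ Has T α (m + 1) (simplexToCube σ) := Iff.rfl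

theorem toSimplex_d (T : (cubeComplex (n + 1)).Table) (α : Bool) (k : ℕ) :
    toSimplex (T.d α (k + 1)) = (toSimplex T).d α k := by
  ext β m σ
  rw [mem_toSimplex, has_d]
  rcases lt_trichotomy m k with h | rfl | h
  · rw [Table.d_val_lt _ h, mem_toSimplex]
    simp [h, h.ne]
  · rw [Table.d_val_eq, mem_toSimplex]
    simp
  · rw [Table.d_val_gt _ h]
    simp [h.ne', h.not_gt]

theorem toSimplex_comp (S T : (cubeComplex (n + 1)).Table) (k : ℕ) :
    toSimplex (S.comp (k + 1) T) = (toSimplex S).comp k (toSimplex T) := by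
  ext β m σ
  rw [mem_toSimplex, has_comp]
  rcases lt_trichotomy m k with h | rfl | h
  · rw [Table.comp_val_lt _ _ h, mem_toSimplex]
    simp [h, h.ne, h.not_gt]
  · cases β
    · rw [Table.comp_val_source, mem_toSimplex]
      simp
    · rw [Table.comp_val_target, mem_toSimplex]
      simp
  · rw [Table.comp_val_gt _ _ h, Set.mem_union, mem_toSimplex, mem_toSimplex]
    simp [h, h.ne', h.not_gt]

theorem simplexToCube_eq_zero {σ : (simplexComplex n).Face} {i : Fin (n + 1)} :
    simplexToCube σ i = 0 ↔ i ∈ σ.1 := by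
  unfold simplexToCube
  split_ifs with h <;> simp [h]

theorem simplexToCube_of_notMem {σ : (simplexComplex n).Face} {i : Fin (n + 1)} (h : i ∉ σ.1) :
    simplexToCube σ i = -1 := if_neg h

theorem zerosBefore_simplexToCube (σ : (simplexComplex n).Face) (i : Fin (n + 1)) :
    zerosBefore (simplexToCube σ) i = (σ.1.filter (· < i)).card := by
  unfold zerosBefore
  congr 1
  ext j
  simp [simplexToCube_eq_zero, and_comm]

/-- A vertex of `x` missing in `σ` is a letter `0` replaced by `-`, and the zeros before it are the
vertices of `σ` below it. The sign is `-` exactly when their number has the parity demanded in the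
simplex. -/
theorem has_simplexToCube_atom {x σ : (simplexComplex n).Face} {α : Bool} {m : ℕ} :
    Has ((cubeComplex (n + 1)).atom (simplexToCube x)) α (m + 1) (simplexToCube σ) ↔
      σ ∈ ((simplexComplex n).atom x).val α m := by
  rw [simplex_mem_atom, has_atom, dim_simplexToCube, SimplexFace.dim_add_one]
  refine and_congr ?_ (and_congr Iff.rfl (forall_congr' fun i => ?_))
  · refine forall_congr' fun i => ?_
    by_cases hx : i ∈ x.1
    · simp [simplexToCube_eq_zero, hx]
    · rw [simplexToCube_of_notMem hx]
      by_cases hσ : i ∈ σ.1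
      · simp [simplexToCube_eq_zero.2 hσ, hx, hσ]
      · simp [simplexToCube_of_notMem hσ, hσ]
  · rw [Ne, simplexToCube_eq_zero, simplexToCube_eq_zero]
    refine imp_congr Iff.rfl (forall_congr' fun hσ => ?_)
    rw [simplexToCube_of_notMem hσ, zerosBefore_simplexToCube]
    generalize (σ.1.filter (· < i)).card = z
    have e₁ : (-1 : SignType) ≠ 1 := by decide
    rcases Nat.even_or_odd z with hz | hz
    · cases α <;> simp [pow_succ, hz.neg_one_pow, hz, Nat.not_odd_iff_even.2 hz, e₁]
    · cases α <;> simp [pow_succ, hz.neg_one_pow, hz, Nat.not_even_iff_odd.2 hz, e₁]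

theorem toSimplex_atom (x : (simplexComplex n).Face) :
    toSimplex ((cubeComplex (n + 1)).atom (simplexToCube x)) = (simplexComplex n).atom x := by
  ext α m σ
  exact has_simplexToCube_atom

/-- The `ω`-functor from the paths of the cube to the tables of the simplex. -/
def pathToSimplex (n : ℕ) :
    (cube (n + 1)).path (cube_nonContracting (n + 1)) ⟶ (simplexComplex n).tables where
  toFun T := toSimplex T.1.1
  map_d α k T := toSimplex_d T.1.1 α k
  map_comp k S T h := by
    have h' : S.1.1.d true (k + 1) = T.1.1.d false (k + 1) :=
      congrArg (fun X : ((cube (n + 1)).path (cube_nonContracting (n + 1))).carrier => X.1.1) h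
    exact ⟨(toSimplex_d S.1.1 true k).symm.trans
      ((congrArg toSimplex h').trans (toSimplex_d T.1.1 false k)), toSimplex_comp S.1.1 T.1.1 k⟩

/-- Choose a letter `i` in which `S` moves. A face of `T` lies above `q` and could have the letter
`0` at `i` only if `q i = -1`; so its letter there is `+`, and it is not of the form `simplexToCube
σ`. -/
theorem toSimplex_comp_zero {S T : (cubeComplex (n + 1)).Table} {p q r : Fin (n + 1) → SignType}
    (hS : Corners S p q) (hT : Corners T q r) (hpq : p ≠ q) :
    toSimplex (S.comp 0 T) = toSimplex S := by
  obtain ⟨i, hi⟩ := Function.ne_iff.1 hpq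
  ext α m σ
  rw [mem_toSimplex, mem_toSimplex, has_comp]
  simp only [Nat.not_lt_zero, Nat.succ_ne_zero, Nat.succ_pos, false_and, true_and, false_or]
  refine ⟨fun h => h.resolve_right fun hc => ?_, .inl⟩
  have h₁ := hS.le i
  obtain ⟨h₂, -, h₃⟩ := hT.bounds hc i
  have h₄ := fun h => (h₃ h).1
  have h₅ := simplexToCube_ne_one σ i
  clear h₃
  revert h₁ h₂ h₄ h₅ hi
  generalize simplexToCube σ i = a, p i = b, q i = c
  revert a b c
  decide

theorem pathToSimplex_germStep
    {S T : ((cube (n + 1)).path (cube_nonContracting (n + 1))).carrier}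
    (h : (cube (n + 1)).GermStep (cube_nonContracting (n + 1)) S T) :
    Hom.toFun (pathToSimplex n) S = Hom.toFun (pathToSimplex n) T := by
  obtain ⟨Y, e, hT⟩ := h
  obtain ⟨p, q, hS⟩ := exists_corners_cell S.1
  obtain ⟨p', q', hY⟩ := exists_corners_cell Y.1
  obtain rfl := hS.trans hY (congrArg Subtype.val e)
  have hT' : T.1.1 = S.1.1.comp 0 Y.1.1 := congrArg Subtype.val hT
  exact (toSimplex_comp_zero hS hY (hS.ne S.2)).symm.trans (congrArg toSimplex hT').symm

end CubeTable

/-! ### The comparison of semi-path omega-categories of cubes with orientals -/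

namespace OmegaCat

/-- A bijective `ω`-functor is an isomorphism. -/
noncomputable def isoOfBijective {C D : OmegaCat.{u}} (f : C ⟶ D)
    (hf : Function.Bijective (Hom.toFun f)) : C ≅ D where
  hom := f
  inv :=
    { toFun := (Equiv.ofBijective _ hf).symm
      map_d := fun α n x => hf.1 (by
        rw [Hom.map_d]
        simp only [Equiv.ofBijective_apply_symm_apply])
      map_comp := fun n x y h => by
        have hx := (Equiv.ofBijective _ hf).apply_symm_apply x
        have hy := (Equiv.ofBijective _ hf).apply_symm_apply y
        have h' : C.d true n ((Equiv.ofBijective _ hf).symm x) =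
            C.d false n ((Equiv.ofBijective _ hf).symm y) := hf.1 (by
          rw [Hom.map_d, Hom.map_d]
          exact (congrArg _ hx).trans (h.trans (congrArg _ hy).symm))
        refine ⟨h', hf.1 ?_⟩
        obtain ⟨h'', e⟩ := Hom.map_comp f n _ _ h'
        rw [e]
        exact ((Equiv.ofBijective _ hf).apply_symm_apply _).trans (D.comp_congr hx.symm hy.symm _ _) }
  hom_inv_id := hom_ext fun x => (Equiv.ofBijective _ hf).symm_apply_apply x
  inv_hom_id := hom_ext fun x => (Equiv.ofBijective _ hf).apply_symm_apply x

end OmegaCat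

namespace CubeTable

open FaceComplex OmegaCat

variable {n : ℕ}

theorem Corners.eq_of_d_eq_atom {T : (cubeComplex n).Table} {p q : Fin n → SignType}
    (hT : Corners T p q)
    (h : T.d false 0 = (cubeComplex n).atom (fun _ : Fin n => (-1 : SignType))) :
    p = fun _ => -1 := by
  have h₁ := (corners_atom (fun _ : Fin n => (-1 : SignType))).source p
  rw [← h, has_d, hT.source] at h₁
  simpa using h₁

theorem Corners.d_eq_atom {T : (cubeComplex n).Table} {q : Fin n → SignType}
    (hT : Corners T (fun _ => -1) q) :
    T.d false 0 = (cubeComplex n).atom (fun _ : Fin n => (-1 : SignType)) := by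
  have hb := corners_atom (fun _ : Fin n => (-1 : SignType))
  ext α m c
  refine Iff.trans (b := m = 0 ∧ c = fun _ => (-1 : SignType)) ?_ ?_
  · refine (has_d (T := T) (α := false) (β := α) (k := 0) (m := m) (c := c)).trans ?_
    simp only [Nat.not_lt_zero, false_and, false_or]
    refine and_congr_right fun hm => ?_
    rw [hm]
    exact hT.source c
  constructor
  · rintro ⟨rfl, rfl⟩
    cases α
    · exact (hb.source _).2 (by simp)
    · exact (hb.target _).2 (by simp)
  · intro h
    have h₁ := fun i => hb.bounds h i
    have hc : c = fun _ => (-1 : SignType) :=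
      funext fun i => le_antisymm (by simpa using (h₁ i).2.1) (by simp)
    refine ⟨?_, hc⟩
    have h₂ := Table.dim_eq _ _ _ _ h
    rw [← h₂, hc]
    exact (dim_eq_zero_iff _).2 fun i => by decide

theorem Corners.eq_of_d_eq {T : (cubeComplex n).Table} {p q : Fin n → SignType}
    (hT : Corners T p q) (h : T.d true 0 = T) : p = q := by
  refine (hT.target p).1 ?_
  have := (hT.source p).2 rfl
  rw [← h, has_d] at this
  simpa using this

theorem initial_eq (T : (cube n).carrier) (h : (cube n).d false 0 T = cubeBase n)
    {p q : Fin n → SignType} (hT : Corners T.1 p q) : p = fun _ => -1 :=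
  hT.eq_of_d_eq_atom (congrArg Subtype.val h)

theorem source_eq_cubeBase (T : (cube n).carrier) {q : Fin n → SignType}
    (hT : Corners T.1 (fun _ => -1) q) : (cube n).d false 0 T = cubeBase n :=
  Subtype.ext hT.d_eq_atom

theorem corners_cell (σ : (simplexComplex n).Face) :
    Corners ((cubeComplex (n + 1)).atom (simplexToCube σ)) (fun _ => -1)
      (fun i => if i ∈ σ.1 then 1 else -1) := by
  have h := corners_atom (simplexToCube σ)
  convert h using 2 with i i
  · by_cases hi : i ∈ σ.1
    · simp [simplexToCube_eq_zero.2 hi]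
    · simp [simplexToCube_of_notMem hi]
  · by_cases hi : i ∈ σ.1
    · simp [simplexToCube_eq_zero.2 hi, hi]
    · simp [simplexToCube_of_notMem hi, hi]

theorem one_le_dim_of_corners {T : (cube n).carrier} {p q : Fin n → SignType}
    (h : Corners T.1 p q) (hpq : p ≠ q) : 1 ≤ (cube n).dim T := by
  by_contra h'
  exact hpq (h.eq_of_d_eq (congrArg Subtype.val
    ((cube n).d_eq_self_of_dim_le (x := T) (n := 0) (by omega) true)))

theorem one_le_dim_cell (σ : (simplexComplex n).Face) :
    1 ≤ (cube (n + 1)).dim ((cubeComplex (n + 1)).cell (simplexToCube σ)) := by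
  refine one_le_dim_of_corners (T := (cubeComplex (n + 1)).cell (simplexToCube σ))
    (corners_cell σ) ?_
  obtain ⟨i, hi⟩ := σ.2
  refine Function.ne_iff.2 ⟨i, ?_⟩
  simp [hi]

theorem source_cell (σ : (simplexComplex n).Face) :
    (cube (n + 1)).d false 0 ((cubeComplex (n + 1)).cell (simplexToCube σ)) = cubeBase (n + 1) :=
  source_eq_cubeBase _ (corners_cell σ)

/-- The germ of the face of the cube that corresponds to a face of the simplex. -/
noncomputable def faceGerm (σ : (simplexComplex n).Face) : (cubeSemiPath (n + 1)).carrier :=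
  (cube (n + 1)).germ (cube_nonContracting (n + 1)) ((cubeComplex (n + 1)).cell (simplexToCube σ))
    (one_le_dim_cell σ) (source_cell σ)

theorem exists_semiPathToSimplex (n : ℕ) :
    ∃ F : (cube (n + 1)).semiPath (cube_nonContracting (n + 1)) ⟶ (simplexComplex n).tables,
      ∀ x, Hom.toFun F (Hom.toFun ((cube (n + 1)).toSemiPath (cube_nonContracting (n + 1))) x) =
        Hom.toFun (pathToSimplex n) x := by
  obtain ⟨F, hF⟩ := (cube (n + 1)).exists_semiPath_desc (cube_nonContracting (n + 1))
    (pathToSimplex n) (fun _ _ h => pathToSimplex_germStep h)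
  refine ⟨F, fun x => ?_⟩
  rw [← hF]
  rfl

/-- The `ω`-functor from the semi-paths of the cube to the tables of the simplex. -/
noncomputable def semiPathToSimplex (n : ℕ) : cubeSemiPath (n + 1) ⟶ (simplexComplex n).tables where
  toFun z := Hom.toFun (exists_semiPathToSimplex n).choose z.1
  map_d α k z := Hom.map_d (exists_semiPathToSimplex n).choose α k z.1
  map_comp k z w h :=
    Hom.map_comp (exists_semiPathToSimplex n).choose k z.1 w.1 (congrArg Subtype.val h)

theorem semiPathToSimplex_germ (x : (cube (n + 1)).carrier) (hx : 1 ≤ (cube (n + 1)).dim x)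
    (hs : (cube (n + 1)).d false 0 x = cubeBase (n + 1)) :
    Hom.toFun (semiPathToSimplex n) ((cube (n + 1)).germ (cube_nonContracting (n + 1)) x hx hs) =
      toSimplex x.1 :=
  (exists_semiPathToSimplex n).choose_spec ⟨x, hx⟩

theorem semiPathToSimplex_faceGerm (σ : (simplexComplex n).Face) :
    Hom.toFun (semiPathToSimplex n) (faceGerm σ) = (simplexComplex n).atom σ :=
  (semiPathToSimplex_germ _ _ _).trans (toSimplex_atom σ)

/-- The word has one zero for each vertex of `σ`, that is one more than `dim σ`, and passing to
paths lowers the degree by one. -/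
theorem dim_faceGerm (σ : (simplexComplex n).Face) :
    (cubeSemiPath (n + 1)).dim (faceGerm σ) ≤ (simplexComplex n).dim σ := by
  refine dim_le_of_d_eq_self (α := true) _ (Subtype.ext ?_)
  refine (Hom.map_d ((cube (n + 1)).toSemiPath (cube_nonContracting (n + 1))) true _ _).symm.trans
    (congrArg _ (Subtype.ext (Subtype.ext ?_)))
  exact atom_d _ (dim_simplexToCube σ).le

/-- The initial corner of a face keeps its letters `+`, so starting at the initial vertex excludes
them; positive dimension provides a letter `0`. -/
theorem exists_faceGerm (a : Fin (n + 1) → SignType) (hx : 1 ≤ (cube (n + 1)).dim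
    ((cubeComplex (n + 1)).cell a))
    (hs : (cube (n + 1)).d false 0 ((cubeComplex (n + 1)).cell a) = cubeBase (n + 1)) :
    ∃ σ, (cube (n + 1)).germ (cube_nonContracting (n + 1)) ((cubeComplex (n + 1)).cell a) hx hs =
      faceGerm σ := by
  have hc := corners_atom a
  have h₁ := initial_eq ((cubeComplex (n + 1)).cell a) hs hc
  have h₂ := Corners.ne (T := (cubeComplex (n + 1)).cell a) hc hx
  obtain ⟨σ, rfl⟩ : ∃ σ, simplexToCube σ = a := by
    refine exists_simplexToCube (fun i hi => ?_) ?_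
    · have := congrFun h₁ i
      rw [hi] at this
      revert this
      decide
    · obtain ⟨i, hi⟩ := Function.ne_iff.1 h₂
      refine ⟨i, ?_⟩
      by_contra h
      exact hi (by simp only [if_neg h])
  exact ⟨σ, rfl⟩

/-- Germs of cells of the cube are composites of germs of faces. -/
theorem compGen_germ (x : (cube (n + 1)).carrier) (hx : 1 ≤ (cube (n + 1)).dim x)
    (hs : (cube (n + 1)).d false 0 x = cubeBase (n + 1)) :
    (cubeSemiPath (n + 1)).CompGen (fun y => ∃ σ, y = faceGerm σ)
      ((cube (n + 1)).germ (cube_nonContracting (n + 1)) x hx hs) := by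
  induction compGen_cube x with
  | of x h =>
    obtain ⟨a, rfl⟩ := h
    exact .of _ (exists_faceGerm a hx hs)
  | comp k x y h _ _ ihx ihy =>
    -- Factors of dimension `0` are not paths and have no germ, but they are identities in every
    -- degree and drop out.
    by_cases hx' : (cube (n + 1)).dim x ≤ 0
    · have e := comp_eq_right h (hx'.trans (Nat.zero_le k))
      simp only [e] at hx hs ⊢
      exact ihy hx hs
    by_cases hy' : (cube (n + 1)).dim y ≤ 0
    · have e := comp_eq_left h (hy'.trans (Nat.zero_le k))
      simp only [e] at hx hs ⊢
      exact ihx hx hs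
    have dx : 1 ≤ (cube (n + 1)).dim x := by omega
    have dy : 1 ≤ (cube (n + 1)).dim y := by omega
    rcases k with _ | k
    · have sx : (cube (n + 1)).d false 0 x = cubeBase (n + 1) := by
        rwa [(cube (n + 1)).d_source] at hs
      -- A composite in degree `0` has the germ of its first factor. The second factor, which need
      -- not start at the initial vertex, is never examined.
      have e : (cube (n + 1)).germ (cube_nonContracting (n + 1)) x dx sx =
          (cube (n + 1)).germ (cube_nonContracting (n + 1)) _ hx hs :=
        Subtype.ext (toSemiPath_eq_of_germStep ⟨⟨y, dy⟩, h, rfl⟩)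
      rw [← e]
      exact ihx dx sx
    · obtain ⟨e₁, e₂⟩ := d_comp_of_lt (Nat.succ_pos k) h false
      have sx := e₁.symm.trans hs
      have sy := e₂.symm.trans hs
      obtain ⟨h', e⟩ := Hom.map_comp ((cube (n + 1)).toSemiPath (cube_nonContracting (n + 1))) k
        ⟨x, dx⟩ ⟨y, dy⟩ (Subtype.ext h)
      have e' : (cube (n + 1)).germ (cube_nonContracting (n + 1)) _ hx hs =
          (cubeSemiPath (n + 1)).comp k
            ((cube (n + 1)).germ (cube_nonContracting (n + 1)) x dx sx)
            ((cube (n + 1)).germ (cube_nonContracting (n + 1)) y dy sy) (Subtype.ext h') :=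
        Subtype.ext e
      rw [e']
      exact .comp k _ _ _ (ihx dx sx) (ihy dy sy)

/-- The semi-paths of the cube, as an `ω`-category over the simplex. -/
noncomputable def atomicOver (n : ℕ) : SimplexFace.AtomicOver n where
  E := cubeSemiPath (n + 1)
  π := semiPathToSimplex n
  g := faceGerm
  π_g := semiPathToSimplex_faceGerm
  dim_g := dim_faceGerm
  gen x := CompGen.trans (by
    rintro _ ⟨x, hx, hs, rfl⟩
    exact compGen_germ x hx hs) ((cube (n + 1)).compGen_semiPathAt (cube_nonContracting (n + 1)) x)

/-- The `ω`-functor from the semi-paths of the cube to the oriental. -/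
noncomputable def semiPathToOriental (n : ℕ) : cubeSemiPath (n + 1) ⟶ oriental n where
  toFun x := ⟨Hom.toFun (semiPathToSimplex n) x,
    SimplexFace.AtomicOver.generated_of_composite ((atomicOver n).composite_tab x)⟩
  map_d α k x := Subtype.ext (Hom.map_d (semiPathToSimplex n) α k x)
  map_comp k x y h := by
    obtain ⟨h', e⟩ := Hom.map_comp (semiPathToSimplex n) k x y h
    exact ⟨Subtype.ext h', Subtype.ext e⟩

/-- Both halves are instances of the general results for `ω`-categories generated by one cell over
each face. -/
theorem semiPathToOriental_bijective (n : ℕ) :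
    Function.Bijective (Hom.toFun (semiPathToOriental n)) := by
  constructor
  · intro x y h
    exact (atomicOver n).tab_injective (congrArg Subtype.val h)
  · intro T
    obtain ⟨x, hx⟩ := (atomicOver n).exists_tab_eq T.2
    exact ⟨x, Subtype.ext hx⟩

/-- The isomorphism between the semi-paths of the cube and the oriental. -/
noncomputable def semiPathIso (n : ℕ) : cubeSemiPath (n + 1) ≅ oriental n :=
  isoOfBijective (semiPathToOriental n) (semiPathToOriental_bijective n)

end CubeTable

/-! ### Functoriality -/

namespace CubeTable

open FaceComplex OmegaCat

/-- A map of faces of cubes that lies over a monotone map of vertices of simplices. -/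
structure LiesOver {m l : ℕ} (f : (Fin (m + 1) → SignType) → Fin (l + 1) → SignType)
    (g : Fin (m + 1) →o Fin (l + 1)) : Prop where
  exists_one : ∀ a i, a i = 1 → ∃ j, f a j = 1
  ne_zero : ∀ a, (∀ i, a i ≠ 0) → ∀ j, f a j ≠ 0
  base : f (fun _ => -1) = fun _ => -1
  face : ∀ σ : (simplexComplex m).Face, f (simplexToCube σ) = simplexToCube (simplexMap g σ)

variable {m l : ℕ} {f : (Fin (m + 1) → SignType) → Fin (l + 1) → SignType}
  {g : Fin (m + 1) →o Fin (l + 1)}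

/-- Since letters `+` survive under `f`, a face whose image has no letter `+` has none itself;
positive dimension then makes it a face of the simplex, where `f` is given by `g`. -/
theorem LiesOver.toSimplex_mapTable (h : LiesOver f g) (T : (cubeComplex (m + 1)).Table) :
    toSimplex (mapTable (K := cubeComplex (m + 1)) (L := cubeComplex (l + 1)) f T) =
      mapTable (simplexMap g) (toSimplex T) := by
  ext α k σ
  constructor
  · rintro ⟨hd, a, ha, e⟩
    rw [dim_simplexToCube] at hd
    have hz : ∃ i, (a : Fin (m + 1) → SignType) i = 0 := by
      by_contra! hz
      have h₁ := (dim_eq_zero_iff a).2 hz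
      have h₂ := T.dim_eq _ _ _ ha
      omega
    obtain ⟨τ, rfl⟩ := exists_simplexToCube (fun i hi => by
      obtain ⟨j, hj⟩ := h.exists_one a i hi
      exact simplexToCube_ne_one σ j ((congrFun e j).symm.trans hj)) hz
    refine ⟨by omega, τ, ha, simplexToCube_injective ?_⟩
    rw [← h.face]
    exact e
  · rintro ⟨hd, τ, hτ, rfl⟩
    exact ⟨by rw [dim_simplexToCube, hd], simplexToCube τ, hτ, h.face τ⟩

/-- The `ω`-functor that is induced by a map of faces of cubes. -/
abbrev cubeMap (hf : ∀ x, mapTable (K := cubeComplex (m + 1)) (L := cubeComplex (l + 1)) f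
    ((cubeComplex (m + 1)).atom x) = (cubeComplex (l + 1)).atom (f x)) :
    cube (m + 1) ⟶ cube (l + 1) :=
  mapOmega (K := cubeComplex (m + 1)) (L := cubeComplex (l + 1)) f hf

variable {hf : ∀ x, mapTable (K := cubeComplex (m + 1)) (L := cubeComplex (l + 1)) f
  ((cubeComplex (m + 1)).atom x) = (cubeComplex (l + 1)).atom (f x)}

theorem LiesOver.source_eq (h : LiesOver f g) {x : (cube (m + 1)).carrier}
    (hs : (cube (m + 1)).d false 0 x = cubeBase (m + 1)) :
    (cube (l + 1)).d false 0 (Hom.toFun (cubeMap hf) x) = cubeBase (l + 1) := by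
  refine (Hom.map_d (cubeMap hf) false 0 x).symm.trans ((congrArg _ hs).trans ?_)
  refine (mapOmega_cell (K := cubeComplex (m + 1)) (L := cubeComplex (l + 1)) f hf
    (fun _ : Fin (m + 1) => (-1 : SignType))).trans ?_
  exact congrArg (cubeComplex (l + 1)).cell h.base

/-- The final vertex of `x` has a letter `+`. Its image is the final vertex of the image and still
has one, so the image does not end at the initial vertex where it starts. -/
theorem LiesOver.one_le_dim (h : LiesOver f g) {x : (cube (m + 1)).carrier}
    (hx : 1 ≤ (cube (m + 1)).dim x)
    (hs : (cube (m + 1)).d false 0 x = cubeBase (m + 1)) :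
    1 ≤ (cube (l + 1)).dim (Hom.toFun (cubeMap hf) x) := by
  obtain ⟨p, q, hc⟩ := exists_corners_cell x
  obtain ⟨p', q', hc'⟩ :=
    exists_corners_cell (n := l + 1) (Hom.toFun (cubeMap hf) x)
  have hq := (hc.target q).2 rfl
  have hq₀ := (dim_eq_zero_iff q).1 (x.1.dim_eq _ _ _ hq)
  have e : f q = q' := (hc'.target _).1
    ⟨(dim_eq_zero_iff _).2 (h.ne_zero q hq₀), q, hq, rfl⟩
  refine one_le_dim_of_corners hc' fun e' => ?_
  obtain ⟨i, hi⟩ := Function.ne_iff.1 (hc.ne hx)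
  rw [initial_eq x hs hc] at hi
  have hq₁ : q i = 1 := by
    have h₀ := hq₀ i
    have h₁ : (-1 : SignType) ≠ q i := hi
    revert h₀ h₁
    generalize q i = a
    revert a
    decide
  obtain ⟨j, hj⟩ := h.exists_one q i hq₁
  rw [e, ← e', initial_eq _ (h.source_eq hs) hc'] at hj
  exact absurd (show (-1 : SignType) = 1 from hj) (by decide)

/-- The `ω`-functor between semi-paths of cubes that corresponds to a monotone map of vertices. -/
noncomputable def semiPathMap (g : Fin (m + 1) →o Fin (l + 1)) :
    cubeSemiPath (m + 1) ⟶ cubeSemiPath (l + 1) :=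
  (semiPathIso m).hom ≫ orientalMap g ≫ (semiPathIso l).inv

/-- After applying the injective comparison with the oriental, the claim about germs becomes
`LiesOver.toSimplex_mapTable`. -/
theorem LiesOver.inducedBy (h : LiesOver f g) : InducedBy (cubeMap hf) (semiPathMap g) := by
  intro x hx hs
  refine ⟨h.one_le_dim hx hs, h.source_eq hs, ?_⟩
  refine (semiPathToOriental_bijective l).1 ?_
  have e : semiPathMap g ≫ (semiPathIso l).hom = (semiPathIso m).hom ≫ orientalMap g := by
    simp [semiPathMap]
  refine (congrArg (fun k => Hom.toFun k _) e).trans (Subtype.ext ?_)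
  refine (congrArg (mapTable (simplexMap g)) (semiPathToSimplex_germ x hx hs)).trans ?_
  exact (h.toSimplex_mapTable x.1).symm.trans
    (semiPathToSimplex_germ (Hom.toFun (cubeMap hf) x) (h.one_le_dim hx hs)
      (h.source_eq hs)).symm

theorem inducedBy_unique {m l : ℕ} {F : cube m ⟶ cube l} {G G' : cubeSemiPath m ⟶ cubeSemiPath l}
    (h : InducedBy F G) (h' : InducedBy F G') : G = G' :=
  semiPathAt_hom_ext fun x hx hs => by
    obtain ⟨_, _, e⟩ := h x hx hs
    obtain ⟨_, _, e'⟩ := h' x hx hs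
    exact e.trans e'.symm

/-! ### Faces and connections over cofaces and codegeneracies -/

theorem liesOver_cubeFace {n : ℕ} (i : Fin (n + 2)) :
    LiesOver (cubeFace (n := n + 1) i) (SimplexCategory.δ i).toOrderHom where
  exists_one a j hj := ⟨i.succAbove j, by simpa [cubeFace] using hj⟩
  ne_zero a ha j := by
    rcases Fin.eq_self_or_eq_succAbove i j with rfl | ⟨j, rfl⟩
    · simp [cubeFace]
    · simpa [cubeFace] using ha j
  base := by
    funext j
    rcases Fin.eq_self_or_eq_succAbove i j with rfl | ⟨j, rfl⟩ <;> simp [cubeFace]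
  face σ := by
    funext j
    have hm : ∀ j, j ∈ (simplexMap (SimplexCategory.δ i).toOrderHom σ).1 ↔
        ∃ k ∈ σ.1, i.succAbove k = j := fun j => Finset.mem_image
    rcases Fin.eq_self_or_eq_succAbove i j with rfl | ⟨j, rfl⟩
    · rw [simplexToCube_of_notMem]
      · simp [cubeFace]
      · rw [hm]
        rintro ⟨k, -, hk⟩
        exact Fin.succAbove_ne _ _ hk
    · have : i.succAbove j ∈ (simplexMap (SimplexCategory.δ i).toOrderHom σ).1 ↔ j ∈ σ.1 := by
        rw [hm]
        constructor
        · rintro ⟨k, hk, e⟩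
          rwa [← Fin.succAbove_right_injective e]
        · exact fun h => ⟨j, h, rfl⟩
      simp only [cubeFace, Fin.insertNth_apply_succAbove]
      unfold simplexToCube
      simp only [this]

theorem predAbove_cases {n : ℕ} (i : Fin (n + 1)) (k : Fin (n + 2)) :
    (∃ j ≤ i, k = j.castSucc ∧ i.predAbove k = j) ∨ ∃ j, i ≤ j ∧ k = j.succ ∧ i.predAbove k = j := by
  rcases le_or_gt k i.castSucc with h | h
  · obtain ⟨j, rfl⟩ := Fin.exists_castSucc_eq.2 (h.trans_lt (Fin.castSucc_lt_last i)).ne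
    have hj := Fin.castSucc_le_castSucc_iff.1 h
    exact .inl ⟨j, hj, rfl, Fin.predAbove_castSucc_of_le _ _ hj⟩
  · obtain ⟨j, rfl⟩ := Fin.exists_succ_eq.2 ((Fin.zero_le _).trans_lt h).ne'
    have hj := Fin.castSucc_lt_succ_iff.1 h
    exact .inr ⟨j, hj, rfl, Fin.predAbove_succ_of_le _ _ hj⟩

/-- Together with `exists_eq_cubeConnection` this says that a letter of the connection is the
maximum of the word over a fiber of `predAbove`. In this form the connection is compared with the
codegeneracy without distinguishing positions. -/
theorem le_cubeConnection {n : ℕ} (i : Fin (n + 1)) (a : Fin (n + 2) → SignType)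
    (k : Fin (n + 2)) : a k ≤ cubeConnection i a (i.predAbove k) := by
  unfold cubeConnection
  rcases predAbove_cases i k with ⟨j, hj, rfl, e⟩ | ⟨j, hj, rfl, e⟩ <;> rw [e]
  · rcases hj.lt_or_eq with h | rfl
    · rw [if_pos h]
    · rw [if_neg (lt_irrefl j), if_pos rfl]
      exact le_max_left _ _
  · rcases hj.lt_or_eq with h | rfl
    · rw [if_neg h.not_gt, if_neg h.ne']
    · rw [if_neg (lt_irrefl i), if_pos rfl]
      exact le_max_right _ _

theorem exists_eq_cubeConnection {n : ℕ} (i : Fin (n + 1)) (a : Fin (n + 2) → SignType)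
    (j : Fin (n + 1)) : ∃ k, i.predAbove k = j ∧ cubeConnection i a j = a k := by
  unfold cubeConnection
  rcases lt_trichotomy j i with h | rfl | h
  · exact ⟨j.castSucc, Fin.predAbove_castSucc_of_le _ _ h.le, if_pos h⟩
  · rw [if_neg (lt_irrefl j), if_pos rfl]
    rcases max_choice (a j.castSucc) (a j.succ) with h | h
    · exact ⟨j.castSucc, Fin.predAbove_castSucc_of_le _ _ le_rfl, h⟩
    · exact ⟨j.succ, Fin.predAbove_succ_of_le _ _ le_rfl, h⟩
  · exact ⟨j.succ, Fin.predAbove_succ_of_le _ _ h.le, by rw [if_neg h.not_gt, if_neg h.ne']⟩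

theorem liesOver_cubeConnection {n : ℕ} (i : Fin (n + 1)) :
    LiesOver (cubeConnection i) (SimplexCategory.σ i).toOrderHom where
  exists_one a k hk := by
    refine ⟨i.predAbove k, ?_⟩
    have h := le_cubeConnection i a k
    rw [hk] at h
    revert h
    generalize cubeConnection i a (i.predAbove k) = b
    revert b
    decide
  ne_zero a ha j := by
    obtain ⟨k, -, h⟩ := exists_eq_cubeConnection i a j
    rw [h]
    exact ha k
  base := by
    funext j
    obtain ⟨k, -, h⟩ := exists_eq_cubeConnection i (fun _ => -1) j
    exact h
  face σ := by
    funext j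
    obtain ⟨k, rfl, h⟩ := exists_eq_cubeConnection i (simplexToCube σ) j
    have hm : ∀ j, j ∈ (simplexMap (SimplexCategory.σ i).toOrderHom σ).1 ↔
        ∃ k ∈ σ.1, i.predAbove k = j := fun j => Finset.mem_image
    by_cases hk : k ∈ σ.1
    · rw [h, simplexToCube_eq_zero.2 hk, simplexToCube_eq_zero.2 ((hm _).2 ⟨k, hk, rfl⟩)]
    · rw [h, simplexToCube_of_notMem hk, simplexToCube_of_notMem]
      rw [hm]
      -- A vertex `k'` of `σ` in the same fiber as `k` would force the maximum to be at least `0`,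
      -- while its value is the letter `-` at `k`.
      rintro ⟨k', hk', e⟩
      have h' := le_cubeConnection i (simplexToCube σ) k'
      rw [e, h, simplexToCube_eq_zero.2 hk', simplexToCube_of_notMem hk] at h'
      exact absurd h' (by decide)

/-- The functor that sends `[n]` to the semi-paths of the cube of dimension `n + 1`. -/
noncomputable def semiPathFunctor : SimplexCategory ⥤ OmegaCat.{0} where
  obj a := cubeSemiPath (a.len + 1)
  map f := semiPathMap f.toOrderHom
  map_id a := by
    have h : orientalMap (SimplexCategory.Hom.toOrderHom (𝟙 a)) = 𝟙 _ := orientalFunctor.map_id a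
    rw [semiPathMap, h]
    simp
  map_comp {a b c} f g := by
    have h : orientalMap (SimplexCategory.Hom.toOrderHom (f ≫ g)) =
        orientalMap f.toOrderHom ≫ orientalMap g.toOrderHom := orientalFunctor.map_comp f g
    simp only [semiPathMap, h, Category.assoc, Iso.inv_hom_id_assoc]

/-- The orientals are the semi-paths of the cubes. -/
noncomputable def orientalFunctorIso : orientalFunctor ≅ semiPathFunctor :=
  NatIso.ofComponents (fun a => (semiPathIso a.len).symm) (fun {a b} f => by
    change orientalMap f.toOrderHom ≫ (semiPathIso b.len).inv =
      (semiPathIso a.len).inv ≫ semiPathMap f.toOrderHom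
    simp [semiPathMap])

theorem orientalFunctorIso_cell {n : ℕ} (σ : (simplexComplex n).Face) :
    Hom.toFun (orientalFunctorIso.hom.app (SimplexCategory.mk n)) ((simplexComplex n).cell σ) =
      faceGerm σ := by
  have h : Hom.toFun (semiPathIso n).hom (faceGerm σ) = (simplexComplex n).cell σ :=
    Subtype.ext (semiPathToSimplex_faceGerm σ)
  change Hom.toFun (semiPathIso n).inv _ = _
  rw [← h]
  exact congrArg (fun k => Hom.toFun k (faceGerm σ)) (semiPathIso n).hom_inv_id

theorem dim_cube_zero (x : (cube 0).carrier) : (cube 0).dim x ≤ 0 := by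
  obtain ⟨p, q, h⟩ := exists_corners_cell x
  obtain rfl : p = q := Subsingleton.elim _ _
  exact h.dim_le_zero

/-- The point has no paths. -/
theorem exists_inducedBy_zero {l : ℕ} (F : cube 0 ⟶ cube l) :
    ∃ G : cubeSemiPath 0 ⟶ cubeSemiPath l, InducedBy F G := by
  have empty : ∀ z : (cubeSemiPath 0).carrier, False := fun z => by
    induction (cube 0).compGen_semiPathAt (cube_nonContracting 0) z with
    | of z h =>
      obtain ⟨x, hx, -⟩ := h
      have := dim_cube_zero x
      omega
    | comp _ _ _ _ _ _ h _ => exact h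
  refine ⟨⟨fun z => (empty z).elim, fun _ _ z => (empty z).elim, fun _ z _ _ => (empty z).elim⟩,
    fun x hx _ => ?_⟩
  have := dim_cube_zero x
  omega

end CubeTable

theorem mainTheorem7 :
    (∀ (n : ℕ) (i : Fin (n + 1)),
      ∃! g : cubeSemiPath n ⟶ cubeSemiPath (n + 1), InducedBy (cubeδ i) g) ∧
    (∀ (n : ℕ) (i : Fin (n + 1)),
      ∃! g : cubeSemiPath (n + 2) ⟶ cubeSemiPath (n + 1), InducedBy (cubeγ i) g) ∧
    ∃ (q : ∀ a b : SimplexCategory,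
        (a ⟶ b) → (cubeSemiPath (a.len + 1) ⟶ cubeSemiPath (b.len + 1)))
      (q_id : ∀ a : SimplexCategory, q a a (𝟙 a) = 𝟙 (cubeSemiPath (a.len + 1)))
      (q_comp : ∀ (a b c : SimplexCategory) (f : a ⟶ b) (g : b ⟶ c),
        q a c (f ≫ g) = q a b f ≫ q b c g),
      (∀ (n : ℕ) (i : Fin (n + 2)), InducedBy (cubeδ i)
        (q (SimplexCategory.mk n) (SimplexCategory.mk (n + 1)) (SimplexCategory.δ i))) ∧
      (∀ (n : ℕ) (i : Fin (n + 1)), InducedBy (cubeγ i)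
        (q (SimplexCategory.mk (n + 1)) (SimplexCategory.mk n) (SimplexCategory.σ i))) ∧
      ∃ e : orientalFunctor ≅
          ({ obj := fun a => cubeSemiPath (a.len + 1)
             map := fun {a b} f => q a b f
             map_id := q_id
             map_comp := fun {a b c} f g => q_comp a b c f g } : SimplexCategory ⥤ OmegaCat.{0}),
        ∀ (n : ℕ) (σ : (simplexComplex n).Face),
          ∃ (hx : 1 ≤ (cube (n + 1)).dim ((cubeComplex (n + 1)).cell (simplexToCube σ)))
            (hs : (cube (n + 1)).d false 0 ((cubeComplex (n + 1)).cell (simplexToCube σ)) =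
              cubeBase (n + 1)),
            OmegaCat.Hom.toFun (e.hom.app (SimplexCategory.mk n)) ((simplexComplex n).cell σ) =
              (cube (n + 1)).germ (cube_nonContracting (n + 1))
                ((cubeComplex (n + 1)).cell (simplexToCube σ)) hx hs := by
  refine ⟨fun n i => ?_, fun n i => ?_, fun a b f => CubeTable.semiPathMap f.toOrderHom, ?_, ?_, ?_,
    ?_, ?_, ?_⟩
  · refine existsUnique_of_exists_of_unique ?_
      (fun _ _ h h' => CubeTable.inducedBy_unique h h')
    -- For `n = 0` the domain is not the semi-paths of a cube of positive dimension and corresponds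
    -- to no oriental; its fiber is empty.
    rcases n with _ | n
    · exact CubeTable.exists_inducedBy_zero _
    · exact ⟨_, (CubeTable.liesOver_cubeFace i).inducedBy (hf := cubeFace_atom i)⟩
  · exact existsUnique_of_exists_of_unique
      ⟨_, (CubeTable.liesOver_cubeConnection i).inducedBy (hf := cubeConnection_atom i)⟩
      (fun _ _ h h' => CubeTable.inducedBy_unique h h')
  · exact fun a => CubeTable.semiPathFunctor.map_id a
  · exact fun a b c f g => CubeTable.semiPathFunctor.map_comp f g
  · exact fun n i => (CubeTable.liesOver_cubeFace i).inducedBy (hf := cubeFace_atom i)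
  · exact fun n i => (CubeTable.liesOver_cubeConnection i).inducedBy (hf := cubeConnection_atom i)
  · exact CubeTable.orientalFunctorIso
  · exact fun n σ => ⟨CubeTable.one_le_dim_cell σ, CubeTable.source_cell σ,
      CubeTable.orientalFunctorIso_cell σ⟩
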